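/- Let $\mathbb{F}$ be $\mathbb{R}$ or $\mathbb{C}$, and let $p \ge 1$ be a computable real. An $L^p$ space is a Banach space $L^p(\Omega)$ of $\mathbb{F}$-valued functions, where $\Omega$ is a measure space. A presentation of a Banach space $\mathcal{B}$ over $\mathbb{F}$ is a sequence $(v_j)_{j \in \mathbb{N}}$ of points of $\mathcal{B}$ whose linear span is dense in $\mathcal{B}$; its rational vectors are the sums $\sum_{j<M} \alpha_j v_j$ with rational scalars $\alpha_j \in \mathbb{F} \cap \mathbb{Q}(i)$, coded by natural numbers through codes of the finite sequences $(\alpha_0, \ldots, \alpha_{M-1})$. The diagram of the presentation is the set of (codes of) pairs consisting of a rational vector $v$ and an open interval $I$ with rational center and positive rational radius such that $\|v\| \in I$. A name of the presentation is a function $f \in \mathbb{N}^{\mathbb{N}}$ whose range is the diagram, and an index of the presentation is a number $e$ such that the $e$-th partial computable function, given a code of a rational vector $v$ and $k \in \mathbb{N}$, outputs a code of a rational number $q$ with $|q - \|v\|| < 2^{-k}$. Then: 1. the set of all names of presentations of $L^p$ spaces is a $\Pi^0_2$-complete subset of $\mathbb{N}^{\mathbb{N}}$ (it is lightface $\Pi^0_2$,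 and for every lightface $\Pi^0_2$ set $P \subseteq \mathbb{N}^{\mathbb{N}}$ there is a computable operator $F : \mathbb{N}^{\mathbb{N}} \to \mathbb{N}^{\mathbb{N}}$ such that $f \in P$ if and only if $F(f)$ names a presentation of an $L^p$ space, for all $f$); 2. the set of all indices of presentations of $L^p$ spaces is a $\Pi^0_2$-complete subset of $\mathbb{N}$ (with respect to many-one reducibility). -/

import Mathlib

open MeasureTheory
open scoped ENNReal

noncomputable section

namespace LpIndex

/-! ### Computability on the natural numbers and on Baire space -/

/-- A total operator `F : ℕ^ℕ → ℕ^ℕ` is computable (a total Turing functional): a computable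
procedure `φ`, given an argument `n` and a finite initial segment of the input `f`, either returns
a value or asks for a longer initial segment, and `F f n = m` exactly when `m` is returned
on some initial segment of `f`. -/
def IsComputableOperator (F : (ℕ → ℕ) → ℕ → ℕ) : Prop :=
  ∃ φ : List ℕ → ℕ → Option ℕ, Computable₂ φ ∧
    ∀ (f : ℕ → ℕ) (n m : ℕ), F f n = m ↔ ∃ k : ℕ, φ ((List.range k).map f) n = some m

/-- `P ⊆ ℕ^ℕ` is (lightface) `Π⁰₂`: `P(f) ↔ ∀ x ∃ y Q(f; x, y)` for some computable predicate
`Q ⊆ ℕ^ℕ × ℕ × ℕ`. The predicate is given by a computable functional, which takes the value `1`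
where the predicate holds. -/
def IsPi02Baire (P : Set (ℕ → ℕ)) : Prop :=
  ∃ Q : (ℕ → ℕ) → ℕ → ℕ, IsComputableOperator Q ∧
    ∀ f : ℕ → ℕ, f ∈ P ↔ ∀ x : ℕ, ∃ y : ℕ, Q f (Nat.pair x y) = 1

/-- `P ⊆ ℕ^ℕ` is `Π⁰₂`-complete: it is `Π⁰₂`, and every `Π⁰₂` subset of `ℕ^ℕ` reduces to it
by a computable operator. -/
def IsPi02CompleteBaire (P : Set (ℕ → ℕ)) : Prop :=
  IsPi02Baire P ∧ ∀ P' : Set (ℕ → ℕ), IsPi02Baire P' →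
    ∃ F : (ℕ → ℕ) → ℕ → ℕ, IsComputableOperator F ∧ ∀ f : ℕ → ℕ, f ∈ P' ↔ F f ∈ P

/-- `A ⊆ ℕ` is `Π⁰₂`: `e ∈ A ↔ ∀ x ∃ y R(e, x, y)` for some computable predicate `R`. -/
def IsPi02Nat (A : Set ℕ) : Prop :=
  ∃ R : ℕ × ℕ × ℕ → Prop, ComputablePred R ∧ ∀ e : ℕ, e ∈ A ↔ ∀ x : ℕ, ∃ y : ℕ, R (e, x, y)

/-- `A ⊆ ℕ` is `Π⁰₂`-complete (with respect to many-one reducibility). -/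
def IsPi02CompleteNat (A : Set ℕ) : Prop :=
  IsPi02Nat A ∧ ∀ A' : Set ℕ, IsPi02Nat A' → ManyOneReducible (fun e => e ∈ A') (fun e => e ∈ A)

/-! ### Codes of rationals, rational scalars, rational intervals -/

/-- Codes `((a, b), c)` of rational numbers. -/
abbrev RatCode : Type := (ℕ × ℕ) × ℕ

/-- The rational number `(a - b) / (c + 1)` with code `((a, b), c)`. -/
def RatCode.val (q : RatCode) : ℚ := ((q.1.1 : ℚ) - (q.1.2 : ℚ)) / ((q.2 : ℚ) + 1)

/-- Codes `(a, b)` of positive rational numbers. -/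
abbrev PosRatCode : Type := ℕ × ℕ

/-- The positive rational number `(a + 1) / (b + 1)` with code `(a, b)`. -/
def PosRatCode.val (r : PosRatCode) : ℚ := ((r.1 : ℚ) + 1) / ((r.2 : ℚ) + 1)

/-- A real number `x` is computable: some computable sequence of rationals `q k` satisfies
`|q k - x| < 2 ^ (-k)`. -/
def IsComputableReal (x : ℝ) : Prop :=
  ∃ q : ℕ → RatCode, Computable q ∧ ∀ k : ℕ, |((q k).val : ℝ) - x| < ((2 : ℝ) ^ k)⁻¹

/-- Codes of rational open intervals (the rational open balls of `ℝ`): a center and a radius. -/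
abbrev IntervalCode : Type := RatCode × PosRatCode

/-- The rational open interval with a given code. -/
def IntervalCode.toSet (I : IntervalCode) : Set ℝ := Metric.ball (I.1.val : ℝ) (I.2.val : ℝ)

/-- Codes of rational scalars: formal expressions `x + y i` with rational `x`, `y`. -/
abbrev ScalarCode : Type := RatCode × RatCode

/-- The rational scalar with a given code. Over `ℂ` these are the elements of `ℚ(i)`.
Over `ℝ`, where `RCLike.I = 0`, they are the rationals. -/
def ScalarCode.val (𝕜 : Type*) [RCLike 𝕜] (a : ScalarCode) : 𝕜 :=
  ((a.1.val : ℚ) : 𝕜) + ((a.2.val : ℚ) : 𝕜) * (RCLike.I : 𝕜)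

/-- Codes of rational vectors: finite sequences of codes of rational scalars. -/
abbrev VectorCode : Type := List ScalarCode

/-! ### Presentations of Banach spaces, their names and their indices -/

/-- A presentation of `B`: a sequence of distinguished points whose linear span is dense. -/
structure Presentation (𝕜 : Type*) [RCLike 𝕜] (B : Type*) [NormedAddCommGroup B]
    [NormedSpace 𝕜 B] where
  point : ℕ → B
  dense : (Submodule.span 𝕜 (Set.range point)).topologicalClosure = ⊤

section

variable {𝕜 : Type*} [RCLike 𝕜] {B : Type*} [NormedAddCommGroup B] [NormedSpace 𝕜 B]

/-- The rational vector `∑ j, α_j • v_j` with code `⟨α_0, …, α_{M-1}⟩`, where `v_j` is the `j`-th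
distinguished point. -/
def Presentation.vec (S : Presentation 𝕜 B) (v : VectorCode) : B :=
  ∑ j : Fin v.length, (v.get j).val 𝕜 • S.point j

/-- The diagram of a presentation: all pairs of a rational vector (code) and a rational
interval (code) which contains the norm of that vector. -/
def Presentation.diagram (S : Presentation 𝕜 B) : Set (VectorCode × IntervalCode) :=
  {d | ‖S.vec d.1‖ ∈ d.2.toSet}

/-- `f ∈ ℕ^ℕ` is a name of a presentation: it enumerates the diagram. -/
def Presentation.IsName (S : Presentation 𝕜 B) (f : ℕ → ℕ) : Prop :=
  Set.range f = Encodable.encode '' S.diagram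

/-- `e` is an index of a presentation: the `e`-th partial computable function, given (a code of) a
rational vector `v` and `k ∈ ℕ`, halts with a code of a rational `q` with
`|q - ‖v‖| < 2 ^ (-k)`. -/
def Presentation.IsIndex (S : Presentation 𝕜 B) (e : ℕ) : Prop :=
  ∀ (v : VectorCode) (k : ℕ), ∃ q : RatCode,
    Encodable.encode q ∈
      Nat.Partrec.Code.eval (Denumerable.ofNat Nat.Partrec.Code e) (Encodable.encode (v, k)) ∧
    |(q.val : ℝ) - ‖S.vec v‖| < ((2 : ℝ) ^ k)⁻¹

end

/-- The set of all names of presentations of `L^p` spaces `L^p(Ω)`, `Ω` a measure space. Names are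
preserved by isometric isomorphisms. -/
def lpNames (𝕜 : Type*) [RCLike 𝕜] (p : ℝ) (hp : 1 ≤ p) : Set (ℕ → ℕ) :=
  haveI : Fact (1 ≤ ENNReal.ofReal p) := ⟨ENNReal.one_le_ofReal.2 hp⟩
  {f | ∃ (Ω : Type) (_ : MeasurableSpace Ω) (μ : Measure Ω)
      (S : Presentation 𝕜 (Lp 𝕜 (ENNReal.ofReal p) μ)), S.IsName f}

/-- The set of all indices of (computable) presentations of `L^p` spaces `L^p(Ω)`, `Ω` a measure
space. -/
def lpIndices (𝕜 : Type*) [RCLike 𝕜] (p : ℝ) (hp : 1 ≤ p) : Set ℕ :=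
  haveI : Fact (1 ≤ ENNReal.ofReal p) := ⟨ENNReal.one_le_ofReal.2 hp⟩
  {e | ∃ (Ω : Type) (_ : MeasurableSpace Ω) (μ : Measure Ω)
      (S : Presentation 𝕜 (Lp 𝕜 (ENNReal.ofReal p) μ)), S.IsIndex e}

end LpIndex

end

noncomputable section

namespace LpIndex

/-! ### A quantitative form of Clarkson's equality case -/

/-! The upper bounds carry the substance. Being the diagram `D` of a presentation of an `L^p` space
is expressed by conditions of one shape: whenever finitely many pairs lie in `D`, some witness
computes a finite list of pairs that lie in `D` as well (`IsRule`). If `D` is enumerated, such a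
condition is `Π⁰₂` in the enumeration, because the premises can be named by their positions and the
conclusion is confirmed at a finite stage (`IsRule.exists_test`). This applies to a name, which
enumerates its diagram. For an index it applies to the set of intervals that the program certifies,
together with the totality of the program, which is itself `Π⁰₂` (`isIndex_iff`).

Four of the rules force `D` to consist of the intervals around the values of a seminorm on finitely
supported sequences (`exists_norm_of_rules`, `IsNormFunction.seminorm`). The fifth,
`HasLocalLpBases`, says that finitely many rational vectors are nearly contained in the span of `m`
vectors which behave like the unit vectors of `ℓ^p_m`, with an error that decays exponentially in
`m`. It suffices to test this on a finite grid (`abs_seminorm_sub_norm_le_of_net`), and the norms of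
`ℓ^p_m` can be approximated by an algorithm because `p` is computable (`exists_computable_lpNorm`).
Spaces `L^p` have the property by approximation with simple functions
(`exists_isometric_lift_near`).

Conversely, let a space be locally `ℓ^p` in this sense. If `p ≠ 2`, the defect `|a+b|^p + |a-b|^p -
2|a|^p - 2|b|^p` of two scalars has a constant sign and is at least `|p-2| min(|a|,|b|)^p` in size
(`exists_sign_min_rpow_le`). Hence an almost isometric copy of `ℓ^p_m` inside `ℓ^p_M` has almost
disjoint unit vectors, and these can be corrected to exactly disjoint ones
(`exists_disjoint_unit_vectors_of_nearIsometric`). Iteration gives a chain of spaces `ℓ^p_m` with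
exact disjointness preserving isometries and summable errors (`LocallyLp.exists_chain`). Such a
system is realized by successive subdivision of intervals of the line (`exists_lpTree`), and the
limit of the level maps is an isometry with dense range in the resulting `L^p`
(`LpChain.exists_denseRange`). If `p = 2` the defect vanishes identically; then the parallelogram
law passes to the limit, and a separable Hilbert space is an `ℓ²`
(`LocallyLp.exists_denseRange_of_eq_two`).

For hardness one fixed presentation suffices, that of the one-dimensional `L^p` of a point. Its
diagram is enumerated piece by piece as more instances of the given `Π⁰₂` condition are confirmed; a
failing instance leaves a finite set, which is no diagram. For indices, the computation on input `n`
waits for the `n`-th instance to be confirmed, so a failing instance makes the program partial. -/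

lemma add_rpow_le_rpow_add_mul {A B θ : ℝ} (hB : 0 ≤ B) (hBA : B ≤ A) (h0 : 0 < θ) (h1 : θ ≤ 1) :
    (A + B) ^ θ ≤ A ^ θ + θ * B ^ θ := by
  rcases (hB.trans hBA).eq_or_lt with rfl | hA
  · have : B = 0 := le_antisymm hBA hB
    simp [this, Real.zero_rpow h0.ne']
  have hr0 : 0 ≤ B / A := by positivity
  have hr1 : B / A ≤ 1 := (div_le_one hA).2 hBA
  have e : A + B = A * (1 + B / A) := by field_simp
  have e2 : B ^ θ = A ^ θ * (B / A) ^ θ := by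
    rw [← Real.mul_rpow hA.le hr0]; congr 1; field_simp
  rw [e, Real.mul_rpow hA.le (by positivity), e2]
  have h2 : (1 + B / A) ^ θ ≤ 1 + θ * (B / A) :=
    rpow_one_add_le_one_add_mul_self (by linarith) h0.le h1
  have h3 : B / A ≤ (B / A) ^ θ := by
    simpa using Real.rpow_le_rpow_of_exponent_ge_of_imp hr0 hr1 h1 (fun _ h => absurd h one_ne_zero)
  have h4 : 0 ≤ A ^ θ := by positivity
  nlinarith [mul_le_mul_of_nonneg_left h3 h0.le]

/-- After scaling to `A = 1` this is Bernoulli's inequality combined with `r ^ θ ≤ r` for `0 ≤ r ≤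
1`. Both reverse for exponents at most `1`, which gives the companion `add_rpow_le_rpow_add_mul`. -/
lemma rpow_add_mul_le_add_rpow {A B θ : ℝ} (hB : 0 ≤ B) (hBA : B ≤ A) (h1 : 1 ≤ θ) :
    A ^ θ + θ * B ^ θ ≤ (A + B) ^ θ := by
  have h0 : 0 < θ := by linarith
  rcases (hB.trans hBA).eq_or_lt with rfl | hA
  · have : B = 0 := le_antisymm hBA hB
    simp [this, Real.zero_rpow h0.ne']
  have hr0 : 0 ≤ B / A := by positivity
  have hr1 : B / A ≤ 1 := (div_le_one hA).2 hBA
  have e : A + B = A * (1 + B / A) := by field_simp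
  have e2 : B ^ θ = A ^ θ * (B / A) ^ θ := by
    rw [← Real.mul_rpow hA.le hr0]; congr 1; field_simp
  rw [e, Real.mul_rpow hA.le (by positivity), e2]
  have h2 : 1 + θ * (B / A) ≤ (1 + B / A) ^ θ :=
    one_add_mul_self_le_rpow_one_add (by linarith) h1
  have h3 : (B / A) ^ θ ≤ B / A := by
    simpa using Real.rpow_le_rpow_of_exponent_ge_of_imp hr0 hr1 h1 (fun _ h => absurd h h0.ne')
  have h4 : 0 ≤ A ^ θ := by positivity
  nlinarith [mul_le_mul_of_nonneg_left h3 h0.le]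

lemma norm_rpow_eq_sq_rpow {𝕜 : Type*} [RCLike 𝕜] (a : 𝕜) (p : ℝ) :
    ‖a‖ ^ p = (‖a‖ ^ 2) ^ (p / 2) := by
  rw [← Real.rpow_natCast, ← Real.rpow_mul (norm_nonneg _)]
  congr 1; push_cast; ring

/-- For `p ≠ 2` the `p`-parallelogram defect of two scalars has a constant sign and
dominates the smaller one. -/
lemma exists_sign_min_rpow_le (𝕜 : Type*) [RCLike 𝕜] {p : ℝ} (hp : 1 ≤ p) :
    ∃ σ : ℝ, |σ| = 1 ∧ ∀ a b : 𝕜, |p - 2| * min ‖a‖ ‖b‖ ^ p ≤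
      σ * (‖a + b‖ ^ p + ‖a - b‖ ^ p - 2 * ‖a‖ ^ p - 2 * ‖b‖ ^ p) := by
  have par : ∀ a b : 𝕜, ‖a + b‖ ^ 2 + ‖a - b‖ ^ 2 = 2 * (‖a‖ ^ 2 + ‖b‖ ^ 2) := by
    intro a b
    have := parallelogram_law_with_norm 𝕜 a b
    nlinarith
  have wlog : ∀ σ : ℝ, (∀ a b : 𝕜, ‖b‖ ≤ ‖a‖ → |p - 2| * ‖b‖ ^ p ≤
      σ * (‖a + b‖ ^ p + ‖a - b‖ ^ p - 2 * ‖a‖ ^ p - 2 * ‖b‖ ^ p)) →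
      ∀ a b : 𝕜, |p - 2| * min ‖a‖ ‖b‖ ^ p ≤
      σ * (‖a + b‖ ^ p + ‖a - b‖ ^ p - 2 * ‖a‖ ^ p - 2 * ‖b‖ ^ p) := by
    intro σ h a b
    rcases le_total ‖b‖ ‖a‖ with hab | hab
    · rw [min_eq_right hab]; exact h a b hab
    · rw [min_eq_left hab]
      have := h b a hab
      rw [add_comm b a, norm_sub_rev b a] at this
      linarith
  -- By the parallelogram law of the scalars, `‖a‖² + ‖b‖²` is the midpoint of `‖a+b‖²` and
  -- `‖a-b‖²`. Concavity or convexity of `t ^ (p/2)` compares the sum of the `p`-th powers with `2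
  -- (‖a‖² + ‖b‖²) ^ (p/2)`, and the Bernoulli bound with `θ = p/2` compares this with `2 ‖a‖^p + p
  -- ‖b‖^p`. What remains is `|p - 2| ‖b‖^p`.
  have jens : ∀ a b : 𝕜, (1 / 2 : ℝ) * ‖a + b‖ ^ 2 + (1 / 2) * ‖a - b‖ ^ 2 = ‖a‖ ^ 2 + ‖b‖ ^ 2 := by
    intro a b; linarith [par a b]
  rcases le_total p 2 with h2 | h2
  · refine ⟨-1, by simp, wlog _ fun a b hab => ?_⟩
    rw [abs_of_nonpos (by linarith)]
    have c := (Real.concaveOn_rpow (p := p / 2) (by linarith) (by linarith)).2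
      (show ‖a + b‖ ^ 2 ∈ Set.Ici (0 : ℝ) by simp) (show ‖a - b‖ ^ 2 ∈ Set.Ici (0 : ℝ) by simp)
      (show (0 : ℝ) ≤ 1 / 2 by norm_num) (show (0 : ℝ) ≤ 1 / 2 by norm_num) (by norm_num)
    simp only [smul_eq_mul] at c
    rw [jens] at c
    have d := add_rpow_le_rpow_add_mul (A := ‖a‖ ^ 2) (B := ‖b‖ ^ 2) (θ := p / 2) (by positivity)
      (by gcongr) (by linarith) (by linarith)
    simp only [← norm_rpow_eq_sq_rpow] at c d
    linarith
  · refine ⟨1, by simp, wlog _ fun a b hab => ?_⟩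
    rw [abs_of_nonneg (by linarith)]
    have c := (convexOn_rpow (p := p / 2) (by linarith)).2
      (show ‖a + b‖ ^ 2 ∈ Set.Ici (0 : ℝ) by simp) (show ‖a - b‖ ^ 2 ∈ Set.Ici (0 : ℝ) by simp)
      (show (0 : ℝ) ≤ 1 / 2 by norm_num) (show (0 : ℝ) ≤ 1 / 2 by norm_num) (by norm_num)
    simp only [smul_eq_mul] at c
    rw [jens] at c
    have d := rpow_add_mul_le_add_rpow (A := ‖a‖ ^ 2) (B := ‖b‖ ^ 2) (θ := p / 2) (by positivity)
      (by gcongr) (by linarith)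
    simp only [← norm_rpow_eq_sq_rpow] at c d
    linarith

/-! ### Disjointification of almost disjoint vectors of `ℓ^p_M` -/

/-- The space `ℓ^p_M` over `𝕜`. -/
abbrev FinLp (𝕜 : Type*) (p : ℝ) (M : ℕ) : Type _ := PiLp (ENNReal.ofReal p) (fun _ : Fin M => 𝕜)

section FinLp

variable {𝕜 : Type*} [RCLike 𝕜] {p : ℝ}

lemma FinLp.norm_eq [hp : Fact (1 ≤ ENNReal.ofReal p)] {M : ℕ} (x : FinLp 𝕜 p M) :
    ‖x‖ = (∑ i, ‖x i‖ ^ p) ^ (1 / p) := by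
  have h1 : 1 ≤ p := ENNReal.one_le_ofReal.1 hp.out
  have : (ENNReal.ofReal p).toReal = p := ENNReal.toReal_ofReal (by linarith)
  rw [PiLp.norm_eq_sum (by rw [this]; linarith), this]

lemma FinLp.norm_rpow [hp : Fact (1 ≤ ENNReal.ofReal p)] {M : ℕ} (x : FinLp 𝕜 p M) :
    ‖x‖ ^ p = ∑ i, ‖x i‖ ^ p := by
  have h1 : 1 ≤ p := ENNReal.one_le_ofReal.1 hp.out
  rw [FinLp.norm_eq, ← Real.rpow_mul (by positivity), one_div,
    inv_mul_cancel₀ (by linarith), Real.rpow_one]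

/-- The part of the vector `y` carried by a set of coordinates. -/
def FinLp.restrict {M : ℕ} (S : Fin M → Prop) [DecidablePred S] (y : FinLp 𝕜 p M) : FinLp 𝕜 p M :=
  WithLp.toLp _ fun l => if S l then y l else 0

lemma FinLp.restrict_apply {M : ℕ} (S : Fin M → Prop) [DecidablePred S] (y : FinLp 𝕜 p M)
    (l : Fin M) : FinLp.restrict S y l = if S l then y l else 0 := rfl

/-- Each coordinate is given to a vector whose entry there is largest. An entry that `y j` loses is
the smaller one of itself and the owner's entry, so the loss is controlled by the pairwise sums of
`min ^ p`, which the parallelogram defects dominate. -/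
lemma exists_owner_restrict_sub_rpow_le [hp : Fact (1 ≤ ENNReal.ofReal p)] (h2 : p ≠ 2) {m M : ℕ}
    [NeZero m] (y : Fin m → FinLp 𝕜 p M) {ε : ℝ} (hε : 0 ≤ ε)
    (hy : ∀ i j, i ≠ j → |‖y i + y j‖ ^ p + ‖y i - y j‖ ^ p - 2 * ‖y i‖ ^ p - 2 * ‖y j‖ ^ p| ≤ ε) :
    ∃ o : Fin M → Fin m, ∀ j,
      ‖FinLp.restrict (fun l => o l = j) (y j) - y j‖ ^ p ≤ m * (ε / |p - 2|) := by
  have h1 : 1 ≤ p := ENNReal.one_le_ofReal.1 hp.out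
  obtain ⟨σ, hσ, hmin⟩ := exists_sign_min_rpow_le 𝕜 h1
  have hpos : 0 < |p - 2| := abs_pos.2 (sub_ne_zero.2 h2)
  -- The coordinatewise defects all have the sign `σ`, so nothing cancels when they are summed to
  -- the defect of the vectors.
  have pair : ∀ i j, i ≠ j → ∑ l, min ‖y i l‖ ‖y j l‖ ^ p ≤ ε / |p - 2| := by
    intro i j hij
    rw [le_div_iff₀' hpos]
    calc |p - 2| * ∑ l, min ‖y i l‖ ‖y j l‖ ^ p
        = ∑ l, |p - 2| * min ‖y i l‖ ‖y j l‖ ^ p := Finset.mul_sum _ _ _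
      _ ≤ ∑ l, σ * (‖y i l + y j l‖ ^ p + ‖y i l - y j l‖ ^ p
            - 2 * ‖y i l‖ ^ p - 2 * ‖y j l‖ ^ p) := Finset.sum_le_sum fun l _ => hmin _ _
      _ = σ * (‖y i + y j‖ ^ p + ‖y i - y j‖ ^ p - 2 * ‖y i‖ ^ p - 2 * ‖y j‖ ^ p) := by
          simp only [FinLp.norm_rpow, PiLp.add_apply, PiLp.sub_apply]
          rw [← Finset.mul_sum, Finset.sum_sub_distrib, Finset.sum_sub_distrib,
            Finset.sum_add_distrib, Finset.mul_sum, Finset.mul_sum]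
      _ ≤ |σ * (‖y i + y j‖ ^ p + ‖y i - y j‖ ^ p - 2 * ‖y i‖ ^ p - 2 * ‖y j‖ ^ p)| := le_abs_self _
      _ ≤ ε := by rw [abs_mul, hσ, one_mul]; exact hy i j hij
  have ho : ∀ l : Fin M, ∃ i : Fin m, ∀ j, ‖y j l‖ ≤ ‖y i l‖ := fun l => by
    obtain ⟨i, -, hi⟩ := Finset.exists_max_image Finset.univ (fun j => ‖y j l‖) ⟨0, by simp⟩
    exact ⟨i, fun j => hi j (Finset.mem_univ _)⟩
  choose o ho using ho
  refine ⟨o, fun j => ?_⟩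
  rw [FinLp.norm_rpow]
  have hterm : ∀ l, ‖(FinLp.restrict (fun l => o l = j) (y j) - y j) l‖ ^ p ≤
      ∑ i ∈ Finset.univ.erase j, min ‖y i l‖ ‖y j l‖ ^ p := by
    intro l
    rw [PiLp.sub_apply, FinLp.restrict_apply]
    by_cases hl : o l = j
    · simp only [hl, if_true, sub_self, norm_zero]
      rw [Real.zero_rpow (by linarith)]
      exact Finset.sum_nonneg fun i _ => by positivity
    · simp only [hl, if_false, zero_sub, norm_neg]
      have := Finset.single_le_sum (f := fun i => min ‖y i l‖ ‖y j l‖ ^ p)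
        (fun i _ => by positivity) (Finset.mem_erase.2 ⟨hl, Finset.mem_univ (o l)⟩)
      simpa [min_eq_right (ho l j)] using this
  refine (Finset.sum_le_sum fun l _ => hterm l).trans ?_
  rw [Finset.sum_comm]
  refine (Finset.sum_le_card_nsmul _ _ (ε / |p - 2|) fun i hi =>
    pair i j (Finset.ne_of_mem_erase hi)).trans ?_
  rw [Finset.card_erase_of_mem (Finset.mem_univ _), Finset.card_univ, Fintype.card_fin, nsmul_eq_mul]
  gcongr; omega

/-- Almost disjoint, almost normalized vectors of `ℓ^p_M` are close to disjoint unit vectors. -/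
lemma exists_disjoint_unit_vectors [hp : Fact (1 ≤ ENNReal.ofReal p)] (h2 : p ≠ 2) {m M : ℕ}
    (y : Fin m → FinLp 𝕜 p M) {ε η : ℝ} (hε : 0 ≤ ε) (hη : 0 ≤ η) (hη4 : η ≤ 1 / 4)
    (hy : ∀ i j, i ≠ j → |‖y i + y j‖ ^ p + ‖y i - y j‖ ^ p - 2 * ‖y i‖ ^ p - 2 * ‖y j‖ ^ p| ≤ ε)
    (hy1 : ∀ i, |‖y i‖ - 1| ≤ η) (hεη : m * (ε / |p - 2|) ≤ η ^ p) :
    ∃ z : Fin m → FinLp 𝕜 p M, (∀ j, ‖z j‖ = 1) ∧ (∀ i j l, z i l ≠ 0 → z j l ≠ 0 → i = j) ∧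
      ∀ j, ‖z j - y j‖ ≤ 3 * η := by
  have h1 : 1 ≤ p := ENNReal.one_le_ofReal.1 hp.out
  rcases Nat.eq_zero_or_pos m with rfl | hm
  · exact ⟨y, fun j => j.elim0, fun j => j.elim0, fun j => j.elim0⟩
  have : NeZero m := ⟨hm.ne'⟩
  obtain ⟨o, ho⟩ := exists_owner_restrict_sub_rpow_le h2 y hε hy
  set w : Fin m → FinLp 𝕜 p M := fun j => FinLp.restrict (fun l => o l = j) (y j) with hw
  have hwy : ∀ j, ‖w j - y j‖ ≤ η := fun j => by
    refine (Real.rpow_le_rpow_iff (norm_nonneg _) hη (by linarith : 0 < p)).1 ?_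
    exact (ho j).trans hεη
  -- Restriction moves a vector by at most `η`; its norm is then within `2η` of `1`, and normalizing
  -- moves it by at most `2η` more. This is the `3η` of the conclusion.
  have hw1 : ∀ j, |‖w j‖ - 1| ≤ 2 * η := fun j => by
    have a1 := (abs_le.1 (abs_norm_sub_norm_le (w j) (y j)))
    have a2 := abs_le.1 (hy1 j)
    have a3 := hwy j
    rw [abs_le]; constructor <;> linarith
  have hw0 : ∀ j, 0 < ‖w j‖ := fun j => by
    have := abs_le.1 (hw1 j); linarith
  refine ⟨fun j => ((‖w j‖⁻¹ : ℝ) : 𝕜) • w j, fun j => ?_, fun i j l hi hj => ?_, fun j => ?_⟩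
  · rw [norm_smul, RCLike.norm_ofReal, abs_of_pos (inv_pos.2 (hw0 j)), inv_mul_cancel₀ (hw0 j).ne']
  · have key : ∀ i, (((‖w i‖⁻¹ : ℝ) : 𝕜) • w i) l ≠ 0 → o l = i := by
      intro i h
      by_contra hne
      exact h (by simp [hw, FinLp.restrict_apply, hne])
    exact (key i hi).symm.trans (key j hj)
  · have e : ((‖w j‖⁻¹ : ℝ) : 𝕜) • w j - w j = ((‖w j‖⁻¹ - 1 : ℝ) : 𝕜) • w j := by
      push_cast; rw [sub_smul, one_smul]
    have : ‖((‖w j‖⁻¹ : ℝ) : 𝕜) • w j - w j‖ ≤ 2 * η := by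
      rw [e, norm_smul, RCLike.norm_ofReal]
      calc |‖w j‖⁻¹ - 1| * ‖w j‖ = |(‖w j‖⁻¹ - 1) * ‖w j‖| := by
            rw [abs_mul, abs_of_pos (hw0 j)]
        _ = |‖w j‖ - 1| := by
            rw [sub_mul, inv_mul_cancel₀ (hw0 j).ne', one_mul, abs_sub_comm]
        _ ≤ 2 * η := hw1 j
    calc ‖((‖w j‖⁻¹ : ℝ) : 𝕜) • w j - y j‖
        = ‖(((‖w j‖⁻¹ : ℝ) : 𝕜) • w j - w j) + (w j - y j)‖ := by rw [sub_add_sub_cancel]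
      _ ≤ 2 * η + η := (norm_add_le _ _).trans (add_le_add this (hwy j))
      _ = 3 * η := by ring

end FinLp

end LpIndex

end

noncomputable section

namespace LpIndex

/-! ### Almost isometric copies of `ℓ^p_m` -/

lemma abs_rpow_sub_rpow_le {p R s t : ℝ} (hp : 1 ≤ p) (hs : s ∈ Set.Icc 0 R)
    (ht : t ∈ Set.Icc 0 R) : |s ^ p - t ^ p| ≤ p * R ^ (p - 1) * |s - t| := by
  have := (convex_Icc (0 : ℝ) R).norm_image_sub_le_of_norm_hasDerivWithin_le
    (f := fun x => x ^ p) (f' := fun x => p * x ^ (p - 1)) (C := p * R ^ (p - 1))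
    (fun x _ => (Real.hasDerivAt_rpow_const (Or.inr hp)).hasDerivWithinAt) (fun x hx => by
      rw [Real.norm_eq_abs, abs_of_nonneg (mul_nonneg (by linarith) (Real.rpow_nonneg hx.1 _))]
      exact mul_le_mul_of_nonneg_left (Real.rpow_le_rpow hx.1 hx.2 (by linarith)) (by linarith))
    ht hs
  simpa using this

lemma norm_sum_rpow_of_disjoint {ι E : Type*} [SeminormedAddCommGroup E] {p : ℝ} (hp : 0 < p)
    (s : Finset ι) (c : ι → E) (hc : ∀ i j, c i ≠ 0 → c j ≠ 0 → i = j) :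
    ‖∑ i ∈ s, c i‖ ^ p = ∑ i ∈ s, ‖c i‖ ^ p := by
  by_cases h : ∃ i ∈ s, c i ≠ 0
  · obtain ⟨i, hi, hi0⟩ := h
    have h0 : ∀ j ∈ s, j ≠ i → c j = 0 := fun j _ hji => by
      by_contra hj; exact hji (hc j i hj hi0)
    rw [Finset.sum_eq_single_of_mem i hi h0, Finset.sum_eq_single_of_mem i hi]
    intro j hj hji
    rw [h0 j hj hji, norm_zero, Real.zero_rpow hp.ne']
  · push Not at h
    rw [Finset.sum_eq_zero h, norm_zero, Real.zero_rpow hp.ne', Finset.sum_eq_zero]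
    intro j hj
    rw [h j hj, norm_zero, Real.zero_rpow hp.ne']

section

variable {𝕜 : Type*} [RCLike 𝕜] {p : ℝ} {X : Type*} [SeminormedAddCommGroup X] [NormedSpace 𝕜 X]

/-- The linear map `ℓ^p_m → X` which takes the unit vectors to given vectors. -/
def FinLp.lift (p : ℝ) {m : ℕ} (u : Fin m → X) : FinLp 𝕜 p m →ₗ[𝕜] X :=
  Fintype.linearCombination 𝕜 u ∘ₗ (WithLp.linearEquiv _ 𝕜 (Fin m → 𝕜)).toLinearMap

lemma FinLp.lift_apply {m : ℕ} (u : Fin m → X) (a : FinLp 𝕜 p m) :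
    FinLp.lift p u a = ∑ j, a j • u j := rfl

/-- The `j`-th unit vector of `ℓ^p_m`. -/
def FinLp.unit (𝕜 : Type*) [RCLike 𝕜] (p : ℝ) {m : ℕ} (j : Fin m) : FinLp 𝕜 p m :=
  WithLp.toLp _ (Pi.single j 1)

lemma FinLp.unit_apply {m : ℕ} (j l : Fin m) :
    FinLp.unit 𝕜 p j l = if l = j then 1 else 0 := by
  simp [FinLp.unit]

lemma FinLp.lift_unit {m : ℕ} (u : Fin m → X) (j : Fin m) :
    FinLp.lift p u (FinLp.unit 𝕜 p j) = u j := by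
  simp [FinLp.lift_apply, FinLp.unit_apply]

lemma FinLp.norm_unit [hp : Fact (1 ≤ ENNReal.ofReal p)] {m : ℕ} (j : Fin m) :
    ‖FinLp.unit 𝕜 p j‖ = 1 := by
  have h1 : 1 ≤ p := ENNReal.one_le_ofReal.1 hp.out
  have h0 : p ≠ 0 := by linarith
  rw [FinLp.norm_eq]
  simp [FinLp.unit_apply, apply_ite, ite_pow, Real.zero_rpow h0]

lemma FinLp.norm_unit_add_smul_unit [hp : Fact (1 ≤ ENNReal.ofReal p)] {m : ℕ} {i j : Fin m}
    (hij : i ≠ j) {c : 𝕜} (hc : ‖c‖ = 1) :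
    ‖FinLp.unit 𝕜 p i + c • FinLp.unit 𝕜 p j‖ ^ p = 2 := by
  have h1 : 1 ≤ p := ENNReal.one_le_ofReal.1 hp.out
  have h0 : p ≠ 0 := by linarith
  rw [FinLp.norm_rpow]
  have : ∀ l, ‖(FinLp.unit 𝕜 p i + c • FinLp.unit 𝕜 p j) l‖ ^ p =
      (if l = i then 1 else 0) + if l = j then 1 else 0 := by
    intro l
    rw [PiLp.add_apply, PiLp.smul_apply, FinLp.unit_apply, FinLp.unit_apply]
    by_cases hi : l = i
    · simp [hi, hij]
    · by_cases hj : l = j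
      · simp [hj, hc, Ne.symm hij]
      · simp [hi, hj, Real.zero_rpow h0]
  simp only [this, Finset.sum_add_distrib]
  simp
  norm_num

lemma FinLp.norm_apply_le [hp : Fact (1 ≤ ENNReal.ofReal p)] {m : ℕ} (a : FinLp 𝕜 p m)
    (j : Fin m) : ‖a j‖ ≤ ‖a‖ := PiLp.norm_apply_le a j

/-- The crude bound `‖a j‖ ≤ ‖a‖` costs a factor `m`. It is affordable because the tolerances are
chosen small relative to the dimension. -/
lemma FinLp.norm_lift_sub_le [hp : Fact (1 ≤ ENNReal.ofReal p)] {m : ℕ} (u v : Fin m → X) {η : ℝ}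
    (huv : ∀ j, ‖u j - v j‖ ≤ η) (a : FinLp 𝕜 p m) :
    ‖FinLp.lift p u a - FinLp.lift p v a‖ ≤ m * η * ‖a‖ := by
  rw [FinLp.lift_apply, FinLp.lift_apply, ← Finset.sum_sub_distrib]
  refine (norm_sum_le_of_le (f := fun j => a j • u j - a j • v j)
    (n := fun _ => η * ‖a‖) _ fun j _ => ?_).trans ?_
  · rw [← smul_sub, norm_smul, mul_comm]
    exact mul_le_mul (huv j) (FinLp.norm_apply_le a j) (norm_nonneg _)
      ((norm_nonneg _).trans (huv j))
  · simp [mul_assoc]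

/-- Vectors `u_j` which span a `(1 ± ε)`-isometric copy of `ℓ^p_m`. -/
def NearIsometric (𝕜 : Type*) [RCLike 𝕜] (p : ℝ) {X : Type*} [SeminormedAddCommGroup X]
    [NormedSpace 𝕜 X] {m : ℕ} (u : Fin m → X) (ε : ℝ) : Prop :=
  ∀ a : FinLp 𝕜 p m, |‖FinLp.lift p u a‖ - (∑ i, ‖a i‖ ^ p) ^ (1 / p)|
    ≤ ε * (∑ i, ‖a i‖ ^ p) ^ (1 / p)

lemma nearIsometric_iff [hp : Fact (1 ≤ ENNReal.ofReal p)] {m : ℕ} {u : Fin m → X} {ε : ℝ} :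
    NearIsometric 𝕜 p u ε ↔ ∀ a : FinLp 𝕜 p m, |‖FinLp.lift p u a‖ - ‖a‖| ≤ ε * ‖a‖ := by
  simp only [NearIsometric, FinLp.norm_eq]

lemma NearIsometric.mono {m : ℕ} {u : Fin m → X} {ε δ : ℝ} (h : NearIsometric 𝕜 p u ε)
    (hεδ : ε ≤ δ) : NearIsometric 𝕜 p u δ := fun a =>
  (h a).trans (mul_le_mul_of_nonneg_right hεδ (by positivity))

/-- A space is locally `L^p` if its finite subsets are almost contained in almost isometric
copies of `ℓ^p_m`. -/
def LocallyLp (𝕜 : Type*) [RCLike 𝕜] (p : ℝ) (X : Type*) [SeminormedAddCommGroup X]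
    [NormedSpace 𝕜 X] : Prop :=
  ∀ (V : Finset X) (k : ℕ), ∃ (m : ℕ) (u : Fin m → X),
    NearIsometric 𝕜 p u (2⁻¹ ^ (k * (m + 1))) ∧
    ∀ v ∈ V, ∃ a : FinLp 𝕜 p m, ‖v - FinLp.lift p u a‖ ≤ 2⁻¹ ^ k

lemma FinLp.norm_lift_of_disjoint [hp : Fact (1 ≤ ENNReal.ofReal p)] {m M : ℕ}
    {z : Fin m → FinLp 𝕜 p M} (hz1 : ∀ j, ‖z j‖ = 1)
    (hz : ∀ i j l, z i l ≠ 0 → z j l ≠ 0 → i = j) (a : FinLp 𝕜 p m) :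
    ‖FinLp.lift p z a‖ = ‖a‖ := by
  have h1 : 1 ≤ p := ENNReal.one_le_ofReal.1 hp.out
  have h0 : 0 < p := by linarith
  rw [FinLp.norm_eq, FinLp.norm_eq]
  congr 1
  have : ∀ l, ‖FinLp.lift p z a l‖ ^ p = ∑ j, ‖a j‖ ^ p * ‖z j l‖ ^ p := by
    intro l
    have e : FinLp.lift p z a l = ∑ j, a j * z j l := by
      simp [FinLp.lift_apply]
    rw [e, norm_sum_rpow_of_disjoint h0]
    · refine Finset.sum_congr rfl fun j _ => ?_
      rw [norm_mul, Real.mul_rpow (norm_nonneg _) (norm_nonneg _)]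
    · intro i j hi hj
      exact hz i j l (right_ne_zero_of_mul hi) (right_ne_zero_of_mul hj)
  simp only [this]
  rw [Finset.sum_comm]
  refine Finset.sum_congr rfl fun j _ => ?_
  rw [← Finset.mul_sum, ← FinLp.norm_rpow, hz1, Real.one_rpow, mul_one]

/-- Of two almost isometric copies of `ℓ^p_m` and `ℓ^p_M`, the first almost contained in the
second, the first is close to the span of disjoint unit vectors of the second. -/
lemma exists_disjoint_unit_vectors_of_nearIsometric (𝕜 : Type*) [RCLike 𝕜] {X : Type*}
    [SeminormedAddCommGroup X] [NormedSpace 𝕜 X]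
    [hp : Fact (1 ≤ ENNReal.ofReal p)] (h2 : p ≠ 2) :
    ∃ C : ℝ, 0 < C ∧ ∀ {m M : ℕ} (u : Fin m → X) (u' : Fin M → X) (ε η : ℝ), 0 ≤ ε →
      NearIsometric 𝕜 p u ε → NearIsometric 𝕜 p u' ε →
      (∀ j, ∃ a : FinLp 𝕜 p M, ‖u j - FinLp.lift p u' a‖ ≤ ε) →
      C * m * ε ≤ η ^ p → 4 * ε ≤ η → η ≤ 1 / 4 →
      ∃ z : Fin m → FinLp 𝕜 p M, (∀ j, ‖z j‖ = 1) ∧ (∀ i j l, z i l ≠ 0 → z j l ≠ 0 → i = j) ∧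
        ∀ j, ‖FinLp.lift p u' (z j) - u j‖ ≤ 7 * η := by
  have h1 : 1 ≤ p := ENNReal.one_le_ofReal.1 hp.out
  have hpos : 0 < |p - 2| := abs_pos.2 (sub_ne_zero.2 h2)
  set L : ℝ := p * 4 ^ (p - 1) with hL
  have hLpos : 0 < L := by positivity
  -- `L` is a Lipschitz constant of `t ^ p` on `[0, 4]`. In the defect of a pair, `‖y i ± y j‖ ^ p`
  -- are each off by `8Lε` and `‖y i‖ ^ p`, `‖y j‖ ^ p`, counted twice, by `4Lε`, which adds up to
  -- `32Lε`.
  refine ⟨32 * L / |p - 2|, by positivity, ?_⟩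
  intro m M u u' ε η hε hu hu' hclose hC h4 hη4
  rw [nearIsometric_iff] at hu hu'
  choose y hy using hclose
  have hη : 0 ≤ η := by linarith
  have hε16 : ε ≤ 1 / 16 := by linarith
  -- Vectors of the two coordinate spaces with nearby images in `X` have nearby norms, since both
  -- maps are almost isometric. The bound `ε ≤ 1/16` first confines `‖Y‖` to `[0, 4]`.
  have gen : ∀ (Y : FinLp 𝕜 p M) (x : FinLp 𝕜 p m) (s : ℝ), ‖x‖ ≤ s → s ≤ 2 →
      ‖FinLp.lift p u' Y - FinLp.lift p u x‖ ≤ s * ε → |‖Y‖ - ‖x‖| ≤ 4 * s * ε ∧ ‖Y‖ ≤ 4 := by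
    intro Y x s hxs hs2 hd
    have b1 := abs_le.1 (hu' Y)
    have b2 := abs_le.1 (hu x)
    have b3 := abs_le.1 ((abs_norm_sub_norm_le _ _).trans hd)
    have hx0 := norm_nonneg x
    have hY0 := norm_nonneg Y
    have b4 : ε * ‖x‖ ≤ ε * s := mul_le_mul_of_nonneg_left hxs hε
    have b5 : ε * s ≤ (1 / 16) * s := by nlinarith
    have b6 : ε * ‖Y‖ ≤ 1 / 16 * ‖Y‖ := mul_le_mul_of_nonneg_right hε16 hY0
    have hY2 : ‖Y‖ ≤ 2 * s := by nlinarith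
    have b7 : ε * ‖Y‖ ≤ ε * (2 * s) := mul_le_mul_of_nonneg_left hY2 hε
    exact ⟨abs_le.2 ⟨by nlinarith, by nlinarith⟩, by linarith⟩
  have single : ∀ j, |‖y j‖ - 1| ≤ 4 * ε ∧ ‖y j‖ ≤ 4 := fun j => by
    have := gen (y j) (FinLp.unit 𝕜 p j) 1 (FinLp.norm_unit j).le (by norm_num) (by
      rw [FinLp.lift_unit, norm_sub_rev, one_mul]; exact hy j)
    rw [FinLp.norm_unit] at this
    simpa using this
  have pair : ∀ i j (c : 𝕜), i ≠ j → ‖c‖ = 1 → |‖y i + c • y j‖ ^ p - 2| ≤ L * (8 * ε) := by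
    intro i j c hij hc
    have hx2 : ‖FinLp.unit 𝕜 p i + c • FinLp.unit 𝕜 p j‖ ≤ 2 := by
      refine (norm_add_le _ _).trans ?_
      rw [norm_smul, hc, FinLp.norm_unit, FinLp.norm_unit]; norm_num
    obtain ⟨g1, g2⟩ := gen (y i + c • y j) _ 2 hx2 le_rfl (by
      rw [map_add, map_add, map_smul, map_smul, FinLp.lift_unit, FinLp.lift_unit]
      have e : FinLp.lift p u' (y i) + c • FinLp.lift p u' (y j) - (u i + c • u j) =
        (FinLp.lift p u' (y i) - u i) + c • (FinLp.lift p u' (y j) - u j) := by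
        rw [smul_sub]; abel
      rw [e]
      refine (norm_add_le _ _).trans ?_
      rw [norm_smul, hc, norm_sub_rev, norm_sub_rev _ (u j)]
      linarith [hy i, hy j])
    have := abs_rpow_sub_rpow_le h1 ⟨norm_nonneg _, g2⟩
      (⟨norm_nonneg _, hx2.trans (by norm_num)⟩ :
        ‖FinLp.unit 𝕜 p i + c • FinLp.unit 𝕜 p j‖ ∈ Set.Icc (0 : ℝ) 4)
    rw [FinLp.norm_unit_add_smul_unit hij hc] at this
    refine this.trans (mul_le_mul_of_nonneg_left (by linarith) hLpos.le)
  have single' : ∀ j, |‖y j‖ ^ p - 1| ≤ L * (4 * ε) := fun j => by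
    have := abs_rpow_sub_rpow_le h1 ⟨norm_nonneg _, (single j).2⟩
      (⟨by norm_num, by norm_num⟩ : (1 : ℝ) ∈ Set.Icc (0 : ℝ) 4)
    rw [Real.one_rpow] at this
    exact this.trans (mul_le_mul_of_nonneg_left (single j).1 hLpos.le)
  obtain ⟨z, hz1, hz, hzy⟩ := exists_disjoint_unit_vectors h2 y (ε := 32 * L * ε) (η := η)
    (by positivity) hη hη4 (fun i j hij => by
      have a1 := abs_le.1 (pair i j 1 hij (by simp))
      have a2 := abs_le.1 (pair i j (-1) hij (by simp))
      rw [one_smul] at a1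
      rw [neg_one_smul, ← sub_eq_add_neg] at a2
      have a3 := abs_le.1 (single' i)
      have a4 := abs_le.1 (single' j)
      rw [abs_le]; constructor <;> nlinarith) (fun i => (single i).1.trans h4) (by
      calc (m : ℝ) * (32 * L * ε / |p - 2|) = 32 * L / |p - 2| * m * ε := by ring
        _ ≤ _ := hC)
  refine ⟨z, hz1, hz, fun j => ?_⟩
  have e : FinLp.lift p u' (z j) - u j =
      FinLp.lift p u' (z j - y j) - (u j - FinLp.lift p u' (y j)) := by
    rw [map_sub]; abel
  rw [e]
  refine (norm_sub_le _ _).trans ?_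
  have b1 := abs_le.1 (hu' (z j - y j))
  have b2 := hzy j
  have b3 := hy j
  have b4 : ε * ‖z j - y j‖ ≤ 1 / 16 * ‖z j - y j‖ :=
    mul_le_mul_of_nonneg_right hε16 (norm_nonneg _)
  linarith

end

end LpIndex

end

noncomputable section

namespace LpIndex

/-! ### Chains of copies of `ℓ^p_m` with disjoint transition maps -/

/-- The tolerance in `LocallyLp` must beat a power of the dimension, but `k` is chosen before the
dimension is known. Exponential decay in `k * n` does so uniformly in `n`. -/
lemma exists_inv_two_pow_mul_le {c : ℝ} (hc : 0 < c) (s : ℕ) :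
    ∃ k : ℕ, ∀ n : ℕ, 1 ≤ n → (2⁻¹ : ℝ) ^ (k * n) * (n : ℝ) ^ s ≤ c ∧ (2⁻¹ : ℝ) ^ k ≤ c := by
  obtain ⟨j, hj⟩ := exists_pow_lt_of_lt_one hc (by norm_num : (2⁻¹ : ℝ) < 1)
  refine ⟨s + j, fun n hn => ?_⟩
  have h1 : (n : ℝ) ^ s ≤ 2 ^ (s * n) := by
    rw [mul_comm, pow_mul]
    gcongr
    exact_mod_cast Nat.lt_two_pow_self.le
  have h2 : (2⁻¹ : ℝ) ^ (j * n) ≤ 2⁻¹ ^ j :=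
    pow_le_pow_of_le_one (by norm_num) (by norm_num) (Nat.le_mul_of_pos_right j hn)
  refine ⟨?_, ?_⟩
  · rw [add_mul, pow_add]
    calc (2⁻¹ : ℝ) ^ (s * n) * 2⁻¹ ^ (j * n) * n ^ s
        ≤ (2⁻¹ : ℝ) ^ (s * n) * 2⁻¹ ^ j * 2 ^ (s * n) := by gcongr
      _ = 2⁻¹ ^ j := by
        rw [mul_right_comm, ← mul_pow]; norm_num
      _ ≤ c := hj.le
  · refine le_trans ?_ hj.le
    exact pow_le_pow_of_le_one (by norm_num) (by norm_num) (by omega)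

section

variable {𝕜 : Type*} [RCLike 𝕜] {p : ℝ} {X : Type*} [SeminormedAddCommGroup X] [NormedSpace 𝕜 X]

/-- The parameters required by `exists_disjoint_unit_vectors_of_nearIsometric` are produced
together: `η` is `δ / (28 (m+1))`, so that `m` errors of size `7η` stay below `δ`, and `ε` is the
tolerance of `LocallyLp`. -/
lemma LocallyLp.exists_nearIsometric [hp : Fact (1 ≤ ENNReal.ofReal p)] (hX : LocallyLp 𝕜 p X)
    {C : ℝ} (hC : 0 < C) {δ : ℝ} (hδ : 0 < δ) (hδ1 : δ ≤ 1) (V : Finset X) :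
    ∃ (m : ℕ) (u : Fin m → X) (ε η : ℝ), 0 < ε ∧ ε ≤ δ ∧ NearIsometric 𝕜 p u ε ∧
      C * m * ε ≤ η ^ p ∧ 4 * ε ≤ η ∧ η ≤ 1 / 4 ∧ m * (7 * η) ≤ δ ∧
      ∀ v ∈ V, ∃ a : FinLp 𝕜 p m, ‖v - FinLp.lift p u a‖ ≤ δ := by
  have h1 : 1 ≤ p := ENNReal.one_le_ofReal.1 hp.out
  set s := ⌈p⌉₊ + 1 with hs
  -- The entries give, in this order, `C m ε ≤ η ^ p`, `4 ε ≤ η` and `ε ≤ δ`. The power `⌈p⌉₊ + 1`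
  -- of the dimension accounts for the factor `m` and for the denominator of `η ^ p`.
  set c : ℝ := min (min ((δ / 28) ^ p / C) (δ / 112)) δ with hc
  have hc0 : 0 < c := by rw [hc]; positivity
  obtain ⟨k, hk⟩ := exists_inv_two_pow_mul_le hc0 s
  obtain ⟨m, u, hu, hV⟩ := hX V k
  obtain ⟨hk1, hk2⟩ := hk (m + 1) (by omega)
  set n : ℝ := ((m + 1 : ℕ) : ℝ) with hn
  have hn1 : 1 ≤ n := by rw [hn]; exact_mod_cast Nat.le_add_left 1 m
  have hmn : (m : ℝ) ≤ n := by rw [hn]; push_cast; linarith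
  set ε : ℝ := 2⁻¹ ^ (k * (m + 1)) with hε
  have hε0 : 0 < ε := by positivity
  have hεn : ε * n ^ (⌈p⌉₊ + 1) ≤ c := hk1
  have hεn1 : ε * n ≤ c := le_trans (mul_le_mul_of_nonneg_left
    (by simpa using pow_le_pow_right₀ hn1 (by omega : 1 ≤ ⌈p⌉₊ + 1)) hε0.le) hεn
  have hcδ : c ≤ δ := min_le_right _ _
  have hc112 : c ≤ δ / 112 := (min_le_left _ _).trans (min_le_right _ _)
  have hcC : c ≤ (δ / 28) ^ p / C := (min_le_left _ _).trans (min_le_left _ _)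
  have hεc : ε ≤ c := le_trans (le_mul_of_one_le_right hε0.le hn1) hεn1
  refine ⟨m, u, ε, δ / 28 / n, hε0, hεc.trans hcδ, hu, ?_, ?_, ?_, ?_, fun v hv => ?_⟩
  · rw [Real.div_rpow (by positivity) (by linarith), le_div_iff₀ (by positivity)]
    have e1 : n ^ p ≤ n ^ ⌈p⌉₊ := by
      rw [← Real.rpow_natCast]
      exact Real.rpow_le_rpow_of_exponent_le hn1 (Nat.le_ceil p)
    rw [le_div_iff₀ hC] at hcC
    calc C * m * ε * n ^ p ≤ C * n * ε * n ^ ⌈p⌉₊ := by gcongr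
      _ = ε * n ^ (⌈p⌉₊ + 1) * C := by ring
      _ ≤ c * C := by gcongr
      _ ≤ _ := hcC
  · rw [le_div_iff₀ (by linarith)]
    linarith
  · rw [div_le_iff₀ (by linarith)]
    linarith
  · have : (m : ℝ) * (7 * (δ / 28 / n)) = (m / n) * (δ / 4) := by ring
    rw [this]
    have : (m : ℝ) / n ≤ 1 := (div_le_one (by linarith)).2 hmn
    nlinarith
  · obtain ⟨a, ha⟩ := hV v hv
    exact ⟨a, ha.trans (hk2.trans hcδ)⟩

/-- A chain of almost isometric copies of the spaces `ℓ^p_m`, each almost contained in the next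
one by way of a disjointness preserving isometry `ℓ^p_m → ℓ^p_M`, and almost containing the
elements of a given sequence. -/
structure LpChain (𝕜 : Type*) [RCLike 𝕜] (p : ℝ) {X : Type*} [SeminormedAddCommGroup X]
    [NormedSpace 𝕜 X] [Fact (1 ≤ ENNReal.ofReal p)] (e : ℕ → X) where
  dim : ℕ → ℕ
  vec : ∀ n, Fin (dim n) → X
  tr : ∀ n, Fin (dim n) → FinLp 𝕜 p (dim (n + 1))
  near : ∀ n, NearIsometric 𝕜 p (vec n) (2⁻¹ ^ (n + 1))
  norm_tr : ∀ n j, ‖tr n j‖ = 1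
  disj : ∀ n i j l, tr n i l ≠ 0 → tr n j l ≠ 0 → i = j
  close : ∀ n (a : FinLp 𝕜 p (dim n)), ‖FinLp.lift p (vec (n + 1)) (FinLp.lift p (tr n) a) - FinLp.lift p (vec n) a‖
    ≤ 2⁻¹ ^ n * ‖a‖
  covers : ∀ n, ∀ i ≤ n, ∃ a : FinLp 𝕜 p (dim n), ‖e i - FinLp.lift p (vec n) a‖ ≤ 2⁻¹ ^ n

/-- A link of a chain under construction. -/
structure LpLink (𝕜 : Type*) [RCLike 𝕜] (p : ℝ) (X : Type*) [SeminormedAddCommGroup X]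
    [NormedSpace 𝕜 X] (C : ℝ) where
  dim : ℕ
  vec : Fin dim → X
  ε : ℝ
  η : ℝ
  tol : ℝ
  ε_pos : 0 < ε
  ε_le : ε ≤ tol
  near : NearIsometric 𝕜 p vec ε
  bound : C * dim * ε ≤ η ^ p
  four_le : 4 * ε ≤ η
  η_le : η ≤ 1 / 4
  η_tol : dim * (7 * η) ≤ tol

/-- The disjointness correction at a link is governed by that link's own `ε`. Therefore the next
link is built with a tolerance below this `ε`, and its span is made to approximate the vectors of
the present link as well as more terms of `e`. The further bound `2⁻¹ ^ (n + 2)` on the tolerances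
makes the errors summable. -/
lemma LocallyLp.exists_chain [hp : Fact (1 ≤ ENNReal.ofReal p)] (h2 : p ≠ 2)
    (hX : LocallyLp 𝕜 p X) (e : ℕ → X) : Nonempty (LpChain 𝕜 p e) := by
  classical
  obtain ⟨C, hC, key⟩ := exists_disjoint_unit_vectors_of_nearIsometric 𝕜 (X := X) h2
  have ext : ∀ (δ : ℝ) (V : Finset X), 0 < δ → δ ≤ 1 →
      ∃ l : LpLink 𝕜 p X C, l.tol = δ ∧
        ∀ v ∈ V, ∃ a : FinLp 𝕜 p l.dim, ‖v - FinLp.lift p l.vec a‖ ≤ δ := by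
    intro δ V hδ hδ1
    obtain ⟨m, u, ε, η, h0, h1, h2, h3, h4, h5, h6, h7⟩ := hX.exists_nearIsometric hC hδ hδ1 V
    exact ⟨⟨m, u, ε, η, δ, h0, h1, h2, h3, h4, h5, h6⟩, rfl, h7⟩
  have : Nonempty (LpLink 𝕜 p X C) := ⟨(ext 1 ∅ one_pos le_rfl).choose⟩
  choose! E hEtol hE using ext
  set nxt : ℕ → LpLink 𝕜 p X C → LpLink 𝕜 p X C := fun n l =>
    E (min l.ε (2⁻¹ ^ (n + 2)))
      (Finset.univ.image l.vec ∪ (Finset.range (n + 2)).image e) with hnxt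
  set σ : ℕ → LpLink 𝕜 p X C := fun n => Nat.rec (motive := fun _ => LpLink 𝕜 p X C) (E (2⁻¹ ^ 1) {e 0}) nxt n with hσ
  have hσs : ∀ n, σ (n + 1) = nxt n (σ n) := fun n => rfl
  have hmin : ∀ n, 0 < min (σ n).ε ((2⁻¹ : ℝ) ^ (n + 2)) := fun n =>
    lt_min (σ n).ε_pos (by positivity)
  have hmin1 : ∀ n, min (σ n).ε ((2⁻¹ : ℝ) ^ (n + 2)) ≤ 1 := fun n =>
    (min_le_right _ _).trans (pow_le_one₀ (by norm_num) (by norm_num))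
  have htol : ∀ n, (σ (n + 1)).tol = min (σ n).ε (2⁻¹ ^ (n + 2)) := fun n =>
    hEtol _ _ (hmin n) (hmin1 n)
  have htol' : ∀ n, (σ n).tol ≤ 2⁻¹ ^ (n + 1) := by
    intro n
    cases n with
    | zero => exact (hEtol _ _ (by norm_num) (by norm_num)).le
    | succ n => rw [htol]; exact min_le_right _ _
  have hlink : ∀ n, ∃ z : Fin (σ n).dim → FinLp 𝕜 p (σ (n + 1)).dim, (∀ j, ‖z j‖ = 1) ∧
      (∀ i j l, z i l ≠ 0 → z j l ≠ 0 → i = j) ∧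
      ∀ j, ‖FinLp.lift p (σ (n + 1)).vec (z j) - (σ n).vec j‖ ≤ 7 * (σ n).η := by
    intro n
    refine key (σ n).vec (σ (n + 1)).vec (σ n).ε (σ n).η (σ n).ε_pos.le (σ n).near
      ((σ (n + 1)).near.mono ?_) (fun j => ?_) (σ n).bound (σ n).four_le (σ n).η_le
    · exact (σ (n + 1)).ε_le.trans ((htol n).le.trans (min_le_left _ _))
    · obtain ⟨a, ha⟩ := hE (min (σ n).ε (2⁻¹ ^ (n + 2)))
        (Finset.univ.image (σ n).vec ∪ (Finset.range (n + 2)).image e) (hmin n) (hmin1 n)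
        ((σ n).vec j) (by simp)
      exact ⟨a, ha.trans (min_le_left _ _)⟩
  choose z hz1 hz hzc using hlink
  refine ⟨⟨fun n => (σ n).dim, fun n => (σ n).vec, z, fun n => ?_, hz1, hz, fun n a => ?_,
    fun n i hi => ?_⟩⟩
  · exact (σ n).near.mono ((σ n).ε_le.trans (htol' n))
  · have e1 : FinLp.lift p (σ (n + 1)).vec (FinLp.lift p (z n) a) =
        FinLp.lift p (fun j => FinLp.lift p (σ (n + 1)).vec (z n j)) a := by
      rw [FinLp.lift_apply (z n), map_sum, FinLp.lift_apply]
      simp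
    rw [e1]
    refine (FinLp.norm_lift_sub_le _ _ (hzc n) a).trans ?_
    gcongr
    refine ((σ n).η_tol.trans (htol' n)).trans ?_
    exact pow_le_pow_of_le_one (by norm_num) (by norm_num) (by omega)
  · cases n with
    | zero =>
      obtain rfl : i = 0 := by omega
      obtain ⟨a, ha⟩ := hE (2⁻¹ ^ 1) {e 0} (by norm_num) (by norm_num) (e 0) (by simp)
      exact ⟨a, ha.trans (by norm_num)⟩
    | succ n =>
      obtain ⟨a, ha⟩ := hE (min (σ n).ε (2⁻¹ ^ (n + 2)))
        (Finset.univ.image (σ n).vec ∪ (Finset.range (n + 2)).image e) (hmin n) (hmin1 n)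
        (e i) (by
          rw [Finset.mem_union]; right
          exact Finset.mem_image_of_mem _ (Finset.mem_range.2 (by omega)))
      refine ⟨a, ha.trans ((min_le_right _ _).trans ?_)⟩
      exact pow_le_pow_of_le_one (by norm_num) (by norm_num) (by omega)

end

end LpIndex

end

noncomputable section

namespace LpIndex

/-! ### A measure space from a system of disjoint transition maps -/

/-- The intervals are laid end to end. Being half-open, they fill the whole interval exactly, so
that later coverings hold at every point and not only almost everywhere. -/
lemma exists_split_Ico {ι : Type*} [DecidableEq ι] (w : ι → ℝ) (hw : ∀ i, 0 ≤ w i)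
    (s : Finset ι) (l : ℝ) :
    ∃ t : ι → ℝ, (∀ i ∈ s, l ≤ t i ∧ t i + w i ≤ l + ∑ j ∈ s, w j) ∧
      (∀ i ∈ s, ∀ j ∈ s, i ≠ j → Disjoint (Set.Ico (t i) (t i + w i)) (Set.Ico (t j) (t j + w j))) ∧
      ∀ x ∈ Set.Ico l (l + ∑ j ∈ s, w j), ∃ i ∈ s, x ∈ Set.Ico (t i) (t i + w i) := by
  induction s using Finset.induction_on generalizing l with
  | empty => exact ⟨fun _ => l, by simp, by simp, by simp⟩
  | insert a s ha ih =>
    obtain ⟨t, ht1, ht2, ht3⟩ := ih (l + w a)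
    have hne : ∀ i ∈ s, i ≠ a := fun i hi h => ha (h ▸ hi)
    have hsum : 0 ≤ ∑ j ∈ s, w j := Finset.sum_nonneg fun i _ => hw i
    have hdis : ∀ i ∈ s, Disjoint (Set.Ico (t i) (t i + w i)) (Set.Ico l (l + w a)) := by
      intro i hi
      rw [Set.disjoint_left]
      intro x hx hx'
      have := (ht1 i hi).1
      exact absurd hx'.2 (not_lt.2 (this.trans hx.1))
    refine ⟨Function.update t a l, ?_, ?_, ?_⟩
    · intro i hi
      rw [Finset.sum_insert ha]
      rcases Finset.mem_insert.1 hi with rfl | hi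
      · simp [hsum]
      · rw [Function.update_of_ne (hne i hi)]
        have := ht1 i hi
        exact ⟨by linarith [hw a], by linarith⟩
    · intro i hi j hj hij
      rcases Finset.mem_insert.1 hi with hia | hi <;> rcases Finset.mem_insert.1 hj with hja | hj
      · exact absurd (hia.trans hja.symm) hij
      · rw [hia, Function.update_self, Function.update_of_ne (hne j hj)]
        exact (hdis j hj).symm
      · rw [hja, Function.update_self, Function.update_of_ne (hne i hi)]
        exact hdis i hi
      · rw [Function.update_of_ne (hne j hj), Function.update_of_ne (hne i hi)]
        exact ht2 i hi j hj hij
    · intro x hx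
      rw [Finset.sum_insert ha] at hx
      by_cases h : x < l + w a
      · exact ⟨a, Finset.mem_insert_self _ _, by rw [Function.update_self]; exact ⟨hx.1, h⟩⟩
      · obtain ⟨i, hi, hxi⟩ := ht3 x ⟨not_lt.1 h, by linarith [hx.2]⟩
        exact ⟨i, Finset.mem_insert_of_mem hi, by rwa [Function.update_of_ne (hne i hi)]⟩

section

variable {𝕜 : Type*} [RCLike 𝕜] {p : ℝ}

/-- Finitely many disjoint intervals of the lengths `‖c j‖ ^ (-p)`. -/
structure IntervalLevel (𝕜 : Type*) [RCLike 𝕜] (p : ℝ) (m : ℕ) where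
  left : Fin m → ℝ
  c : Fin m → 𝕜
  c_ne : ∀ j, c j ≠ 0
  disj : ∀ i j, i ≠ j → Disjoint (Set.Ico (left i) (left i + ‖c i‖ ^ (-p)))
    (Set.Ico (left j) (left j + ‖c j‖ ^ (-p)))

/-- The `j`-th interval. -/
def IntervalLevel.set {m : ℕ} (l : IntervalLevel 𝕜 p m) (j : Fin m) : Set ℝ :=
  Set.Ico (l.left j) (l.left j + ‖l.c j‖ ^ (-p))

lemma IntervalLevel.nonempty (m : ℕ) : Nonempty (IntervalLevel 𝕜 p m) := by
  obtain ⟨t, -, ht, -⟩ := exists_split_Ico (fun _ : Fin m => (1 : ℝ)) (fun _ => zero_le_one)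
    Finset.univ 0
  exact ⟨⟨t, fun _ => 1, fun _ => one_ne_zero, fun i j hij => by
    simpa using ht i (Finset.mem_univ _) j (Finset.mem_univ _) hij⟩⟩

/-- The interval of `j` is cut into pieces of lengths `‖c j‖ ^ (-p) * ‖z j i‖ ^ p`, one for each `i`
in the support of `z j`; they fill it because `‖z j‖ = 1`. Disjointness of the supports gives each
`i` at most one parent, and an `i` without a parent receives a new interval of length `1`. -/
lemma IntervalLevel.exists_refine [hp : Fact (1 ≤ ENNReal.ofReal p)] {m M : ℕ}
    (l : IntervalLevel 𝕜 p m) (z : Fin m → FinLp 𝕜 p M) (hz1 : ∀ j, ‖z j‖ = 1)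
    (hz : ∀ i j k, z i k ≠ 0 → z j k ≠ 0 → i = j) :
    ∃ l' : IntervalLevel 𝕜 p M,
      (∀ j i, z j i ≠ 0 → l'.set i ⊆ l.set j ∧ l.c j = z j i * l'.c i) ∧
      ∀ j, ∀ x ∈ l.set j, ∃ i, z j i ≠ 0 ∧ x ∈ l'.set i := by
  classical
  have h1 : 1 ≤ p := ENNReal.one_le_ofReal.1 hp.out
  have h0 : p ≠ 0 := by linarith
  set w : Fin m → Fin M → ℝ := fun j i => ‖l.c j / z j i‖ ^ (-p) with hw
  have hw0 : ∀ j i, 0 ≤ w j i := fun j i => by positivity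
  have hwe : ∀ j i, z j i ≠ 0 → w j i = ‖l.c j‖ ^ (-p) * ‖z j i‖ ^ p := by
    intro j i hji
    rw [hw]
    simp only
    rw [norm_div, Real.div_rpow (norm_nonneg _) (norm_nonneg _), Real.rpow_neg (norm_nonneg (z j i)),
      div_inv_eq_mul]
  have hsum : ∀ j, ∑ i ∈ Finset.univ.filter (fun i => z j i ≠ 0), w j i = ‖l.c j‖ ^ (-p) := by
    intro j
    rw [Finset.sum_congr rfl fun i hi => hwe j i (Finset.mem_filter.1 hi).2, ← Finset.mul_sum,
      Finset.sum_filter_of_ne, ← FinLp.norm_rpow, hz1, Real.one_rpow, mul_one]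
    intro i _ hi h
    rw [h, norm_zero, Real.zero_rpow h0] at hi
    exact hi rfl
  choose t ht1 ht2 ht3 using fun j => exists_split_Ico (w j) (hw0 j)
    (Finset.univ.filter (fun i => z j i ≠ 0)) (l.left j)
  simp only [hsum, Finset.mem_filter, Finset.mem_univ, true_and] at ht1 ht2 ht3
  -- Beyond `R` there is room for the new intervals, away from all old ones.
  obtain ⟨R, hR⟩ : ∃ R, ∀ j, l.left j + ‖l.c j‖ ^ (-p) ≤ R := by
    obtain ⟨R, hR⟩ := (Set.finite_range fun j => l.left j + ‖l.c j‖ ^ (-p)).bddAbove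
    exact ⟨R, fun j => hR ⟨j, rfl⟩⟩
  obtain ⟨f, hf1, hf2, -⟩ := exists_split_Ico (fun _ : Fin M => (1 : ℝ)) (fun _ => zero_le_one)
    Finset.univ R
  set T : Fin M → ℝ := fun i => if h : ∃ j, z j i ≠ 0 then t h.choose i else f i with hT
  set c' : Fin M → 𝕜 := fun i => if h : ∃ j, z j i ≠ 0 then l.c h.choose / z h.choose i else 1
    with hc'
  have hTo : ∀ j i, z j i ≠ 0 → T i = t j i ∧ c' i = l.c j / z j i := by
    intro j i hji
    have h : ∃ j, z j i ≠ 0 := ⟨j, hji⟩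
    have e : h.choose = j := hz _ _ _ h.choose_spec hji
    simp only [hT, hc']
    rw [dif_pos h, dif_pos h, e]
    exact ⟨rfl, rfl⟩
  have hTn : ∀ i, (¬ ∃ j, z j i ≠ 0) → T i = f i ∧ c' i = 1 := by
    intro i h
    simp only [hT, hc']
    rw [dif_neg h, dif_neg h]
    exact ⟨rfl, rfl⟩
  have hsub : ∀ j i, z j i ≠ 0 → Set.Ico (T i) (T i + ‖c' i‖ ^ (-p)) ⊆ l.set j := by
    intro j i hji
    obtain ⟨e1, e2⟩ := hTo j i hji
    rw [e1, e2]
    exact Set.Ico_subset_Ico (ht1 j i hji).1 (ht1 j i hji).2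
  have hfresh : ∀ i, (¬ ∃ j, z j i ≠ 0) → Set.Ico (T i) (T i + ‖c' i‖ ^ (-p)) ⊆ Set.Ici R := by
    intro i h
    obtain ⟨e1, -⟩ := hTn i h
    rw [e1]
    intro x hx
    exact (hf1 i (Finset.mem_univ _)).1.trans hx.1
  have hlow : ∀ j, Disjoint (l.set j) (Set.Ici R) := by
    intro j
    rw [Set.disjoint_left]
    intro x hx hxR
    exact absurd (hx.2.trans_le (hR j)) (not_lt.2 hxR)
  refine ⟨⟨T, c', ?_, ?_⟩, ?_, ?_⟩
  · intro i
    by_cases h : ∃ j, z j i ≠ 0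
    · obtain ⟨j, hj⟩ := h
      rw [(hTo j i hj).2]
      exact div_ne_zero (l.c_ne j) hj
    · rw [(hTn i h).2]; exact one_ne_zero
  · intro i i' hii
    by_cases h : ∃ j, z j i ≠ 0 <;> by_cases h' : ∃ j, z j i' ≠ 0
    · obtain ⟨j, hj⟩ := h
      obtain ⟨j', hj'⟩ := h'
      by_cases hjj : j = j'
      · subst hjj
        obtain ⟨e1, e2⟩ := hTo j i hj
        obtain ⟨e3, e4⟩ := hTo j i' hj'
        rw [e1, e2, e3, e4]
        exact ht2 j i hj i' hj' hii
      · exact (l.disj j j' hjj).mono (hsub j i hj) (hsub j' i' hj')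
    · obtain ⟨j, hj⟩ := h
      exact (hlow j).mono (hsub j i hj) (hfresh i' h')
    · obtain ⟨j, hj⟩ := h'
      exact ((hlow j).mono (hsub j i' hj) (hfresh i h)).symm
    · obtain ⟨e1, e2⟩ := hTn i h
      obtain ⟨e3, e4⟩ := hTn i' h'
      rw [e1, e2, e3, e4]
      simpa using hf2 i (Finset.mem_univ _) i' (Finset.mem_univ _) hii
  · intro j i hji
    refine ⟨hsub j i hji, ?_⟩
    change l.c j = z j i * c' i
    rw [(hTo j i hji).2, mul_div_cancel₀ _ hji]
  · intro j x hx
    obtain ⟨i, hi, hxi⟩ := ht3 j x hx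
    refine ⟨i, hi, ?_⟩
    obtain ⟨e1, e2⟩ := hTo j i hi
    change x ∈ Set.Ico (T i) (T i + ‖c' i‖ ^ (-p))
    rw [e1, e2]
    exact hxi

/-- A measure space with a refining sequence of finite families of disjoint sets, which generate
the `σ`-algebra. The set `set n j` has the measure `‖c n j‖ ^ (-p)`, and `c n j` on `set n j` is
the combination of the functions `c (n+1) i` on `set (n+1) i` with the coefficients
`tr n j i`. -/
structure LpTree (𝕜 : Type*) [RCLike 𝕜] (p : ℝ) [Fact (1 ≤ ENNReal.ofReal p)] (dim : ℕ → ℕ)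
    (tr : ∀ n, Fin (dim n) → FinLp 𝕜 p (dim (n + 1))) (Ω : Type) [m0 : MeasurableSpace Ω]
    (μ : Measure Ω) where
  set : ∀ n, Fin (dim n) → Set Ω
  c : ∀ n, Fin (dim n) → 𝕜
  c_ne : ∀ n j, c n j ≠ 0
  measure_set : ∀ n j, μ (set n j) = ENNReal.ofReal (‖c n j‖ ^ (-p))
  disj : ∀ n i j, i ≠ j → Disjoint (set n i) (set n j)
  sub : ∀ n j i, tr n j i ≠ 0 → set (n + 1) i ⊆ set n j
  c_eq : ∀ n j i, tr n j i ≠ 0 → c n j = tr n j i * c (n + 1) i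
  cover : ∀ n j, ∀ x ∈ set n j, ∃ i, tr n j i ≠ 0 ∧ x ∈ set (n + 1) i
  gen : m0 = MeasurableSpace.generateFrom {s | ∃ n j, s = set n j}
  null : μ (⋃ n, ⋃ j, set n j)ᶜ = 0

/-- Starting from arbitrary disjoint intervals, `IntervalLevel.exists_refine` is iterated on the
real line. The `σ`-algebra is the one generated by the intervals, not the Borel one, so that their
indicators will span a dense subspace of `L^p`. -/
lemma exists_lpTree [hp : Fact (1 ≤ ENNReal.ofReal p)] (dim : ℕ → ℕ)
    (tr : ∀ n, Fin (dim n) → FinLp 𝕜 p (dim (n + 1))) (hz1 : ∀ n j, ‖tr n j‖ = 1)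
    (hz : ∀ n i j k, tr n i k ≠ 0 → tr n j k ≠ 0 → i = j) :
    ∃ (Ω : Type) (_ : MeasurableSpace Ω) (μ : Measure Ω), Nonempty (LpTree 𝕜 p dim tr Ω μ) := by
  choose nxt hn1 hn2 using fun n (l : IntervalLevel 𝕜 p (dim n)) =>
    l.exists_refine (tr n) (hz1 n) (hz n)
  set L : ∀ n, IntervalLevel 𝕜 p (dim n) := fun n =>
    Nat.rec (motive := fun n => IntervalLevel 𝕜 p (dim n)) (IntervalLevel.nonempty _).some nxt n
  have hL : ∀ n, L (n + 1) = nxt n (L n) := fun n => rfl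
  set G : Set (Set ℝ) := {s | ∃ n j, s = (L n).set j} with hG
  have hle : MeasurableSpace.generateFrom G ≤ (inferInstance : MeasurableSpace ℝ) := by
    refine MeasurableSpace.generateFrom_le ?_
    rintro s ⟨n, j, rfl⟩
    exact measurableSet_Ico
  set U : Set ℝ := ⋃ n, ⋃ j, (L n).set j with hU
  have hms : ∀ n j, MeasurableSet[MeasurableSpace.generateFrom G] ((L n).set j) := fun n j =>
    MeasurableSpace.measurableSet_generateFrom ⟨n, j, rfl⟩
  have hmU : MeasurableSet[MeasurableSpace.generateFrom G] U :=
    MeasurableSet.iUnion fun n => MeasurableSet.iUnion fun j => hms n j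
  have hμ : ∀ s, MeasurableSet[MeasurableSpace.generateFrom G] s →
      (volume.restrict U).trim hle s = volume (s ∩ U) := fun s hs => by
    rw [trim_measurableSet_eq hle hs, Measure.restrict_apply (hle _ hs)]
  -- Restricting Lebesgue measure to `U` makes the part of the line outside all intervals null;
  -- otherwise it could contribute functions that the tree does not see.
  refine ⟨ℝ, MeasurableSpace.generateFrom G, (volume.restrict U).trim hle,
    ⟨@LpTree.mk 𝕜 _ p _ dim tr ℝ (MeasurableSpace.generateFrom G) _
      (fun n => (L n).set) (fun n => (L n).c) (fun n => (L n).c_ne) (fun n j => ?_)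
      (fun n => (L n).disj) (fun n j i h => ?_) (fun n j i h => ?_) (fun n j => ?_) rfl ?_⟩⟩
  · refine (hμ _ (hms n j)).trans ?_
    rw [Set.inter_eq_left.2]
    · rw [IntervalLevel.set, Real.volume_Ico]
      congr 1; ring
    · exact (Set.subset_iUnion (fun j => (L n).set j) j).trans
        (Set.subset_iUnion (fun n => ⋃ j, (L n).set j) n)
  · rw [hL]; exact (hn1 n (L n) j i h).1
  · rw [hL]; exact (hn1 n (L n) j i h).2
  · rw [hL]; exact hn2 n (L n) j
  · refine (hμ _ (@MeasurableSet.compl _ _ (MeasurableSpace.generateFrom G) hmU)).trans ?_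
    rw [Set.compl_inter_self, measure_empty]

end

end LpIndex

end

noncomputable section

namespace LpIndex

/-! ### Density of the span of the sets of a tree -/

section

variable {𝕜 : Type*} [RCLike 𝕜] {q : ℝ≥0∞} {Ω : Type*} [MeasurableSpace Ω] {μ : Measure Ω}

lemma smul_indicatorConstLp_one {s : Set Ω} (hs : MeasurableSet s) (hμs : μ s ≠ ∞) (c : 𝕜) :
    c • indicatorConstLp q hs hμs (1 : 𝕜) = indicatorConstLp q hs hμs c := by
  ext1
  filter_upwards [Lp.coeFn_smul c (indicatorConstLp q hs hμs (1 : 𝕜)),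
    indicatorConstLp_coeFn (p := q) (hs := hs) (hμs := hμs) (c := (1 : 𝕜)),
    indicatorConstLp_coeFn (p := q) (hs := hs) (hμs := hμs) (c := c)] with x h1 h2 h3
  rw [h1, Pi.smul_apply, h2, h3]
  by_cases hx : x ∈ s <;> simp [hx]

/-- The measurable sets of finite measure whose indicator belongs to a subspace of `L^q`. -/
def HasIndicatorIn (W : Submodule 𝕜 (Lp 𝕜 q μ)) (s : Set Ω) : Prop :=
  ∃ (hs : MeasurableSet s) (hμs : μ s ≠ ∞), indicatorConstLp q hs hμs (1 : 𝕜) ∈ W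

variable {W : Submodule 𝕜 (Lp 𝕜 q μ)}

lemma HasIndicatorIn.empty : HasIndicatorIn W ∅ :=
  ⟨MeasurableSet.empty, by simp, by rw [indicatorConstLp_empty]; exact W.zero_mem⟩

lemma HasIndicatorIn.union {s t : Set Ω} (hs : HasIndicatorIn W s) (ht : HasIndicatorIn W t)
    (hst : Disjoint s t) : HasIndicatorIn W (s ∪ t) := by
  obtain ⟨hs, hμs, h1⟩ := hs
  obtain ⟨ht, hμt, h2⟩ := ht
  refine ⟨hs.union ht, by finiteness, ?_⟩
  rw [indicatorConstLp_disjoint_union hs ht hμs hμt hst]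
  exact W.add_mem h1 h2

lemma HasIndicatorIn.diff {s t : Set Ω} (hs : HasIndicatorIn W s) (ht : HasIndicatorIn W t)
    (hst : s ⊆ t) : HasIndicatorIn W (t \ s) := by
  obtain ⟨hs, hμs, h1⟩ := hs
  obtain ⟨ht, hμt, h2⟩ := ht
  have hμ : μ (t \ s) ≠ ∞ := measure_ne_top_of_subset Set.sdiff_subset hμt
  refine ⟨ht.diff hs, hμ, ?_⟩
  have := indicatorConstLp_disjoint_union (p := q) hs (ht.diff hs) hμs hμ
    Set.disjoint_sdiff_right (1 : 𝕜)
  simp only [Set.union_sdiff_cancel hst] at this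
  rw [this] at h2
  exact (Submodule.add_mem_iff_right W h1).1 h2

lemma HasIndicatorIn.biUnion {ι : Type*} (s : Finset ι) (f : ι → Set Ω)
    (hf : ∀ i ∈ s, HasIndicatorIn W (f i)) (hd : ∀ i ∈ s, ∀ j ∈ s, i ≠ j → Disjoint (f i) (f j)) :
    HasIndicatorIn W (⋃ i ∈ s, f i) := by
  classical
  induction s using Finset.induction_on with
  | empty => simpa using HasIndicatorIn.empty
  | insert a s ha ih =>
    rw [Finset.set_biUnion_insert]
    refine (hf a (Finset.mem_insert_self _ _)).union
      (ih (fun i hi => hf i (Finset.mem_insert_of_mem hi))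
        (fun i hi j hj => hd i (Finset.mem_insert_of_mem hi) j (Finset.mem_insert_of_mem hj))) ?_
    rw [Set.disjoint_iUnion₂_right]
    intro i hi
    exact hd a (Finset.mem_insert_self _ _) i (Finset.mem_insert_of_mem hi)
      (fun h => ha (h ▸ hi))

/-- The measures of `s \ f n` decrease to `0` because `s` has finite measure, and for `q ≠ ∞` this
is convergence of the indicators in `L^q`. -/
lemma HasIndicatorIn.of_monotone [Fact (1 ≤ q)] (hq : q ≠ ∞)
    (hW : IsClosed (W : Set (Lp 𝕜 q μ))) {f : ℕ → Set Ω} (hf : ∀ n, HasIndicatorIn W (f n))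
    (hmono : Monotone f) {s : Set Ω} (hs : MeasurableSet s) (hμs : μ s ≠ ∞) (hfs : ∀ n, f n ⊆ s)
    (hnull : μ (s \ ⋃ n, f n) = 0) : HasIndicatorIn W s := by
  choose h1 h2 h3 using hf
  refine ⟨hs, hμs, hW.mem_of_tendsto (b := Filter.atTop) (tendsto_indicatorConstLp_set (ht := h1) (hμt := h2) hq ?_)
    (Filter.Eventually.of_forall h3)⟩
  have := tendsto_measure_iInter_atTop (μ := μ) (s := fun n => s \ f n)
    (fun n => (hs.diff (h1 n)).nullMeasurableSet)
    (fun m n hmn => Set.sdiff_subset_sdiff_right (hmono hmn))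
    ⟨0, measure_ne_top_of_subset Set.sdiff_subset hμs⟩
  rw [← Set.sdiff_iUnion, hnull] at this
  refine this.congr fun n => ?_
  rw [Function.comp_apply, symmDiff_comm, symmDiff_of_ge (hfs n)]

lemma eq_top_of_hasIndicatorIn [Fact (1 ≤ q)] (hq : q ≠ ∞) (hW : IsClosed (W : Set (Lp 𝕜 q μ)))
    (h : ∀ s, MeasurableSet s → μ s ≠ ∞ → HasIndicatorIn W s) : W = ⊤ := by
  rw [eq_top_iff]
  rintro f -
  induction f using Lp.induction hq with
  | indicatorConst c hs hμs =>
    obtain ⟨_, _, h3⟩ := h _ hs hμs.ne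
    rw [Lp.simpleFunc.coe_indicatorConst, ← smul_indicatorConstLp_one]
    exact W.smul_mem c h3
  | add hf hg _ h1 h2 => exact W.add_mem h1 h2
  | isClosed => exact hW

end

namespace LpTree

variable {𝕜 : Type*} [RCLike 𝕜] {p : ℝ} [Fact (1 ≤ ENNReal.ofReal p)] {dim : ℕ → ℕ}
  {tr : ∀ n, Fin (dim n) → FinLp 𝕜 p (dim (n + 1))} {Ω : Type} [m0 : MeasurableSpace Ω]
  {μ : Measure Ω} (A : LpTree 𝕜 p dim tr Ω μ)

lemma measurableSet (n : ℕ) (j : Fin (dim n)) : MeasurableSet (A.set n j) := by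
  have h := MeasurableSpace.measurableSet_generateFrom
    (show A.set n j ∈ {s | ∃ n j, s = A.set n j} from ⟨n, j, rfl⟩)
  rwa [← A.gen] at h

lemma measure_ne_top (n : ℕ) (j : Fin (dim n)) : μ (A.set n j) ≠ ∞ := by
  rw [A.measure_set]; exact ENNReal.ofReal_ne_top

lemma exists_mem_add {n : ℕ} {j : Fin (dim n)} {x : Ω} (hx : x ∈ A.set n j) (k : ℕ) :
    ∃ i, x ∈ A.set (n + k) i := by
  induction k with
  | zero => exact ⟨j, hx⟩
  | succ k ih =>
    obtain ⟨i, hi⟩ := ih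
    obtain ⟨i', -, hi'⟩ := A.cover _ _ _ hi
    exact ⟨i', hi'⟩

/-- Some child of `A.set n i` contains `x`, and it must be the `j`-th set since the sets of one
level are disjoint. -/
lemma subset_of_mem_succ {n : ℕ} {i : Fin (dim n)} {j : Fin (dim (n + 1))} {x : Ω}
    (hi : x ∈ A.set n i) (hj : x ∈ A.set (n + 1) j) : A.set (n + 1) j ⊆ A.set n i := by
  obtain ⟨j', h1, h2⟩ := A.cover _ _ _ hi
  have : j' = j := by
    by_contra hne
    exact Set.disjoint_left.1 (A.disj _ _ _ hne) h2 hj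
  subst this
  exact A.sub _ _ _ h1

lemma subset_of_mem_add {n : ℕ} {i : Fin (dim n)} (k : ℕ) {j : Fin (dim (n + k))} {x : Ω}
    (hi : x ∈ A.set n i) (hj : x ∈ A.set (n + k) j) : A.set (n + k) j ⊆ A.set n i := by
  induction k generalizing x with
  | zero =>
    have : i = j := by
      by_contra hne
      exact Set.disjoint_left.1 (A.disj _ _ _ hne) hi hj
    exact this ▸ subset_rfl
  | succ k ih =>
    obtain ⟨l, hl⟩ := A.exists_mem_add hi k
    exact (A.subset_of_mem_succ hl hj).trans (ih hi hl)

lemma subset_of_mem {n n' : ℕ} (h : n ≤ n') {i : Fin (dim n)} {j : Fin (dim n')} {x : Ω}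
    (hi : x ∈ A.set n i) (hj : x ∈ A.set n' j) : A.set n' j ⊆ A.set n i := by
  obtain ⟨k, rfl⟩ := Nat.exists_eq_add_of_le h
  exact A.subset_of_mem_add k hi hj

/-- Sets of the tree that meet are nested, which makes the generating family a `π`-system. -/
lemma subset_or_subset_of_mem {n n' : ℕ} {i : Fin (dim n)} {j : Fin (dim n')} {x : Ω}
    (hi : x ∈ A.set n i) (hj : x ∈ A.set n' j) :
    A.set n' j ⊆ A.set n i ∨ A.set n i ⊆ A.set n' j := by
  rcases le_total n n' with h | h
  · exact Or.inl (A.subset_of_mem h hi hj)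
  · exact Or.inr (A.subset_of_mem h hj hi)

lemma isPiSystem : IsPiSystem {s | ∃ n j, s = A.set n j} := by
  rintro _ ⟨n, i, rfl⟩ _ ⟨n', j, rfl⟩ ⟨x, hx, hx'⟩
  rcases A.subset_or_subset_of_mem hx hx' with h | h
  · rw [Set.inter_eq_right.2 h]; exact ⟨n', j, rfl⟩
  · rw [Set.inter_eq_left.2 h]; exact ⟨n, i, rfl⟩

lemma level_monotone : Monotone fun n => ⋃ j, A.set n j := by
  refine monotone_nat_of_le_succ fun n => Set.iUnion_subset fun j x hx => ?_
  obtain ⟨i, -, hi⟩ := A.cover _ _ _ hx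
  exact Set.mem_iUnion.2 ⟨i, hi⟩

/-- A closed subspace of `L^p` which contains the indicators of the sets of the tree is
the whole space. -/
theorem eq_top {W : Submodule 𝕜 (Lp 𝕜 (ENNReal.ofReal p) μ)}
    (hW : IsClosed (W : Set (Lp 𝕜 (ENNReal.ofReal p) μ)))
    (h : ∀ n j, HasIndicatorIn W (A.set n j)) : W = ⊤ := by
  have hq : ENNReal.ofReal p ≠ ∞ := ENNReal.ofReal_ne_top
  have hfin : ∀ n (i : Fin (dim n)) (B : Set Ω), μ (B ∩ A.set n i) ≠ ∞ := fun n i B =>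
    measure_ne_top_of_subset Set.inter_subset_right (A.measure_ne_top n i)
  -- The `π`-`λ` argument runs inside one set of the tree: its measure is finite, so complements
  -- relative to it still have indicators in `L^p`.
  have inner : ∀ n (i : Fin (dim n)) B, MeasurableSet B → HasIndicatorIn W (B ∩ A.set n i) := by
    intro n i B hB
    induction B, hB using MeasurableSpace.induction_on_inter A.gen A.isPiSystem with
    | empty => rw [Set.empty_inter]; exact HasIndicatorIn.empty
    | basic t ht =>
      obtain ⟨n', j, rfl⟩ := ht
      by_cases hne : (A.set n' j ∩ A.set n i).Nonempty
      · obtain ⟨x, hx, hx'⟩ := hne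
        rcases A.subset_or_subset_of_mem hx hx' with h' | h'
        · rw [Set.inter_eq_right.2 h']; exact h _ _
        · rw [Set.inter_eq_left.2 h']; exact h _ _
      · rw [Set.not_nonempty_iff_eq_empty.1 hne]; exact HasIndicatorIn.empty
    | compl t htm ht =>
      have : tᶜ ∩ A.set n i = A.set n i \ (t ∩ A.set n i) := by
        ext x; simp only [Set.mem_inter_iff, Set.mem_compl_iff, Set.mem_sdiff]; tauto
      rw [this]
      exact ht.diff (h n i) Set.inter_subset_right
    | iUnion f hd hfm hf =>
      refine HasIndicatorIn.of_monotone hq hW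
        (f := fun N => ⋃ k ∈ Finset.range N, (f k ∩ A.set n i)) (fun N => ?_) ?_
        ((MeasurableSet.iUnion hfm).inter (A.measurableSet n i)) (hfin n i _) (fun N => ?_) ?_
      · refine HasIndicatorIn.biUnion _ _ (fun k _ => hf k) fun k _ l _ hkl => ?_
        exact (hd hkl).mono Set.inter_subset_left Set.inter_subset_left
      · intro M N hMN
        exact Set.biUnion_subset_biUnion_left fun k hk =>
          Finset.mem_range.2 ((Finset.mem_range.1 hk).trans_le hMN)
      · refine Set.iUnion₂_subset fun k _ => ?_
        exact Set.inter_subset_inter_left _ (Set.subset_iUnion f k)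
      · convert measure_empty (μ := μ)
        rw [Set.sdiff_eq_empty]
        rintro x ⟨hx, hx'⟩
        obtain ⟨k, hk⟩ := Set.mem_iUnion.1 hx
        exact Set.mem_iUnion.2 ⟨k + 1, Set.mem_iUnion₂.2 ⟨k, by simp, hk, hx'⟩⟩
  -- The levels increase and exhaust the space up to a null set, and each level is a finite disjoint
  -- union, so `inner` reaches every set of finite measure.
  refine eq_top_of_hasIndicatorIn hq hW fun s hs hμs => ?_
  refine HasIndicatorIn.of_monotone hq hW (f := fun n => s ∩ ⋃ j, A.set n j) (fun n => ?_)
    (fun m n hmn => Set.inter_subset_inter_right _ (A.level_monotone hmn)) hs hμs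
    (fun n => Set.inter_subset_left) ?_
  · have : s ∩ ⋃ j, A.set n j = ⋃ j ∈ (Finset.univ : Finset (Fin (dim n))), (s ∩ A.set n j) := by
      simp [Set.inter_iUnion]
    rw [this]
    refine HasIndicatorIn.biUnion _ _ (fun j _ => inner n j s hs) fun i _ j _ hij => ?_
    exact (A.disj n i j hij).mono Set.inter_subset_right Set.inter_subset_right
  · refine measure_mono_null ?_ A.null
    rintro x ⟨hx, hx'⟩ hx''
    refine hx' ?_
    obtain ⟨n, hn⟩ := Set.mem_iUnion.1 hx''
    exact Set.mem_iUnion.2 ⟨n, hx, hn⟩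

end LpTree

end LpIndex

end

noncomputable section

namespace LpIndex

/-! ### Norms of combinations of disjoint indicators -/

section

variable {𝕜 : Type*} [RCLike 𝕜] {p : ℝ} {Ω : Type*} [MeasurableSpace Ω] {μ : Measure Ω}

lemma coeFn_finsetSum {q : ℝ≥0∞} {ι : Type*} (s : Finset ι) (f : ι → Lp 𝕜 q μ) :
    ∀ᵐ x ∂μ, (∑ i ∈ s, f i : Lp 𝕜 q μ) x = ∑ i ∈ s, f i x := by
  classical
  induction s using Finset.induction_on with
  | empty => simpa using! Lp.coeFn_zero 𝕜 q μ
  | insert a s ha ih =>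
    rw [Finset.sum_insert ha]
    filter_upwards [ih, Lp.coeFn_add (f a) (∑ i ∈ s, f i)] with x h1 h2
    rw [h2, Pi.add_apply, h1, Finset.sum_insert ha]

lemma norm_sum_indicatorConstLp_rpow [hp : Fact (1 ≤ ENNReal.ofReal p)] {m : ℕ}
    (A : Fin m → Set Ω) (hA : ∀ j, MeasurableSet (A j)) (hμ : ∀ j, μ (A j) ≠ ∞)
    (hd : ∀ i j, i ≠ j → Disjoint (A i) (A j)) (c : Fin m → 𝕜) :
    ‖∑ j, indicatorConstLp (ENNReal.ofReal p) (hA j) (hμ j) (c j)‖ ^ p =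
      ∑ j, ‖c j‖ ^ p * μ.real (A j) := by
  have h1 : 1 ≤ p := ENNReal.one_le_ofReal.1 hp.out
  have h0 : 0 < p := by linarith
  have hq : (ENNReal.ofReal p).toReal = p := ENNReal.toReal_ofReal h0.le
  set f : Lp 𝕜 (ENNReal.ofReal p) μ :=
    ∑ j, indicatorConstLp (ENNReal.ofReal p) (hA j) (hμ j) (c j) with hf
  have hae : ∀ᵐ x ∂μ, ‖f x‖ₑ ^ p = ∑ j, (A j).indicator (fun _ => ENNReal.ofReal (‖c j‖ ^ p)) x := by
    have hall : ∀ᵐ x ∂μ, ∀ j, indicatorConstLp (ENNReal.ofReal p) (hA j) (hμ j) (c j) x =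
        (A j).indicator (fun _ => c j) x := ae_all_iff.2 fun j => indicatorConstLp_coeFn
    filter_upwards [coeFn_finsetSum Finset.univ
      (fun j => indicatorConstLp (ENNReal.ofReal p) (hA j) (hμ j) (c j)), hall] with x h2 h3
    rw [h2, ← ofReal_norm, ENNReal.ofReal_rpow_of_nonneg (norm_nonneg _) h0.le,
      norm_sum_rpow_of_disjoint h0, ENNReal.ofReal_sum_of_nonneg fun j _ => by positivity]
    · refine Finset.sum_congr rfl fun j _ => ?_
      rw [h3 j]
      by_cases hx : x ∈ A j
      · simp [hx]
      · simp [hx, Real.zero_rpow h0.ne']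
    · intro i j hi hj
      rw [h3] at hi hj
      by_contra hij
      exact Set.disjoint_left.1 (hd i j hij) (Set.mem_of_indicator_ne_zero hi)
        (Set.mem_of_indicator_ne_zero hj)
  have hI : ∫⁻ x, ‖f x‖ₑ ^ p ∂μ = ∑ j, ENNReal.ofReal (‖c j‖ ^ p) * μ (A j) := by
    rw [lintegral_congr_ae hae, lintegral_finsetSum _ fun j _ => measurable_const.indicator (hA j)]
    exact Finset.sum_congr rfl fun j _ => lintegral_indicator_const (hA j) _
  rw [Lp.norm_def, eLpNorm_eq_lintegral_rpow_enorm_toReal (by simpa using h0) ENNReal.ofReal_ne_top,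
    hq, hI, ENNReal.toReal_rpow, ← ENNReal.rpow_mul, one_div, inv_mul_cancel₀ h0.ne',
    ENNReal.rpow_one, ENNReal.toReal_sum fun j _ => ENNReal.mul_ne_top ENNReal.ofReal_ne_top (hμ j)]
  refine Finset.sum_congr rfl fun j _ => ?_
  rw [ENNReal.toReal_mul, ENNReal.toReal_ofReal (by positivity), measureReal_def]

end

/-! ### The embedding of a chain in the `L^p` space of its tree -/

section

variable {𝕜 : Type*} [RCLike 𝕜] {p : ℝ} [hp : Fact (1 ≤ ENNReal.ofReal p)] {dim : ℕ → ℕ}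
  {tr : ∀ n, Fin (dim n) → FinLp 𝕜 p (dim (n + 1))} {Ω : Type} [MeasurableSpace Ω]
  {μ : Measure Ω}

/-- The isometric copy of `ℓ^p_m` in `L^p` given by a level of the tree. -/
def LpTree.rep (A : LpTree 𝕜 p dim tr Ω μ) (n : ℕ) :
    FinLp 𝕜 p (dim n) →ₗ[𝕜] Lp 𝕜 (ENNReal.ofReal p) μ :=
  FinLp.lift p fun j => indicatorConstLp _ (A.measurableSet n j) (A.measure_ne_top n j) (A.c n j)

/-- The function `A.c n j` on its set has norm `1`, as its value and the measure satisfy `‖c‖ ^ p *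
‖c‖ ^ (-p) = 1`; the sets of a level are disjoint. -/
lemma LpTree.norm_rep (A : LpTree 𝕜 p dim tr Ω μ) (n : ℕ) (a : FinLp 𝕜 p (dim n)) :
    ‖A.rep n a‖ = ‖a‖ := by
  have h1 : 1 ≤ p := ENNReal.one_le_ofReal.1 hp.out
  have h0 : 0 < p := by linarith
  have e : A.rep n a = ∑ j, indicatorConstLp _ (A.measurableSet n j) (A.measure_ne_top n j)
      (a j * A.c n j) := by
    rw [LpTree.rep, FinLp.lift_apply]
    refine Finset.sum_congr rfl fun j _ => ?_
    rw [← smul_indicatorConstLp_one, smul_smul, smul_indicatorConstLp_one]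
  refine (Real.rpow_left_inj (norm_nonneg _) (norm_nonneg _) h0.ne').1 ?_
  rw [e, norm_sum_indicatorConstLp_rpow _ _ _ (A.disj n), FinLp.norm_rpow]
  refine Finset.sum_congr rfl fun j _ => ?_
  have hc : 0 < ‖A.c n j‖ := norm_pos_iff.2 (A.c_ne n j)
  rw [measureReal_def, A.measure_set, ENNReal.toReal_ofReal (by positivity), norm_mul,
    Real.mul_rpow (norm_nonneg _) hc.le, mul_assoc, ← Real.rpow_add hc, add_neg_cancel,
    Real.rpow_zero, mul_one]

/-- At a point of `A.set n j` exactly one set of the next level contributes, with the value `tr n j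
i * c (n+1) i = c n j`. Outside it, every set whose coefficient is nonzero is avoided. -/
lemma LpTree.rep_tr (A : LpTree 𝕜 p dim tr Ω μ) (n : ℕ) (a : FinLp 𝕜 p (dim n)) :
    A.rep (n + 1) (FinLp.lift p (tr n) a) = A.rep n a := by
  have key : ∀ j, A.rep (n + 1) (tr n j) =
      indicatorConstLp _ (A.measurableSet n j) (A.measure_ne_top n j) (A.c n j) := by
    intro j
    have hall : ∀ᵐ x ∂μ, ∀ i, indicatorConstLp (ENNReal.ofReal p) (A.measurableSet (n + 1) i)
        (A.measure_ne_top (n + 1) i) (tr n j i * A.c (n + 1) i) x =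
        (A.set (n + 1) i).indicator (fun _ => tr n j i * A.c (n + 1) i) x :=
      ae_all_iff.2 fun j => indicatorConstLp_coeFn
    have e : A.rep (n + 1) (tr n j) = ∑ i, indicatorConstLp _ (A.measurableSet (n + 1) i)
        (A.measure_ne_top (n + 1) i) (tr n j i * A.c (n + 1) i) := by
      rw [LpTree.rep, FinLp.lift_apply]
      refine Finset.sum_congr rfl fun i _ => ?_
      rw [← smul_indicatorConstLp_one, smul_smul, smul_indicatorConstLp_one]
    rw [e]
    ext1
    filter_upwards [coeFn_finsetSum Finset.univ (fun i => indicatorConstLp (ENNReal.ofReal p)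
      (A.measurableSet (n + 1) i) (A.measure_ne_top (n + 1) i) (tr n j i * A.c (n + 1) i)), hall,
      indicatorConstLp_coeFn (p := ENNReal.ofReal p) (hs := A.measurableSet n j)
        (hμs := A.measure_ne_top n j) (c := A.c n j)] with x h2 h3 h4
    rw [h2, h4]
    simp only [h3]
    by_cases hx : x ∈ A.set n j
    · obtain ⟨i, hi, hxi⟩ := A.cover n j x hx
      rw [Finset.sum_eq_single i, Set.indicator_of_mem hxi, Set.indicator_of_mem hx,
        A.c_eq n j i hi]
      · intro i' _ hii
        refine Set.indicator_of_notMem (fun hx' => ?_) _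
        exact Set.disjoint_left.1 (A.disj (n + 1) i' i hii) hx' hxi
      · simp
    · rw [Set.indicator_of_notMem hx]
      refine Finset.sum_eq_zero fun i _ => ?_
      by_cases hi : tr n j i = 0
      · simp [hi]
      · exact Set.indicator_of_notMem (fun hx' => hx (A.sub n j i hi hx')) _
  rw [FinLp.lift_apply, map_sum]
  refine Finset.sum_congr rfl fun j _ => ?_
  rw [map_smul, key]
  rfl

/-- The composition of `k` consecutive transition maps. -/
def trans (tr : ∀ n, Fin (dim n) → FinLp 𝕜 p (dim (n + 1))) (n : ℕ) :
    ∀ k, FinLp 𝕜 p (dim n) →ₗ[𝕜] FinLp 𝕜 p (dim (n + k))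
  | 0 => LinearMap.id
  | k + 1 => FinLp.lift p (tr (n + k)) ∘ₗ trans tr n k

lemma LpTree.rep_trans (A : LpTree 𝕜 p dim tr Ω μ) (n k : ℕ) (a : FinLp 𝕜 p (dim n)) :
    A.rep (n + k) (trans tr n k a) = A.rep n a := by
  induction k with
  | zero => rfl
  | succ k ih => rw [← ih]; exact A.rep_tr (n + k) (trans tr n k a)

/-! ### The limit of the level maps of a chain. -/

variable {X : Type*} [SeminormedAddCommGroup X] [NormedSpace 𝕜 X] {e : ℕ → X}

namespace LpChain

lemma norm_trans (Ch : LpChain 𝕜 p e) (n k : ℕ) (a : FinLp 𝕜 p (Ch.dim n)) :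
    ‖trans Ch.tr n k a‖ = ‖a‖ := by
  induction k with
  | zero => rfl
  | succ k ih =>
    rw [← ih]
    exact FinLp.norm_lift_of_disjoint (Ch.norm_tr (n + k)) (Ch.disj (n + k)) _

/-- The almost isometric map `ℓ^p_m → X` at a level of the chain. -/
def emb (Ch : LpChain 𝕜 p e) (n : ℕ) : FinLp 𝕜 p (Ch.dim n) →ₗ[𝕜] X := FinLp.lift p (Ch.vec n)

lemma norm_emb_sub (Ch : LpChain 𝕜 p e) (n : ℕ) (a : FinLp 𝕜 p (Ch.dim n)) :
    |‖Ch.emb n a‖ - ‖a‖| ≤ 2⁻¹ ^ (n + 1) * ‖a‖ := nearIsometric_iff.1 (Ch.near n) a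

lemma norm_le_two_mul (Ch : LpChain 𝕜 p e) (n : ℕ) (a : FinLp 𝕜 p (Ch.dim n)) :
    ‖a‖ ≤ 2 * ‖Ch.emb n a‖ := by
  have h := (abs_le.1 (Ch.norm_emb_sub n a)).1
  have h2 : (2⁻¹ : ℝ) ^ (n + 1) ≤ 2⁻¹ := by
    simpa using pow_le_pow_of_le_one (by norm_num : (0 : ℝ) ≤ 2⁻¹) (by norm_num)
      (by omega : 1 ≤ n + 1)
  have := mul_le_mul_of_nonneg_right h2 (norm_nonneg a)
  linarith

lemma norm_emb_trans_sub_le (Ch : LpChain 𝕜 p e) (n k : ℕ) (a : FinLp 𝕜 p (Ch.dim n)) :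
    ‖Ch.emb (n + k) (trans Ch.tr n k a) - Ch.emb n a‖ ≤ 2 * 2⁻¹ ^ n * ‖a‖ := by
  -- The induction carries the exact partial sum of the geometric series of the errors.
  suffices h : ‖Ch.emb (n + k) (trans Ch.tr n k a) - Ch.emb n a‖ ≤
      (2 * 2⁻¹ ^ n - 2 * 2⁻¹ ^ (n + k)) * ‖a‖ by
    refine h.trans (mul_le_mul_of_nonneg_right ?_ (norm_nonneg _))
    have : (0 : ℝ) ≤ 2⁻¹ ^ (n + k) := by positivity
    linarith
  induction k with
  | zero => simp [trans]
  | succ k ih =>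
    have h1 := Ch.close (n + k) (trans Ch.tr n k a)
    rw [Ch.norm_trans] at h1
    have h2 : ‖Ch.emb (n + (k + 1)) (trans Ch.tr n (k + 1) a) - Ch.emb n a‖ ≤
        ‖Ch.emb (n + (k + 1)) (trans Ch.tr n (k + 1) a) - Ch.emb (n + k) (trans Ch.tr n k a)‖ +
        ‖Ch.emb (n + k) (trans Ch.tr n k a) - Ch.emb n a‖ := norm_sub_le_norm_sub_add_norm_sub _ _ _
    refine h2.trans ((add_le_add h1 ih).trans_eq ?_)
    rw [← add_assoc n k 1, pow_succ _ (n + k)]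
    ring

/-- Linear maps `X → ℓ^p_m` which approximately invert the maps `ℓ^p_m → X`. -/
def coord (Ch : LpChain 𝕜 p e) (b : Module.Basis ℕ 𝕜 X) (n : ℕ) : X →ₗ[𝕜] FinLp 𝕜 p (Ch.dim n) :=
  b.constr 𝕜 fun i => if h : i ≤ n then (Ch.covers n i h).choose else 0

/-- `coord` is defined by its values on a basis and is therefore linear at each level. The basis
vector `b i` is approximated from level `i` on, so the default value below that level has no effect
on limits, and convergence passes to linear combinations. -/
lemma tendsto_norm_sub_emb_coord {b : Module.Basis ℕ 𝕜 X} (Ch : LpChain 𝕜 p b) (x : X) :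
    Filter.Tendsto (fun n => ‖x - Ch.emb n (Ch.coord b n x)‖) Filter.atTop (nhds 0) := by
  have hx : x ∈ Submodule.span 𝕜 (Set.range b) := by rw [b.span_eq]; trivial
  induction hx using Submodule.span_induction with
  | mem x hx =>
    obtain ⟨i, rfl⟩ := hx
    refine squeeze_zero' (Filter.Eventually.of_forall fun n => norm_nonneg _) ?_
      (tendsto_pow_atTop_nhds_zero_of_lt_one (by norm_num : (0 : ℝ) ≤ 2⁻¹) (by norm_num))
    filter_upwards [Filter.eventually_ge_atTop i] with n hn
    rw [coord, Module.Basis.constr_basis, dif_pos hn]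
    exact (Ch.covers n i hn).choose_spec
  | zero => simp
  | add x y _ _ hx hy =>
    refine squeeze_zero (fun n => norm_nonneg _) (fun n => ?_) (by simpa using hx.add hy)
    rw [map_add, map_add, add_sub_add_comm]
    exact norm_add_le _ _
  | smul c x _ hx =>
    refine squeeze_zero (fun n => norm_nonneg _) (fun n => ?_) (by simpa using hx.const_mul ‖c‖)
    rw [map_smul, map_smul, ← smul_sub, norm_smul]

variable {b : Module.Basis ℕ 𝕜 X}

/-- Both elements are brought to level `n + k`, where `A.rep` preserves norms and `Ch.emb` at most
halves them. Distances in `L^p` are thus bounded by distances in `X`, which the triangle inequality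
estimates. -/
lemma norm_rep_coord_sub_le (Ch : LpChain 𝕜 p b) (A : LpTree 𝕜 p Ch.dim Ch.tr Ω μ)
    (n k : ℕ) (a : FinLp 𝕜 p (Ch.dim n)) (x : X) :
    ‖A.rep (n + k) (Ch.coord b (n + k) x) - A.rep n a‖ ≤
      2 * (‖x - Ch.emb (n + k) (Ch.coord b (n + k) x)‖ + ‖x - Ch.emb n a‖ +
        2 * 2⁻¹ ^ n * ‖a‖) := by
  rw [← A.rep_trans n k a, ← map_sub, A.norm_rep]
  refine (Ch.norm_le_two_mul _ _).trans (mul_le_mul_of_nonneg_left ?_ zero_le_two)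
  rw [map_sub]
  have e : Ch.emb (n + k) (Ch.coord b (n + k) x) - Ch.emb (n + k) (trans Ch.tr n k a) =
      (x - Ch.emb n a) - (x - Ch.emb (n + k) (Ch.coord b (n + k) x)) -
        (Ch.emb (n + k) (trans Ch.tr n k a) - Ch.emb n a) := by abel
  rw [e]
  refine (norm_sub_le _ _).trans (add_le_add ((norm_sub_le _ _).trans_eq (add_comm _ _)) ?_)
  exact Ch.norm_emb_trans_sub_le n k a

lemma tendsto_norm_emb_coord (Ch : LpChain 𝕜 p b)
    (x : X) :
    Filter.Tendsto (fun n => ‖Ch.emb n (Ch.coord b n x)‖) Filter.atTop (nhds ‖x‖) := by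
  refine tendsto_iff_norm_sub_tendsto_zero.2
    (squeeze_zero (fun n => norm_nonneg _) (fun n => ?_) (Ch.tendsto_norm_sub_emb_coord x))
  rw [norm_sub_rev x]
  exact abs_norm_sub_norm_le _ _

lemma tendsto_norm_coord (Ch : LpChain 𝕜 p b)
    (x : X) :
    Filter.Tendsto (fun n => ‖Ch.coord b n x‖) Filter.atTop (nhds ‖x‖) := by
  have h1 : Filter.Tendsto (fun n : ℕ => (2⁻¹ : ℝ) ^ (n + 1) * (2 * ‖Ch.emb n (Ch.coord b n x)‖))
      Filter.atTop (nhds 0) := by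
    have := ((Filter.tendsto_add_atTop_iff_nat 1).2 (tendsto_pow_atTop_nhds_zero_of_lt_one
      (by norm_num : (0 : ℝ) ≤ 2⁻¹) (by norm_num))).mul
        ((Ch.tendsto_norm_emb_coord x).const_mul 2)
    simpa using this
  have h2 : Filter.Tendsto (fun n => ‖Ch.emb n (Ch.coord b n x)‖ - ‖Ch.coord b n x‖)
      Filter.atTop (nhds 0) := by
    refine squeeze_zero_norm (fun n => ?_) h1
    refine (Ch.norm_emb_sub n _).trans ?_
    exact mul_le_mul_of_nonneg_left (Ch.norm_le_two_mul n _) (by positivity)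
  simpa using (Ch.tendsto_norm_emb_coord x).sub h2

lemma tendsto_error (Ch : LpChain 𝕜 p b)
    (x : X) : Filter.Tendsto (fun n => 2 * 2⁻¹ ^ n * ‖Ch.coord b n x‖)
    Filter.atTop (nhds 0) := by
  simpa using ((tendsto_pow_atTop_nhds_zero_of_lt_one (by norm_num : (0 : ℝ) ≤ 2⁻¹)
    (by norm_num)).const_mul 2).mul (Ch.tendsto_norm_coord x)

lemma cauchySeq_rep_coord (Ch : LpChain 𝕜 p b) (A : LpTree 𝕜 p Ch.dim Ch.tr Ω μ)
    (x : X) : CauchySeq fun n => A.rep n (Ch.coord b n x) := by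
  rw [Metric.cauchySeq_iff']
  intro ε hε
  have h1 := (Ch.tendsto_norm_sub_emb_coord x).eventually (gt_mem_nhds (by positivity : 0 < ε / 8))
  have h2 := (Ch.tendsto_error x).eventually (gt_mem_nhds (by positivity : 0 < ε / 8))
  obtain ⟨N, hN⟩ := Filter.eventually_atTop.1 (h1.and h2)
  refine ⟨N, fun n hn => ?_⟩
  obtain ⟨k, rfl⟩ := Nat.exists_eq_add_of_le hn
  rw [dist_eq_norm]
  refine (Ch.norm_rep_coord_sub_le A N k _ x).trans_lt ?_
  have a1 := (hN N le_rfl).1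
  have a2 := (hN N le_rfl).2
  have a3 := (hN (N + k) (by omega)).1
  linarith

/-- `J` is a pointwise limit of linear maps, hence linear. It preserves norms because `A.rep n` does
and the norms of the coordinates converge to the norm of the vector. -/
lemma exists_tendsto_rep_coord (Ch : LpChain 𝕜 p b) (A : LpTree 𝕜 p Ch.dim Ch.tr Ω μ) :
    ∃ J : X →ₗᵢ[𝕜] Lp 𝕜 (ENNReal.ofReal p) μ,
      ∀ x, Filter.Tendsto (fun n => A.rep n (Ch.coord b n x)) Filter.atTop (nhds (J x)) := by
  choose f hf using fun x => cauchySeq_tendsto_of_complete (Ch.cauchySeq_rep_coord A x)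
  refine ⟨⟨linearMapOfTendsto f (fun n => A.rep n ∘ₗ Ch.coord b n) (tendsto_pi_nhds.2 hf),
    fun x => ?_⟩, hf⟩
  refine tendsto_nhds_unique (hf x).norm ?_
  simp only [A.norm_rep]
  exact Ch.tendsto_norm_coord x

/-- `J` maps `Ch.emb n a` to within `4 * 2⁻¹ ^ n * ‖a‖` of `A.rep n a`. Moving `a` up the chain
changes neither its norm nor its representative while this error vanishes, so the closure of the
range contains all representatives, hence all indicators of the tree. -/
lemma exists_denseRange (Ch : LpChain 𝕜 p b) (A : LpTree 𝕜 p Ch.dim Ch.tr Ω μ) : ∃ J : X →ₗᵢ[𝕜] Lp 𝕜 (ENNReal.ofReal p) μ, DenseRange J := by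
  obtain ⟨J, hJ⟩ := Ch.exists_tendsto_rep_coord A
  refine ⟨J, ?_⟩
  have hclose : ∀ n (a : FinLp 𝕜 p (Ch.dim n)),
      ‖J (Ch.emb n a) - A.rep n a‖ ≤ 2 * (2 * 2⁻¹ ^ n * ‖a‖) := by
    intro n a
    have hd := (Ch.tendsto_norm_sub_emb_coord (Ch.emb n a)).comp
      (Filter.tendsto_add_atTop_nat n)
    have ht := ((hJ (Ch.emb n a)).comp (Filter.tendsto_add_atTop_nat n)).sub_const (A.rep n a)
    refine le_of_tendsto_of_tendsto ht.norm
      (((hd.add_const (‖Ch.emb n a - Ch.emb n a‖)).add_const (2 * 2⁻¹ ^ n * ‖a‖)).const_mul 2 |>.trans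
        (by simp)) (Filter.Eventually.of_forall fun k => ?_)
    have := Ch.norm_rep_coord_sub_le A n k a (Ch.emb n a)
    simp only [Function.comp_apply]
    rwa [add_comm k n]
  set W : Submodule 𝕜 (Lp 𝕜 (ENNReal.ofReal p) μ) :=
    (LinearMap.range J.toLinearMap).topologicalClosure with hW
  have hWc : IsClosed (W : Set (Lp 𝕜 (ENNReal.ofReal p) μ)) :=
    Submodule.isClosed_topologicalClosure _
  have hrep : ∀ n (a : FinLp 𝕜 p (Ch.dim n)), A.rep n a ∈ W := by
    intro n a
    refine hWc.mem_of_tendsto (f := fun k => J (Ch.emb (n + k) (trans Ch.tr n k a)))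
      (b := Filter.atTop) ?_ (Filter.Eventually.of_forall fun k =>
        Submodule.le_topologicalClosure _ ⟨_, rfl⟩)
    rw [tendsto_iff_norm_sub_tendsto_zero]
    have h0 : Filter.Tendsto (fun k : ℕ => 2 * (2 * (2⁻¹ : ℝ) ^ (k + n) * ‖a‖)) Filter.atTop
        (nhds 0) := by
      simpa using ((((Filter.tendsto_add_atTop_iff_nat n).2 (tendsto_pow_atTop_nhds_zero_of_lt_one
        (by norm_num : (0 : ℝ) ≤ 2⁻¹) (by norm_num))).const_mul 2).mul_const ‖a‖).const_mul 2
    refine squeeze_zero (fun k => norm_nonneg _) (fun k => ?_) h0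
    have := hclose (n + k) (trans Ch.tr n k a)
    rw [A.rep_trans, Ch.norm_trans] at this
    rwa [add_comm k n]
  have htop : W = ⊤ := by
    refine A.eq_top hWc fun n j => ⟨A.measurableSet n j, A.measure_ne_top n j, ?_⟩
    have := hrep n (FinLp.unit 𝕜 p j)
    rw [LpTree.rep, FinLp.lift_unit, ← smul_indicatorConstLp_one] at this
    exact (Submodule.smul_mem_iff _ (A.c_ne n j)).1 this
  have := (Submodule.dense_iff_topologicalClosure_eq_top).2 htop
  rwa [LinearMap.coe_range] at this

end LpChain

/-- A locally `L^p` space of countable dimension embeds densely in an `L^p` space, `p ≠ 2`. -/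
theorem LocallyLp.exists_denseRange_of_ne_two (h2 : p ≠ 2) (b : Module.Basis ℕ 𝕜 X)
    (hX : LocallyLp 𝕜 p X) :
    ∃ (Ω : Type) (_ : MeasurableSpace Ω) (μ : Measure Ω)
      (J : X →ₗᵢ[𝕜] Lp 𝕜 (ENNReal.ofReal p) μ), DenseRange J := by
  obtain ⟨Ch⟩ := hX.exists_chain h2 b
  obtain ⟨Ω, m, μ, ⟨A⟩⟩ := exists_lpTree Ch.dim Ch.tr Ch.norm_tr Ch.disj
  obtain ⟨J, hJ⟩ := Ch.exists_denseRange A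
  exact ⟨Ω, m, μ, J, hJ⟩

end

end LpIndex

end

noncomputable section

namespace LpIndex

/-! ### The Hilbert space case -/

section L2Count

variable (𝕜 : Type*) [RCLike 𝕜] (ι : Type*) [MeasurableSpace ι]
  [MeasurableSingletonClass ι]

/-- The unit vector of `L²` of a counting measure given by a point. -/
def countUnit (i : ι) : Lp 𝕜 2 (Measure.count : Measure ι) :=
  indicatorConstLp 2 (measurableSet_singleton i) (by simp) 1

variable {ι}

lemma inner_countUnit (i : ι) (f : Lp 𝕜 2 (Measure.count : Measure ι)) :
    inner 𝕜 (countUnit 𝕜 ι i) f = f i := by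
  rw [countUnit, L2.inner_indicatorConstLp_one, integral_singleton]
  simp [measureReal_def]

lemma countUnit_apply [DecidableEq ι] (i j : ι) :
    countUnit 𝕜 ι i j = if i = j then 1 else 0 := by
  have := Measure.ae_count_iff.1 (indicatorConstLp_coeFn (p := 2)
    (hs := measurableSet_singleton i) (hμs := by simp) (c := (1 : 𝕜))) j
  rw [countUnit, this]
  simp [Set.indicator_apply, eq_comm]

lemma orthonormal_countUnit : Orthonormal 𝕜 (countUnit 𝕜 ι) := by
  classical
  rw [orthonormal_iff_ite]
  intro i j
  rw [inner_countUnit, countUnit_apply]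
  simp [eq_comm]

variable (ι) in
/-- The standard Hilbert basis of `L²` of a counting measure. -/
def countBasis : HilbertBasis ι 𝕜 (Lp 𝕜 2 (Measure.count : Measure ι)) :=
  HilbertBasis.mkOfOrthogonalEqBot (orthonormal_countUnit 𝕜) (by
    rw [Submodule.eq_bot_iff]
    intro f hf
    rw [Submodule.mem_orthogonal] at hf
    ext1
    have h0 : f =ᵐ[Measure.count] fun _ => (0 : 𝕜) := Measure.ae_count_iff.2 fun i => ?_
    · exact h0.trans (Lp.coeFn_zero _ _ _).symm
    rw [← inner_countUnit]
    exact hf _ (Submodule.subset_span ⟨i, rfl⟩))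

end L2Count

/-- A Hilbert space with a dense sequence of combinations is isometric to some `ℓ²`. -/
lemma exists_linearIsometryEquiv_L2 {𝕜 : Type*} [RCLike 𝕜] {H : Type*} [NormedAddCommGroup H]
    [InnerProductSpace 𝕜 H] [CompleteSpace H] (e : ℕ → H)
    (he : (Submodule.span 𝕜 (Set.range e)).topologicalClosure = ⊤) :
    ∃ (Ω : Type) (_ : MeasurableSpace Ω) (μ : Measure Ω), Nonempty (H ≃ₗᵢ[𝕜] Lp 𝕜 2 μ) := by
  set g := InnerProductSpace.gramSchmidtNormed 𝕜 e with hg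
  have ho := InnerProductSpace.gramSchmidtNormed_orthonormal' (𝕜 := 𝕜) e
  -- Gram–Schmidt yields a zero vector for each `e i` that depends linearly on its predecessors;
  -- discarding these leaves an orthonormal family with the same span.
  let ι : Type := {i : ℕ | g i ≠ 0}
  have hsp : Submodule.span 𝕜 (Set.range fun i : ι => g i) = Submodule.span 𝕜 (Set.range e) := by
    rw [← InnerProductSpace.span_gramSchmidt 𝕜 e,
      ← InnerProductSpace.span_gramSchmidtNormed_range]
    refine le_antisymm (Submodule.span_mono ?_) (Submodule.span_le.2 ?_)
    · rintro _ ⟨i, rfl⟩; exact ⟨i, rfl⟩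
    · rintro _ ⟨i, rfl⟩
      by_cases hi : g i = 0
      · change g i ∈ _
        rw [hi]; exact Submodule.zero_mem _
      · exact Submodule.subset_span ⟨⟨i, hi⟩, rfl⟩
  let b : HilbertBasis ι 𝕜 H := HilbertBasis.mk ho (by
    change ⊤ ≤ (Submodule.span 𝕜 (Set.range fun i : ι => g i)).topologicalClosure
    rw [hsp, he])
  let mι : MeasurableSpace ι := ⊤
  have : MeasurableSingletonClass ι := ⟨fun _ => trivial⟩
  exact ⟨ι, mι, Measure.count, ⟨b.repr.trans (countBasis 𝕜 ι).repr.symm⟩⟩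

/-! ### Locally `L²` spaces and the parallelogram law. -/

section

variable {𝕜 : Type*} [RCLike 𝕜] {X : Type*} [SeminormedAddCommGroup X] [NormedSpace 𝕜 X]

lemma FinLp.parallelogram {m : ℕ} [Fact (1 ≤ ENNReal.ofReal 2)] (a b : FinLp 𝕜 2 m) :
    ‖a + b‖ * ‖a + b‖ + ‖a - b‖ * ‖a - b‖ = 2 * (‖a‖ * ‖a‖ + ‖b‖ * ‖b‖) := by
  have h : ∀ c : FinLp 𝕜 2 m, ‖c‖ * ‖c‖ = ∑ i, ‖c i‖ * ‖c i‖ := fun c => by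
    have := FinLp.norm_rpow c
    simpa only [Real.rpow_two, pow_two] using this
  simp only [h, ← Finset.sum_add_distrib, Finset.mul_sum]
  refine Finset.sum_congr rfl fun i _ => ?_
  simpa only [pow_two, PiLp.add_apply, PiLp.sub_apply] using parallelogram_law_with_norm 𝕜 (a i) (b i)

/-- The factor `2` in the hypothesis leaves room for sums and differences of two approximants, as
the parallelogram law requires. -/
lemma NearIsometric.tendsto_norm {p : ℝ} [hp : Fact (1 ≤ ENNReal.ofReal p)] {m : ℕ → ℕ}
    {u : ∀ k, Fin (m k) → X} (hu : ∀ k, NearIsometric 𝕜 p (u k) (2⁻¹ ^ (k * (m k + 1)))) {z : X}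
    {c : ∀ k, FinLp 𝕜 p (m k)} (hc : ∀ k, ‖z - FinLp.lift p (u k) (c k)‖ ≤ 2 * 2⁻¹ ^ k) :
    Filter.Tendsto (fun k => ‖c k‖) Filter.atTop (nhds ‖z‖) := by
  have h0 : Filter.Tendsto (fun k : ℕ => (2⁻¹ : ℝ) ^ k * (2 * (‖z‖ + 2)) + 2 * 2⁻¹ ^ k)
      Filter.atTop (nhds 0) := by
    have := tendsto_pow_atTop_nhds_zero_of_lt_one (by norm_num : (0 : ℝ) ≤ 2⁻¹) (by norm_num)
    simpa using (this.mul_const (2 * (‖z‖ + 2))).add (this.const_mul 2)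
  refine tendsto_iff_norm_sub_tendsto_zero.2
    (squeeze_zero' (Filter.Eventually.of_forall fun k => norm_nonneg _) ?_ h0)
  filter_upwards [Filter.eventually_ge_atTop 1] with k hk
  have h1 : (2⁻¹ : ℝ) ^ k ≤ 2⁻¹ := by
    simpa using pow_le_pow_of_le_one (by norm_num : (0 : ℝ) ≤ 2⁻¹) (by norm_num) hk
  have h2 := abs_le.1 (nearIsometric_iff.1 ((hu k).mono (pow_le_pow_of_le_one (by norm_num)
    (by norm_num) (Nat.le_mul_of_pos_right k (Nat.succ_pos _)))) (c k))
  have h3 := abs_le.1 ((abs_norm_sub_norm_le _ _).trans (hc k))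
  have h4 := mul_le_mul_of_nonneg_right h1 (norm_nonneg (c k))
  have h5 : ‖c k‖ ≤ 2 * (‖z‖ + 2) := by linarith [norm_nonneg z]
  have h6 := mul_le_mul_of_nonneg_left h5 (by positivity : (0 : ℝ) ≤ 2⁻¹ ^ k)
  rw [Real.norm_eq_abs, abs_le]
  constructor <;> linarith

/-- Approximants of `x` and `y` are taken in the same copy of `ℓ²_m`. Their sum and difference
approximate `x + y` and `x - y`, so the identity of `ℓ²_m` survives in the limit. -/
lemma LocallyLp.parallelogram {p : ℝ} [hp : Fact (1 ≤ ENNReal.ofReal p)] (hp2 : p = 2)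
    (hX : LocallyLp 𝕜 p X) (x y : X) :
    ‖x + y‖ * ‖x + y‖ + ‖x - y‖ * ‖x - y‖ = 2 * (‖x‖ * ‖x‖ + ‖y‖ * ‖y‖) := by
  classical
  subst hp2
  choose m u hu ha using fun k => hX {x, y} k
  choose a ha' using fun k => ha k x (by simp)
  choose b hb' using fun k => ha k y (by simp)
  have hle : ∀ k : ℕ, (2⁻¹ : ℝ) ^ k ≤ 2 * 2⁻¹ ^ k := fun k => by
    have : (0 : ℝ) ≤ 2⁻¹ ^ k := by positivity
    linarith
  have t1 := NearIsometric.tendsto_norm hu fun k => (ha' k).trans (hle k)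
  have t2 := NearIsometric.tendsto_norm hu fun k => (hb' k).trans (hle k)
  have t3 := NearIsometric.tendsto_norm hu (z := x + y) (c := fun k => a k + b k) fun k => by
    rw [map_add, add_sub_add_comm, two_mul]
    exact (norm_add_le _ _).trans (add_le_add (ha' k) (hb' k))
  have t4 := NearIsometric.tendsto_norm hu (z := x - y) (c := fun k => a k - b k) fun k => by
    rw [map_sub, sub_sub_sub_comm, two_mul]
    exact (norm_sub_le _ _).trans (add_le_add (ha' k) (hb' k))
  refine tendsto_nhds_unique ((t3.mul t3).add (t4.mul t4))
    ((((t1.mul t1).add (t2.mul t2)).const_mul 2).congr fun k => ?_)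
  exact (FinLp.parallelogram (a k) (b k)).symm

/-- A locally `L²` space of countable dimension embeds densely in an `L²` space. -/
theorem LocallyLp.exists_denseRange_of_eq_two {p : ℝ} [hp : Fact (1 ≤ ENNReal.ofReal p)]
    (h2 : p = 2) (b : Module.Basis ℕ 𝕜 X) (hX : LocallyLp 𝕜 p X) :
    ∃ (Ω : Type) (_ : MeasurableSpace Ω) (μ : Measure Ω)
      (J : X →ₗᵢ[𝕜] Lp 𝕜 (ENNReal.ofReal p) μ), DenseRange J := by
  have hpar := hX.parallelogram h2
  have hq : ENNReal.ofReal p = 2 := by rw [h2]; simp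
  clear hX
  revert hp
  rw [hq]
  intro _
  -- `X` is only seminormed and need not be complete. The parallelogram law extends to the
  -- completion by continuity and makes it a Hilbert space.
  let H := UniformSpace.Completion X
  let i : X →ₗᵢ[𝕜] H := UniformSpace.Completion.toComplₗᵢ
  have hi : DenseRange i := UniformSpace.Completion.denseRange_coe
  have hparH : ∀ x y : H, ‖x + y‖ * ‖x + y‖ + ‖x - y‖ * ‖x - y‖ = 2 * (‖x‖ * ‖x‖ + ‖y‖ * ‖y‖) := by
    intro x y
    induction x, y using UniformSpace.Completion.induction_on₂ with
    | hp => exact isClosed_eq (by fun_prop) (by fun_prop)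
    | ih x y =>
      have := hpar x y
      rw [← i.norm_map (x + y), ← i.norm_map (x - y), ← i.norm_map x, ← i.norm_map y, i.map_add,
        i.map_sub] at this
      exact this
  let : InnerProductSpace 𝕜 H := InnerProductSpace.ofNorm 𝕜 hparH
  obtain ⟨Ω, mΩ, μ, ⟨E⟩⟩ := exists_linearIsometryEquiv_L2 (𝕜 := 𝕜) (H := H) (fun n => i (b n)) (by
    have e : Set.range (fun n => i (b n)) = i.toLinearMap '' Set.range b := by
      rw [← Set.range_comp]; rfl
    rw [e, Submodule.span_image, b.span_eq, ← Submodule.dense_iff_topologicalClosure_eq_top]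
    rw [Submodule.map_top, LinearMap.coe_range]
    exact hi)
  refine ⟨Ω, mΩ, μ, E.toLinearIsometry.comp i, ?_⟩
  exact E.surjective.denseRange.comp hi E.continuous

/-- A locally `L^p` space of countable dimension embeds densely in an `L^p` space. -/
theorem LocallyLp.exists_denseRange {p : ℝ} [hp : Fact (1 ≤ ENNReal.ofReal p)]
    (b : Module.Basis ℕ 𝕜 X) (hX : LocallyLp 𝕜 p X) :
    ∃ (Ω : Type) (_ : MeasurableSpace Ω) (μ : Measure Ω)
      (J : X →ₗᵢ[𝕜] Lp 𝕜 (ENNReal.ofReal p) μ), DenseRange J := by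
  by_cases h2 : p = 2
  · exact hX.exists_denseRange_of_eq_two h2 b
  · exact hX.exists_denseRange_of_ne_two h2 b

end

end LpIndex

end

noncomputable section

namespace LpIndex

/-! ### Isometric copies of `ℓ^p_m` in `L^p` spaces -/

section

variable {𝕜 : Type*} [RCLike 𝕜] {p : ℝ} {Ω : Type*} [MeasurableSpace Ω] {μ : Measure Ω}

/-- Finitely many elements of an `L^p` space are almost contained in an isometric copy of
some `ℓ^p_m`. -/
theorem exists_isometric_lift_near [hp : Fact (1 ≤ ENNReal.ofReal p)] {ι : Type*} [Finite ι]
    (f : ι → Lp 𝕜 (ENNReal.ofReal p) μ) {ε : ℝ} (hε : 0 < ε) :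
    ∃ (m : ℕ) (g : Fin m → Lp 𝕜 (ENNReal.ofReal p) μ),
      (∀ a : FinLp 𝕜 p m, ‖FinLp.lift p g a‖ = ‖a‖) ∧
      ∀ i, ∃ a : FinLp 𝕜 p m, ‖f i - FinLp.lift p g a‖ ≤ ε := by
  classical
  have h1 : 1 ≤ p := ENNReal.one_le_ofReal.1 hp.out
  have h0 : 0 < p := by linarith
  have hq0 : ENNReal.ofReal p ≠ 0 := by simpa using h0
  have hqt : ENNReal.ofReal p ≠ ∞ := ENNReal.ofReal_ne_top
  choose s hs hsL using fun i => (Lp.memLp (f i)).exists_simpleFunc_eLpNorm_sub_lt hqt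
    (ENNReal.ofReal_pos.2 hε).ne'
  -- The joint level sets of the simple functions `s i`: on each of them all the `s i` are constant.
  set A : (ι → 𝕜) → Set Ω := fun c => ⋂ i, s i ⁻¹' {c i} with hA
  have hmem : ∀ c x, x ∈ A c ↔ (fun i => s i x) = c := by
    intro c x
    simp [hA, funext_iff]
  have hAm : ∀ c, MeasurableSet (A c) := fun c =>
    MeasurableSet.iInter fun i => (s i).measurableSet_preimage _
  have hAμ : ∀ c, c ≠ 0 → μ (A c) ≠ ∞ := by
    intro c hc
    obtain ⟨i, hi⟩ := Function.ne_iff.1 hc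
    refine measure_ne_top_of_subset (Set.iInter_subset _ i) ?_
    exact (SimpleFunc.measure_preimage_lt_top_of_memLp hq0 hqt (s i) (hsL i) _ hi).ne
  set T : Set (ι → 𝕜) := Set.range fun x i => s i x with hT
  have hTfin : T.Finite := by
    refine (Set.Finite.pi' fun i => (s i).finite_range).subset ?_
    rintro _ ⟨x, rfl⟩ i
    exact ⟨x, rfl⟩
  -- The joint value `0` is dropped because its level set may have infinite measure, the null level
  -- sets because their indicators cannot be normalized. Neither affects the functions in `L^p`.
  set T' : Set (ι → 𝕜) := {c ∈ T | c ≠ 0 ∧ μ (A c) ≠ 0} with hT'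
  have hT'fin : T'.Finite := hTfin.subset (Set.sep_subset _ _)
  have : Fintype T' := hT'fin.fintype
  set m := Fintype.card T'
  let e : Fin m ≃ T' := (Fintype.equivFin T').symm
  have hBm : ∀ j, MeasurableSet (A (e j)) := fun j => hAm _
  have hBμ : ∀ j, μ (A (e j)) ≠ ∞ := fun j => hAμ _ (e j).2.2.1
  have hBd : ∀ i j, i ≠ j → Disjoint (A (e i)) (A (e j)) := by
    intro i j hij
    rw [Set.disjoint_left]
    intro x hi hj
    rw [hmem] at hi hj
    exact hij (e.injective (Subtype.ext (hi.symm.trans hj)))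
  have hBpos : ∀ j, 0 < μ.real (A (e j)) := fun j =>
    ENNReal.toReal_pos (e j).2.2.2 (hBμ j)
  set w : Fin m → ℝ := fun j => μ.real (A (e j)) ^ (-p⁻¹) with hw
  have hwpos : ∀ j, 0 < w j := fun j => Real.rpow_pos_of_pos (hBpos j) _
  set g : Fin m → Lp 𝕜 (ENNReal.ofReal p) μ := fun j =>
    indicatorConstLp _ (hBm j) (hBμ j) ((w j : ℝ) : 𝕜) with hg
  have hlift : ∀ a : FinLp 𝕜 p m, FinLp.lift p g a =
      ∑ j, indicatorConstLp _ (hBm j) (hBμ j) (a j * ((w j : ℝ) : 𝕜)) := by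
    intro a
    rw [FinLp.lift_apply]
    refine Finset.sum_congr rfl fun j _ => ?_
    rw [hg]
    simp only
    rw [← smul_indicatorConstLp_one, smul_smul, smul_indicatorConstLp_one]
  refine ⟨m, g, fun a => ?_, fun i => ?_⟩
  · refine (Real.rpow_left_inj (norm_nonneg _) (norm_nonneg _) h0.ne').1 ?_
    rw [hlift, norm_sum_indicatorConstLp_rpow _ _ _ hBd, FinLp.norm_rpow]
    refine Finset.sum_congr rfl fun j _ => ?_
    rw [norm_mul, RCLike.norm_ofReal, abs_of_pos (hwpos j), Real.mul_rpow (norm_nonneg _)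
      (hwpos j).le, hw]
    simp only
    rw [← Real.rpow_mul (hBpos j).le, neg_mul, inv_mul_cancel₀ h0.ne', mul_assoc,
      Real.rpow_neg_one, inv_mul_cancel₀ (hBpos j).ne', mul_one]
  · refine ⟨WithLp.toLp _ fun j => (e j : ι → 𝕜) i / ((w j : ℝ) : 𝕜), ?_⟩
    have hw0 : ∀ j, ((w j : ℝ) : 𝕜) ≠ 0 := fun j => by
      exact_mod_cast (hwpos j).ne'
    have hnull : ∀ᵐ x ∂μ, ∀ c ∈ T, μ (A c) = 0 → x ∉ A c := by
      rw [ae_ball_iff hTfin.countable]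
      intro c _
      by_cases hc : μ (A c) = 0
      · simpa [hc] using measure_eq_zero_iff_ae_notMem.1 hc
      · simp [hc]
    have hall : ∀ᵐ x ∂μ, ∀ j, indicatorConstLp (ENNReal.ofReal p) (hBm j) (hBμ j)
        ((e j : ι → 𝕜) i) x = (A (e j)).indicator (fun _ => (e j : ι → 𝕜) i) x :=
      ae_all_iff.2 fun j => indicatorConstLp_coeFn
    have heq : FinLp.lift p g (WithLp.toLp _ fun j => (e j : ι → 𝕜) i / ((w j : ℝ) : 𝕜)) =
        (hsL i).toLp := by
      rw [hlift]
      simp only [div_mul_cancel₀ _ (hw0 _)]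
      ext1
      filter_upwards [hall, hnull, (hsL i).coeFn_toLp, coeFn_finsetSum Finset.univ
        (fun j => indicatorConstLp (ENNReal.ofReal p) (hBm j) (hBμ j) ((e j : ι → 𝕜) i))]
        with x h2 h3 h4 h5
      rw [h4, h5]
      simp only [h2]
      have hx : x ∈ A fun i => s i x := (hmem _ _).2 rfl
      by_cases hc : (fun i => s i x) = 0
      · have : s i x = 0 := congrFun hc i
        rw [this]
        refine Finset.sum_eq_zero fun j _ => Set.indicator_of_notMem (fun hxj => ?_) _
        rw [hmem] at hxj
        exact (e j).2.2.1 (hxj.symm.trans hc)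
      · have hcT : (fun i => s i x) ∈ T' := ⟨⟨x, rfl⟩, hc, fun h => h3 _ ⟨x, rfl⟩ h hx⟩
        obtain ⟨j, hj⟩ := e.surjective ⟨_, hcT⟩
        have hj' : (e j : ι → 𝕜) = fun i => s i x := by rw [hj]
        rw [Finset.sum_eq_single j, Set.indicator_of_mem, hj']
        · rw [hj']; exact hx
        · intro k _ hkj
          refine Set.indicator_of_notMem (fun hxk => ?_) _
          rw [hmem] at hxk
          exact hkj (e.injective (Subtype.ext (hxk.symm.trans hj'.symm)))
        · simp
    rw [heq, Lp.norm_def]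
    refine ENNReal.toReal_le_of_le_ofReal hε.le ?_
    refine le_of_eq_of_le (eLpNorm_congr_ae ?_) (hs i).le
    filter_upwards [Lp.coeFn_sub (f i) (hsL i).toLp, (hsL i).coeFn_toLp] with x h2 h3
    rw [h2, Pi.sub_apply, h3, Pi.sub_apply]

end

end LpIndex

end

noncomputable section

namespace LpIndex

/-! ### Closure properties of computable functions -/

attribute [fun_prop] Computable

/-- Reduces maps over lists to bounded recursion over positions; the default `d` is never reached.
-/
lemma list_map_eq_map_range {β σ : Type*} (l : List β) (g : β → σ) (d : σ) :
    (List.range l.length).map (fun i => (l[i]?).elim d g) = l.map g := by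
  refine List.ext_getElem (by simp) fun i h1 h2 => ?_
  simp at h1
  simp [h1]

lemma list_all_eq_all_range {β : Type*} (l : List β) (g : β → Bool) :
    (List.range l.length).all (fun i => (l[i]?).elim true g) = l.all g := by
  rw [Bool.eq_iff_iff, List.all_eq_true, List.all_eq_true]
  constructor
  · intro h b hb
    obtain ⟨i, hi, rfl⟩ := List.getElem_of_mem hb
    simpa [hi] using h i (List.mem_range.2 hi)
  · intro h i hi
    rw [List.mem_range] at hi
    simpa [hi] using h _ (List.getElem_mem hi)

section ComputableClosure

variable {α β γ σ : Type*} [Primcodable α] [Primcodable β] [Primcodable γ] [Primcodable σ]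

@[fun_prop]
lemma computable_id : Computable fun x : α => x := Computable.id

@[fun_prop]
lemma computable_const (b : β) : Computable fun _ : α => b := Computable.const b

@[fun_prop]
lemma computable_comp {f : β → γ} {g : α → β} (hf : Computable f) (hg : Computable g) :
    Computable fun x => f (g x) := hf.comp hg

@[fun_prop]
lemma computable_pair {f : α → β} {g : α → γ} (hf : Computable f) (hg : Computable g) :
    Computable fun x => (f x, g x) := hf.pair hg

@[fun_prop]
lemma computable_fst {f : α → β × γ} (hf : Computable f) : Computable fun x => (f x).1 :=
  Computable.fst.comp hf

@[fun_prop]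
lemma computable_snd {f : α → β × γ} (hf : Computable f) : Computable fun x => (f x).2 :=
  Computable.snd.comp hf

@[fun_prop]
lemma computable_add {f g : α → ℕ} (hf : Computable f) (hg : Computable g) :
    Computable fun x => f x + g x := Primrec.nat_add.to_comp.comp hf hg

@[fun_prop]
lemma computable_mul {f g : α → ℕ} (hf : Computable f) (hg : Computable g) :
    Computable fun x => f x * g x := Primrec.nat_mul.to_comp.comp hf hg

@[fun_prop]
lemma computable_sub {f g : α → ℕ} (hf : Computable f) (hg : Computable g) :
    Computable fun x => f x - g x := Primrec.nat_sub.to_comp.comp hf hg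

@[fun_prop]
lemma computable_div {f g : α → ℕ} (hf : Computable f) (hg : Computable g) :
    Computable fun x => f x / g x := Primrec.nat_div.to_comp.comp hf hg

@[fun_prop]
lemma computable_mod {f g : α → ℕ} (hf : Computable f) (hg : Computable g) :
    Computable fun x => f x % g x := Primrec.nat_mod.to_comp.comp hf hg

@[fun_prop]
lemma computable_max {f g : α → ℕ} (hf : Computable f) (hg : Computable g) :
    Computable fun x => max (f x) (g x) := Primrec.nat_max.to_comp.comp hf hg

@[fun_prop]
lemma computable_decide_le {f g : α → ℕ} (hf : Computable f) (hg : Computable g) :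
    Computable fun x => decide (f x ≤ g x) := Primrec.nat_le.decide.to_comp.comp hf hg

@[fun_prop]
lemma computable_decide_lt {f g : α → ℕ} (hf : Computable f) (hg : Computable g) :
    Computable fun x => decide (f x < g x) := Primrec.nat_lt.decide.to_comp.comp hf hg

@[fun_prop]
lemma computable_decide_eq [DecidableEq β] {f g : α → β} (hf : Computable f) (hg : Computable g) :
    Computable fun x => decide (f x = g x) := Primrec.eq.decide.to_comp.comp hf hg

@[fun_prop]
lemma computable_and {f g : α → Bool} (hf : Computable f) (hg : Computable g) :
    Computable fun x => f x && g x := Primrec.and.to_comp.comp hf hg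

@[fun_prop]
lemma computable_or {f g : α → Bool} (hf : Computable f) (hg : Computable g) :
    Computable fun x => f x || g x := Primrec.or.to_comp.comp hf hg

@[fun_prop]
lemma computable_cond {c : α → Bool} {f g : α → β} (hc : Computable c) (hf : Computable f)
    (hg : Computable g) : Computable fun x => bif c x then f x else g x := Computable.cond hc hf hg

@[fun_prop]
lemma computable_some {f : α → β} (hf : Computable f) : Computable fun x => some (f x) :=
  Computable.option_some.comp hf

@[fun_prop]
lemma computable_encode {f : α → β} (hf : Computable f) :
    Computable fun x => Encodable.encode (f x) := Computable.encode.comp hf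

@[fun_prop]
lemma computable_decode {f : α → ℕ} (hf : Computable f) :
    Computable fun x => (Encodable.decode (f x) : Option β) := Computable.decode.comp hf

@[fun_prop]
lemma computable_length {f : α → List β} (hf : Computable f) : Computable fun x => (f x).length :=
  Computable.list_length.comp hf

@[fun_prop]
lemma computable_getElem? {f : α → List β} {g : α → ℕ} (hf : Computable f) (hg : Computable g) :
    Computable fun x => (f x)[g x]? := Computable.list_getElem?.comp hf hg

@[fun_prop]
lemma computable_getD {f : α → List β} {g : α → ℕ} (d : β) (hf : Computable f)
    (hg : Computable g) : Computable fun x => (f x).getD (g x) d :=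
  (Primrec.list_getD d).to_comp.comp hf hg

@[fun_prop]
lemma computable_append {f g : α → List β} (hf : Computable f) (hg : Computable g) :
    Computable fun x => f x ++ g x := Computable.list_append.comp hf hg

@[fun_prop]
lemma computable_cons {f : α → β} {g : α → List β} (hf : Computable f) (hg : Computable g) :
    Computable fun x => f x :: g x := Computable.list_cons.comp hf hg

@[fun_prop]
lemma computable_take {f : α → ℕ} {g : α → List β} (hf : Computable f) (hg : Computable g) :
    Computable fun x => (g x).take (f x) := Primrec.list_take.to_comp.comp hf hg

lemma computable_natRec {f : α → ℕ} {g : α → σ} {h : α → ℕ → σ → σ} (hf : Computable f)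
    (hg : Computable g) (hh : Computable fun z : α × ℕ × σ => h z.1 z.2.1 z.2.2) :
    Computable fun x => (Nat.rec (g x) (h x) (f x) : σ) :=
  Computable.nat_rec hf hg (h := fun x z => h x z.1 z.2) hh

@[fun_prop]
lemma computable_option_elim {o : α → Option β} {g : α → σ} {h : α → β → σ} (ho : Computable o)
    (hg : Computable g) (hh : Computable fun z : α × β => h z.1 z.2) :
    Computable fun x => (o x).elim (g x) (h x) :=
  (Computable.option_casesOn ho hg (g := h) hh).of_eq fun x => by cases o x <;> rfl

@[fun_prop]
lemma computable_pow {f g : α → ℕ} (hf : Computable f) (hg : Computable g) :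
    Computable fun x => f x ^ g x :=
  (computable_natRec (h := fun x _ s => s * f x) hg (computable_const 1) (by fun_prop)).of_eq
    fun x => by induction g x with
      | zero => rfl
      | succ n ih => rw [pow_succ, ← ih]

@[fun_prop]
lemma computable_sum_range {f : α → ℕ} {g : α → ℕ → ℕ} (hf : Computable f)
    (hg : Computable fun z : α × ℕ => g z.1 z.2) :
    Computable fun x => ∑ i ∈ Finset.range (f x), g x i :=
  (computable_natRec (h := fun x n s => s + g x n) hf (computable_const 0) (by fun_prop)).of_eq
    fun x => by induction f x with
      | zero => rfl
      | succ n ih => rw [Finset.sum_range_succ, ← ih]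

@[fun_prop]
lemma computable_all_range {f : α → ℕ} {g : α → ℕ → Bool} (hf : Computable f)
    (hg : Computable fun z : α × ℕ => g z.1 z.2) :
    Computable fun x => (List.range (f x)).all (g x) :=
  (computable_natRec (h := fun x n s => s && g x n) hf (computable_const true) (by fun_prop)).of_eq
    fun x => by induction f x with
      | zero => rfl
      | succ n ih => rw [List.range_succ, List.all_append, ← ih]; simp

@[fun_prop]
lemma computable_map_range {f : α → ℕ} {g : α → ℕ → β} (hf : Computable f)
    (hg : Computable fun z : α × ℕ => g z.1 z.2) :
    Computable fun x => (List.range (f x)).map (g x) :=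
  (computable_natRec (h := fun x n s => s ++ [g x n]) hf (computable_const [])
    (by fun_prop)).of_eq
    fun x => by induction f x with
      | zero => rfl
      | succ n ih => rw [List.range_succ, List.map_append, ← ih]; rfl

@[fun_prop]
lemma computable_list_map {f : α → List β} {g : α → β → σ} (hf : Computable f)
    (hg : Computable fun z : α × β => g z.1 z.2) : Computable fun x => (f x).map (g x) := by
  have h : Computable fun x => (List.range (f x).length).map
      (fun i => ((f x)[i]?).elim none (fun b => some (g x b))) := by fun_prop
  have h2 : Computable fun l : List (Option σ) => l.filterMap id :=
    (Primrec.listFilterMap Primrec.id Primrec₂.right).to_comp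
  refine (h2.comp h).of_eq fun x => ?_
  rw [list_map_eq_map_range, List.filterMap_map]
  simp

@[fun_prop]
lemma computable_list_all {f : α → List β} {g : α → β → Bool} (hf : Computable f)
    (hg : Computable fun z : α × β => g z.1 z.2) : Computable fun x => (f x).all (g x) := by
  have h : Computable fun x => (List.range (f x).length).all
      (fun i => ((f x)[i]?).elim true (g x)) := by fun_prop
  exact h.of_eq fun x => list_all_eq_all_range _ _

@[fun_prop]
lemma computable_filterMap {f : α → List β} {g : α → β → Option σ} (hf : Computable f)
    (hg : Computable fun z : α × β => g z.1 z.2) : Computable fun x => (f x).filterMap (g x) := by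
  have h : Computable fun x => (f x).map (g x) := by fun_prop
  have h2 : Computable fun l : List (Option σ) => l.filterMap id :=
    (Primrec.listFilterMap Primrec.id Primrec₂.right).to_comp
  refine (h2.comp h).of_eq fun x => ?_
  rw [List.filterMap_map]; rfl

end ComputableClosure

end LpIndex

end

noncomputable section

namespace LpIndex

/-! ### Arithmetic of codes of rationals -/

namespace RatCode

/-- The code of a natural number over a positive denominator `d + 1`. -/
def frac (n d : ℕ) : RatCode := ((n, 0), d)

def add (q r : RatCode) : RatCode :=
  ((q.1.1 * (r.2 + 1) + r.1.1 * (q.2 + 1), q.1.2 * (r.2 + 1) + r.1.2 * (q.2 + 1)),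
    q.2 * r.2 + q.2 + r.2)

def mul (q r : RatCode) : RatCode :=
  ((q.1.1 * r.1.1 + q.1.2 * r.1.2, q.1.1 * r.1.2 + q.1.2 * r.1.1), q.2 * r.2 + q.2 + r.2)

def neg (q : RatCode) : RatCode := ((q.1.2, q.1.1), q.2)

/-- The decision procedure for the order of the coded rationals. -/
def le (q r : RatCode) : Bool :=
  decide (q.1.1 * (r.2 + 1) + r.1.2 * (q.2 + 1) ≤ r.1.1 * (q.2 + 1) + q.1.2 * (r.2 + 1))

/-- The decision procedure for the strict order of the coded rationals. -/
def lt (q r : RatCode) : Bool :=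
  decide (q.1.1 * (r.2 + 1) + r.1.2 * (q.2 + 1) < r.1.1 * (q.2 + 1) + q.1.2 * (r.2 + 1))

lemma val_frac (n d : ℕ) : (frac n d).val = n / (d + 1) := by simp [frac, val]

lemma val_add (q r : RatCode) : (add q r).val = q.val + r.val := by
  have h1 : (q.2 : ℚ) + 1 ≠ 0 := by positivity
  have h2 : (r.2 : ℚ) + 1 ≠ 0 := by positivity
  have h3 : (q.2 * r.2 + q.2 + r.2 : ℚ) + 1 = (q.2 + 1) * (r.2 + 1) := by ring
  simp only [add, val]
  push_cast
  rw [h3]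
  field_simp
  ring

lemma val_mul (q r : RatCode) : (mul q r).val = q.val * r.val := by
  have h1 : (q.2 : ℚ) + 1 ≠ 0 := by positivity
  have h2 : (r.2 : ℚ) + 1 ≠ 0 := by positivity
  have h3 : (q.2 * r.2 + q.2 + r.2 : ℚ) + 1 = (q.2 + 1) * (r.2 + 1) := by ring
  simp only [mul, val]
  push_cast
  rw [h3]
  field_simp
  ring

lemma val_neg (q : RatCode) : (neg q).val = -q.val := by
  simp only [neg, val]
  ring

lemma le_iff (q r : RatCode) : le q r = true ↔ q.val ≤ r.val := by
  have h1 : (0 : ℚ) < (q.2 : ℚ) + 1 := by positivity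
  have h2 : (0 : ℚ) < (r.2 : ℚ) + 1 := by positivity
  rw [le, decide_eq_true_iff, val, val, div_le_div_iff₀ h1 h2, ← Nat.cast_le (α := ℚ)]
  push_cast
  constructor <;> intro h <;> linarith

lemma lt_iff (q r : RatCode) : lt q r = true ↔ q.val < r.val := by
  have h1 : (0 : ℚ) < (q.2 : ℚ) + 1 := by positivity
  have h2 : (0 : ℚ) < (r.2 : ℚ) + 1 := by positivity
  rw [lt, decide_eq_true_iff, val, val, div_lt_div_iff₀ h1 h2, ← Nat.cast_lt (α := ℚ)]
  push_cast
  constructor <;> intro h <;> linarith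

lemma exists_val_eq (x : ℚ) : ∃ q : RatCode, q.val = x := by
  refine ⟨((x.num.toNat, (-x.num).toNat), x.den - 1), ?_⟩
  have hd : ((x.den - 1 : ℕ) : ℚ) + 1 = x.den := by
    have := x.den_pos
    rw [Nat.cast_sub (by omega)]; simp
  have hn : ((x.num.toNat : ℕ) : ℚ) - ((-x.num).toNat : ℕ) = x.num := by
    rcases le_total 0 x.num with h | h
    · obtain ⟨n, hn⟩ := Int.eq_ofNat_of_zero_le h
      rw [hn]; simp
    · obtain ⟨n, hn⟩ := Int.eq_ofNat_of_zero_le (neg_nonneg.2 h)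
      have : x.num = -n := by omega
      rw [this]; simp
  rw [val]
  simp only
  rw [hd, hn, Rat.num_div_den]

end RatCode

section

variable {α : Type*} [Primcodable α]

@[fun_prop]
lemma computable_frac {f g : α → ℕ} (hf : Computable f) (hg : Computable g) :
    Computable fun x => RatCode.frac (f x) (g x) := by unfold RatCode.frac; fun_prop

@[fun_prop]
lemma computable_ratAdd {f g : α → RatCode} (hf : Computable f) (hg : Computable g) :
    Computable fun x => RatCode.add (f x) (g x) := by unfold RatCode.add; fun_prop

@[fun_prop]
lemma computable_ratMul {f g : α → RatCode} (hf : Computable f) (hg : Computable g) :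
    Computable fun x => RatCode.mul (f x) (g x) := by unfold RatCode.mul; fun_prop

@[fun_prop]
lemma computable_ratNeg {f : α → RatCode} (hf : Computable f) :
    Computable fun x => RatCode.neg (f x) := by unfold RatCode.neg; fun_prop

@[fun_prop]
lemma computable_ratLe {f g : α → RatCode} (hf : Computable f) (hg : Computable g) :
    Computable fun x => RatCode.le (f x) (g x) := by unfold RatCode.le; fun_prop

@[fun_prop]
lemma computable_ratLt {f g : α → RatCode} (hf : Computable f) (hg : Computable g) :
    Computable fun x => RatCode.lt (f x) (g x) := by unfold RatCode.lt; fun_prop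

end

/-! ### Intervals -/

namespace IntervalCode

def radius (I : IntervalCode) : RatCode := ((I.2.1 + 1, 0), I.2.2)

/-- The left end of an interval. -/
def lo (I : IntervalCode) : RatCode := RatCode.add I.1 (RatCode.neg I.radius)

/-- The right end of an interval. -/
def hi (I : IntervalCode) : RatCode := RatCode.add I.1 I.radius

/-- The interval with center `c` and radius `2 ^ (-k)`. -/
def dyadic (c : RatCode) (k : ℕ) : IntervalCode := (c, (0, 2 ^ k - 1))

lemma val_radius (I : IntervalCode) : I.radius.val = I.2.val := by
  simp [radius, RatCode.val, PosRatCode.val]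

lemma val_lo (I : IntervalCode) : I.lo.val = I.1.val - I.2.val := by
  rw [lo, RatCode.val_add, RatCode.val_neg, val_radius, sub_eq_add_neg]

lemma val_hi (I : IntervalCode) : I.hi.val = I.1.val + I.2.val := by
  rw [hi, RatCode.val_add, val_radius]

lemma mem_toSet {I : IntervalCode} {x : ℝ} :
    x ∈ I.toSet ↔ (I.lo.val : ℝ) < x ∧ x < (I.hi.val : ℝ) := by
  rw [IntervalCode.toSet, Metric.mem_ball, Real.dist_eq, abs_lt, val_lo, val_hi]
  push_cast
  constructor <;> rintro ⟨h1, h2⟩ <;> constructor <;> linarith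

lemma val_dyadic_radius (c : RatCode) (k : ℕ) : (dyadic c k).2.val = ((2 : ℚ) ^ k)⁻¹ := by
  simp [dyadic, PosRatCode.val]

lemma mem_dyadic {c : RatCode} {k : ℕ} {x : ℝ} :
    x ∈ (dyadic c k).toSet ↔ |x - c.val| < ((2 : ℝ) ^ k)⁻¹ := by
  rw [IntervalCode.toSet, val_dyadic_radius, Metric.mem_ball, Real.dist_eq]
  push_cast
  rfl

end IntervalCode

section

variable {α : Type*} [Primcodable α]

@[fun_prop]
lemma computable_lo {f : α → IntervalCode} (hf : Computable f) :
    Computable fun x => (f x).lo := by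
  unfold IntervalCode.lo IntervalCode.radius; fun_prop

@[fun_prop]
lemma computable_hi {f : α → IntervalCode} (hf : Computable f) :
    Computable fun x => (f x).hi := by
  unfold IntervalCode.hi IntervalCode.radius; fun_prop

@[fun_prop]
lemma computable_dyadic {f : α → RatCode} {g : α → ℕ} (hf : Computable f) (hg : Computable g) :
    Computable fun x => IntervalCode.dyadic (f x) (g x) := by
  unfold IntervalCode.dyadic; fun_prop

end

/-! ### Scalars -/

/-- The square of the norm of the imaginary unit: `0` over `ℝ` and `1` over `ℂ`. -/
def imSq (𝕜 : Type*) [RCLike 𝕜] : ℕ := open Classical in if (RCLike.I : 𝕜) = 0 then 0 else 1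

/-- The real and the complex case share one arithmetic: the decision procedures depend on the field
only through the number `imSq 𝕜`. -/
lemma I_mul_I_eq (𝕜 : Type*) [RCLike 𝕜] : (RCLike.I : 𝕜) * RCLike.I = -(imSq 𝕜 : 𝕜) := by
  classical
  rw [imSq]
  split_ifs with h
  · simp [h]
  · rcases RCLike.I_mul_I_ax (K := 𝕜) with h' | h'
    · exact absurd h' h
    · simp [h']

lemma im_I_mul_im_I (𝕜 : Type*) [RCLike 𝕜] :
    RCLike.im (RCLike.I : 𝕜) * RCLike.im (RCLike.I : 𝕜) = imSq 𝕜 := by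
  have := congrArg RCLike.re (I_mul_I_eq 𝕜)
  rw [RCLike.mul_re, RCLike.I_re, map_neg, RCLike.natCast_re] at this
  linarith

namespace ScalarCode

/-- The code of a rational as a scalar. -/
def ofRat (q : RatCode) : ScalarCode := (q, RatCode.frac 0 0)

def zero : ScalarCode := ofRat (RatCode.frac 0 0)

def one : ScalarCode := ofRat (RatCode.frac 1 0)

def negOne : ScalarCode := ofRat (RatCode.neg (RatCode.frac 1 0))

def add (a b : ScalarCode) : ScalarCode := (RatCode.add a.1 b.1, RatCode.add a.2 b.2)

/-- Multiplication, where `δ` is minus the square of the imaginary unit. -/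
def mul (δ : ℕ) (a b : ScalarCode) : ScalarCode :=
  (RatCode.add (RatCode.mul a.1 b.1)
      (RatCode.neg (RatCode.mul (RatCode.frac δ 0) (RatCode.mul a.2 b.2))),
    RatCode.add (RatCode.mul a.1 b.2) (RatCode.mul a.2 b.1))

/-- The square of the norm. -/
def normSq (δ : ℕ) (a : ScalarCode) : RatCode :=
  RatCode.add (RatCode.mul a.1 a.1) (RatCode.mul (RatCode.frac δ 0) (RatCode.mul a.2 a.2))

variable {𝕜 : Type*} [RCLike 𝕜]

lemma val_ofRat (q : RatCode) : (ofRat q).val 𝕜 = ((q.val : ℚ) : 𝕜) := by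
  simp [ofRat, ScalarCode.val, RatCode.val_frac]

lemma val_zero : zero.val 𝕜 = 0 := by simp [zero, val_ofRat, RatCode.val_frac]

lemma val_one : one.val 𝕜 = 1 := by simp [one, val_ofRat, RatCode.val_frac]

lemma val_negOne : negOne.val 𝕜 = -1 := by
  simp [negOne, val_ofRat, RatCode.val_frac, RatCode.val_neg]

lemma val_add (a b : ScalarCode) : (add a b).val 𝕜 = a.val 𝕜 + b.val 𝕜 := by
  simp only [add, ScalarCode.val, RatCode.val_add]
  push_cast
  ring

lemma val_mul (a b : ScalarCode) : (mul (imSq 𝕜) a b).val 𝕜 = a.val 𝕜 * b.val 𝕜 := by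
  simp only [mul, ScalarCode.val, RatCode.val_add, RatCode.val_mul, RatCode.val_neg,
    RatCode.val_frac]
  push_cast
  have := I_mul_I_eq 𝕜
  linear_combination (-(a.2.val : 𝕜) * (b.2.val : 𝕜)) * this

lemma val_normSq (a : ScalarCode) : ((normSq (imSq 𝕜) a).val : ℝ) = ‖a.val 𝕜‖ ^ 2 := by
  have hr : ∀ x : ℚ, ((x : ℚ) : 𝕜) = ((x : ℝ) : 𝕜) := fun x => by simp
  have h1 : RCLike.re (a.val 𝕜) = (a.1.val : ℝ) := by
    rw [ScalarCode.val, hr, hr, map_add, RCLike.ofReal_re, RCLike.re_ofReal_mul, RCLike.I_re]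
    ring
  have h2 : RCLike.im (a.val 𝕜) = (a.2.val : ℝ) * RCLike.im (RCLike.I : 𝕜) := by
    rw [ScalarCode.val, hr, hr, map_add, RCLike.ofReal_im, RCLike.im_ofReal_mul]
    ring
  rw [RCLike.norm_sq_eq_def, h1, h2]
  simp only [normSq, RatCode.val_add, RatCode.val_mul, RatCode.val_frac]
  push_cast
  have := im_I_mul_im_I 𝕜
  linear_combination (-(a.2.val : ℝ) * (a.2.val : ℝ)) * this

/-- The rational scalars are dense. -/
lemma exists_norm_sub_val_lt (z : 𝕜) {ε : ℝ} (hε : 0 < ε) :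
    ∃ a : ScalarCode, ‖z - a.val 𝕜‖ < ε := by
  obtain ⟨x, hx1, hx2⟩ := exists_rat_btwn (show RCLike.re z - ε / 2 < RCLike.re z by linarith)
  obtain ⟨y, hy1, hy2⟩ := exists_rat_btwn (show RCLike.im z - ε / 2 < RCLike.im z by linarith)
  obtain ⟨q, rfl⟩ := RatCode.exists_val_eq x
  obtain ⟨r, rfl⟩ := RatCode.exists_val_eq y
  refine ⟨(q, r), ?_⟩
  have hr : ∀ x : ℚ, ((x : ℚ) : 𝕜) = ((x : ℝ) : 𝕜) := fun x => by simp
  have e : z - ScalarCode.val 𝕜 (q, r) = ((RCLike.re z - q.val : ℝ) : 𝕜) +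
      ((RCLike.im z - r.val : ℝ) : 𝕜) * RCLike.I := by
    conv_lhs => rw [← RCLike.re_add_im z]
    rw [ScalarCode.val, hr, hr]
    push_cast
    ring
  rw [e]
  refine (norm_add_le _ _).trans_lt ?_
  rw [norm_mul, RCLike.norm_ofReal, RCLike.norm_ofReal, abs_of_pos (by linarith),
    abs_of_pos (by linarith)]
  have hI : ‖(RCLike.I : 𝕜)‖ ≤ 1 := by
    rcases eq_or_ne (RCLike.I : 𝕜) 0 with h | h
    · rw [h, norm_zero]; exact zero_le_one
    · exact (RCLike.norm_I_of_ne_zero h).le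
  nlinarith [norm_nonneg (RCLike.I : 𝕜)]

end ScalarCode

section

variable {α : Type*} [Primcodable α]

@[fun_prop]
lemma computable_ofRat {f : α → RatCode} (hf : Computable f) :
    Computable fun x => ScalarCode.ofRat (f x) := by unfold ScalarCode.ofRat; fun_prop

@[fun_prop]
lemma computable_scalarAdd {f g : α → ScalarCode} (hf : Computable f) (hg : Computable g) :
    Computable fun x => ScalarCode.add (f x) (g x) := by unfold ScalarCode.add; fun_prop

@[fun_prop]
lemma computable_scalarMul (δ : ℕ) {f g : α → ScalarCode} (hf : Computable f)
    (hg : Computable g) : Computable fun x => ScalarCode.mul δ (f x) (g x) := by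
  unfold ScalarCode.mul; fun_prop

@[fun_prop]
lemma computable_normSq (δ : ℕ) {f : α → ScalarCode} (hf : Computable f) :
    Computable fun x => ScalarCode.normSq δ (f x) := by
  unfold ScalarCode.normSq; fun_prop

end

/-! ### Rational vectors -/

namespace VectorCode

/-- The code of `a • v + b • w`. -/
def lin (δ : ℕ) (a : ScalarCode) (v : VectorCode) (b : ScalarCode) (w : VectorCode) : VectorCode :=
  (List.range (max v.length w.length)).map fun i =>
    ScalarCode.add (ScalarCode.mul δ a (v.getD i ScalarCode.zero))
      (ScalarCode.mul δ b (w.getD i ScalarCode.zero))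

/-- The decision procedure for the vanishing of a rational vector. -/
def isZero (δ : ℕ) (v : VectorCode) : Bool :=
  (List.range v.length).all fun i =>
    RatCode.le (ScalarCode.normSq δ (v.getD i ScalarCode.zero)) (RatCode.frac 0 0)

/-- The code of the combination of the first `n` vectors of the list `u` with the coefficients
`c`. -/
def comb (δ : ℕ) (c : List ScalarCode) (u : List VectorCode) (n : ℕ) : VectorCode :=
  Nat.rec [] (fun i s => lin δ ScalarCode.one s (c.getD i ScalarCode.zero) (u.getD i [])) n

variable (𝕜 : Type*) [RCLike 𝕜]

/-- The finitely supported sequence of coefficients of a rational vector. -/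
def toFinsupp (v : VectorCode) : ℕ →₀ 𝕜 :=
  Finsupp.onFinset (Finset.range v.length) (fun i => (v.getD i ScalarCode.zero).val 𝕜) (by
    intro i hi
    rw [Finset.mem_range]
    by_contra h
    rw [List.getD_eq_default _ _ (not_lt.1 h), ScalarCode.val_zero] at hi
    exact hi rfl)

variable {𝕜}

lemma toFinsupp_apply (v : VectorCode) (i : ℕ) :
    toFinsupp 𝕜 v i = (v.getD i ScalarCode.zero).val 𝕜 := rfl

lemma toFinsupp_lin (a : ScalarCode) (v : VectorCode) (b : ScalarCode) (w : VectorCode) :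
    toFinsupp 𝕜 (lin (imSq 𝕜) a v b w) = a.val 𝕜 • toFinsupp 𝕜 v + b.val 𝕜 • toFinsupp 𝕜 w := by
  ext i
  simp only [Finsupp.add_apply, Finsupp.smul_apply, toFinsupp_apply, smul_eq_mul]
  by_cases h : i < max v.length w.length
  · rw [lin, List.getD_eq_getElem _ _ (by simpa using h), List.getElem_map, List.getElem_range,
      ScalarCode.val_add, ScalarCode.val_mul, ScalarCode.val_mul]
  · have h' := not_lt.1 h
    rw [List.getD_eq_default _ _ (by simpa [lin] using h'),
      List.getD_eq_default _ _ ((le_max_left _ _).trans h'),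
      List.getD_eq_default _ _ ((le_max_right _ _).trans h')]
    simp [ScalarCode.val_zero]

lemma isZero_iff (v : VectorCode) : isZero (imSq 𝕜) v = true ↔ toFinsupp 𝕜 v = 0 := by
  have key : ∀ a : ScalarCode, RatCode.le (ScalarCode.normSq (imSq 𝕜) a) (RatCode.frac 0 0) = true ↔
      a.val 𝕜 = 0 := by
    intro a
    rw [RatCode.le_iff, RatCode.val_frac, ← Rat.cast_le (K := ℝ), ScalarCode.val_normSq]
    simp only [Nat.cast_zero, zero_add, div_one, Rat.cast_zero]
    constructor
    · intro h
      have : ‖a.val 𝕜‖ = 0 := by nlinarith [norm_nonneg (a.val 𝕜)]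
      exact norm_eq_zero.1 this
    · intro h; rw [h]; simp
  rw [isZero, List.all_eq_true]
  simp only [key]
  constructor
  · intro h
    ext i
    rw [toFinsupp_apply, Finsupp.zero_apply]
    by_cases hi : i < v.length
    · exact h i (List.mem_range.2 hi)
    · rw [List.getD_eq_default _ _ (not_lt.1 hi), ScalarCode.val_zero]
  · intro h i _
    have := DFunLike.congr_fun h i
    rwa [toFinsupp_apply] at this

lemma toFinsupp_comb (c : List ScalarCode) (u : List VectorCode) (n : ℕ) :
    toFinsupp 𝕜 (comb (imSq 𝕜) c u n) =
      ∑ i ∈ Finset.range n, (c.getD i ScalarCode.zero).val 𝕜 • toFinsupp 𝕜 (u.getD i []) := by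
  induction n with
  | zero => ext i; simp [comb, toFinsupp_apply, ScalarCode.val_zero]
  | succ n ih =>
    rw [Finset.sum_range_succ, ← ih]
    change toFinsupp 𝕜 (lin _ _ (comb (imSq 𝕜) c u n) _ _) = _
    rw [toFinsupp_lin, ScalarCode.val_one, one_smul]

lemma exists_toFinsupp_single (j : ℕ) (a : ScalarCode) :
    ∃ v : VectorCode, toFinsupp 𝕜 v = Finsupp.single j (a.val 𝕜) := by
  refine ⟨List.replicate j ScalarCode.zero ++ [a], ?_⟩
  ext i
  rw [toFinsupp_apply, Finsupp.single_apply]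
  rcases lt_trichotomy i j with h | rfl | h
  · rw [if_neg h.ne', List.getD_append _ _ _ _ (by simpa using h),
      List.getD_eq_getElem _ _ (by simpa using h), List.getElem_replicate, ScalarCode.val_zero]
  · rw [if_pos rfl, List.getD_append_right _ _ _ _ (by simp)]
    simp
  · rw [if_neg h.ne, List.getD_eq_default _ _ (by simp; omega), ScalarCode.val_zero]

end VectorCode

lemma Presentation.vec_eq {𝕜 : Type*} [RCLike 𝕜] {B : Type*} [NormedAddCommGroup B]
    [NormedSpace 𝕜 B] (S : Presentation 𝕜 B) (v : VectorCode) :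
    S.vec v = Finsupp.linearCombination 𝕜 S.point (VectorCode.toFinsupp 𝕜 v) := by
  have hs : (VectorCode.toFinsupp 𝕜 v).support ⊆ Finset.range v.length :=
    Finsupp.support_onFinset_subset
  rw [Finsupp.linearCombination_apply, Finsupp.sum_of_support_subset _ hs _ (by simp),
    Presentation.vec, Finset.sum_range]
  refine Finset.sum_congr rfl fun j _ => ?_
  rw [VectorCode.toFinsupp_apply, List.getD_eq_getElem _ _ j.2]
  rfl

section

variable {α : Type*} [Primcodable α]

@[fun_prop]
lemma computable_lin (δ : ℕ) {a b : α → ScalarCode} {v w : α → VectorCode} (ha : Computable a)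
    (hv : Computable v) (hb : Computable b) (hw : Computable w) :
    Computable fun x => VectorCode.lin δ (a x) (v x) (b x) (w x) := by
  unfold VectorCode.lin; fun_prop

@[fun_prop]
lemma computable_isZero (δ : ℕ) {v : α → VectorCode} (hv : Computable v) :
    Computable fun x => VectorCode.isZero δ (v x) := by
  unfold VectorCode.isZero; fun_prop

@[fun_prop]
lemma computable_comb (δ : ℕ) {c : α → List ScalarCode} {u : α → List VectorCode} {n : α → ℕ}
    (hc : Computable c) (hu : Computable u) (hn : Computable n) :
    Computable fun x => VectorCode.comb δ (c x) (u x) (n x) := by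
  unfold VectorCode.comb
  exact computable_natRec (h := fun x i s => VectorCode.lin δ ScalarCode.one s
    ((c x).getD i ScalarCode.zero) ((u x).getD i [])) hn (by fun_prop) (by fun_prop)

end

end LpIndex

end

noncomputable section

namespace LpIndex

/-! ### The seminorm of a norm function on codes -/

section

variable {𝕜 : Type*} [RCLike 𝕜]

/-- A function on codes of rational vectors which satisfies the inequalities of a seminorm, with
rational bounds for the norms of the coefficients. -/
def IsNormFunction (𝕜 : Type*) [RCLike 𝕜] (N : VectorCode → ℝ) : Prop :=
  ∀ (x : VectorCode) (a : ScalarCode) (v : VectorCode) (b : ScalarCode) (w : VectorCode) (α β : ℚ),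
    VectorCode.toFinsupp 𝕜 x = a.val 𝕜 • VectorCode.toFinsupp 𝕜 v +
      b.val 𝕜 • VectorCode.toFinsupp 𝕜 w →
    0 ≤ α → 0 ≤ β → ‖a.val 𝕜‖ ≤ α → ‖b.val 𝕜‖ ≤ β → N x ≤ α * N v + β * N w

open VectorCode

namespace IsNormFunction

variable {N : VectorCode → ℝ}

lemma toFinsupp_nil : toFinsupp 𝕜 [] = 0 := by
  ext i; simp [toFinsupp_apply, ScalarCode.val_zero]

/-- The bounds `α`, `β` need not be tight. With both equal to `0` the value is at most `0`, and with
`α = 2` it is at most twice itself, hence nonnegative. -/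
lemma apply_nil (hN : IsNormFunction 𝕜 N) : N [] = 0 := by
  have h1 := hN [] ScalarCode.zero [] ScalarCode.zero [] 0 0 (by simp [ScalarCode.val_zero, toFinsupp_nil])
    le_rfl le_rfl (by simp [ScalarCode.val_zero]) (by simp [ScalarCode.val_zero])
  have h2 := hN [] ScalarCode.zero [] ScalarCode.zero [] 2 0 (by simp [ScalarCode.val_zero, toFinsupp_nil])
    zero_le_two le_rfl (by simp [ScalarCode.val_zero]) (by simp [ScalarCode.val_zero])
  norm_num at h1 h2
  linarith

lemma nonneg (hN : IsNormFunction 𝕜 N) (v : VectorCode) : 0 ≤ N v := by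
  have h1 := hN [] ScalarCode.zero v ScalarCode.zero v 1 0 (by simp [ScalarCode.val_zero, toFinsupp_nil])
    zero_le_one le_rfl (by simp [ScalarCode.val_zero]) (by simp [ScalarCode.val_zero])
  rw [hN.apply_nil] at h1
  simpa using h1

lemma le_norm_mul (hN : IsNormFunction 𝕜 N) {x v w : VectorCode} {a b : ScalarCode}
    (h : toFinsupp 𝕜 x = a.val 𝕜 • toFinsupp 𝕜 v + b.val 𝕜 • toFinsupp 𝕜 w) :
    N x ≤ ‖a.val 𝕜‖ * N v + ‖b.val 𝕜‖ * N w := by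
  refine le_of_forall_pos_le_add fun ε hε => ?_
  have hv := hN.nonneg v
  have hw := hN.nonneg w
  have hη : 0 < ε / (N v + N w + 1) := by positivity
  obtain ⟨α, h1, h2⟩ := exists_rat_btwn (lt_add_of_pos_right ‖a.val 𝕜‖ hη)
  obtain ⟨β, h3, h4⟩ := exists_rat_btwn (lt_add_of_pos_right ‖b.val 𝕜‖ hη)
  have hα : (0 : ℝ) ≤ α := (norm_nonneg _).trans h1.le
  have hβ : (0 : ℝ) ≤ β := (norm_nonneg _).trans h3.le
  have key := hN x a v b w α β h (by exact_mod_cast hα) (by exact_mod_cast hβ) h1.le h3.le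
  have e : ε / (N v + N w + 1) * (N v + N w + 1) = ε := by field_simp
  nlinarith [mul_le_mul_of_nonneg_right h2.le hv, mul_le_mul_of_nonneg_right h4.le hw]

/-- Applied in both directions, this shows that codes of the same sequence have the same value. -/
lemma congr (hN : IsNormFunction 𝕜 N) {x v : VectorCode} (h : toFinsupp 𝕜 x = toFinsupp 𝕜 v) :
    N x ≤ N v := by
  have := hN.le_norm_mul (x := x) (a := ScalarCode.one) (v := v) (b := ScalarCode.zero) (w := [])
    (by simp [ScalarCode.val_one, ScalarCode.val_zero, h])
  simpa [ScalarCode.val_one, ScalarCode.val_zero] using this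

/-- A code of a unit vector. -/
def unitCode (𝕜 : Type*) [RCLike 𝕜] (j : ℕ) : VectorCode :=
  (exists_toFinsupp_single (𝕜 := 𝕜) j ScalarCode.one).choose

lemma toFinsupp_unitCode (j : ℕ) : toFinsupp 𝕜 (unitCode 𝕜 j) = Finsupp.single j 1 := by
  have := (exists_toFinsupp_single (𝕜 := 𝕜) j ScalarCode.one).choose_spec
  exact this.trans (by rw [ScalarCode.val_one])

/-- The sum of the norms of the terms of a combination of unit vectors. -/
def sumNorm (N : VectorCode → ℝ) (y : ℕ →₀ 𝕜) : ℝ := y.sum fun j c => ‖c‖ * N (unitCode 𝕜 j)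

lemma sumNorm_nonneg (hN : IsNormFunction 𝕜 N) (y : ℕ →₀ 𝕜) : 0 ≤ sumNorm N y :=
  Finset.sum_nonneg fun _ _ => mul_nonneg (norm_nonneg _) (hN.nonneg _)

lemma sumNorm_eq {y : ℕ →₀ 𝕜} {t : Finset ℕ} (h : y.support ⊆ t) :
    sumNorm N y = ∑ j ∈ t, ‖y j‖ * N (unitCode 𝕜 j) :=
  Finsupp.sum_of_support_subset _ h _ (by simp)

lemma sumNorm_add (hN : IsNormFunction 𝕜 N) (x y : ℕ →₀ 𝕜) :
    sumNorm N (x + y) ≤ sumNorm N x + sumNorm N y := by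
  classical
  rw [sumNorm_eq (Finsupp.support_add (g₁ := x) (g₂ := y)), sumNorm_eq (y := x) Finset.subset_union_left,
    sumNorm_eq (y := y) Finset.subset_union_right, ← Finset.sum_add_distrib]
  refine Finset.sum_le_sum fun j _ => ?_
  rw [← add_mul]
  exact mul_le_mul_of_nonneg_right (norm_add_le _ _) (hN.nonneg _)

lemma sumNorm_smul (c : 𝕜) (x : ℕ →₀ 𝕜) : sumNorm N (c • x) = ‖c‖ * sumNorm N x := by
  rw [sumNorm_eq (Finsupp.support_smul (b := c) (g := x)), sumNorm_eq subset_rfl, Finset.mul_sum]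
  exact Finset.sum_congr rfl fun j _ => by simp [mul_assoc]

/-- Induction on the support: subtracting the term at `j` leaves a rational vector, as the
coefficient is itself coded. -/
lemma le_sumNorm (hN : IsNormFunction 𝕜 N) (v : VectorCode) : N v ≤ sumNorm N (toFinsupp 𝕜 v) := by
  suffices H : ∀ (t : Finset ℕ) (v : VectorCode), (toFinsupp 𝕜 v).support ⊆ t →
      N v ≤ ∑ j ∈ t, ‖toFinsupp 𝕜 v j‖ * N (unitCode 𝕜 j) from H _ v subset_rfl
  intro t
  induction t using Finset.induction_on with
  | empty =>
    intro v hv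
    have : toFinsupp 𝕜 v = 0 := by simpa using hv
    refine (hN.congr (v := []) (by rw [this, toFinsupp_nil])).trans ?_
    simp [hN.apply_nil]
  | insert j t hj ih =>
    intro v hv
    set c := v.getD j ScalarCode.zero with hc
    let w := lin (imSq 𝕜) ScalarCode.one v (ScalarCode.mul (imSq 𝕜) ScalarCode.negOne c)
      (unitCode 𝕜 j)
    have hw : toFinsupp 𝕜 w = toFinsupp 𝕜 v - Finsupp.single j (c.val 𝕜) := by
      simp only [w, toFinsupp_lin, ScalarCode.val_one, ScalarCode.val_mul, ScalarCode.val_negOne,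
        toFinsupp_unitCode]
      rw [one_smul, Finsupp.smul_single, smul_eq_mul, mul_one, neg_one_mul, Finsupp.single_neg,
        sub_eq_add_neg]
    have hwj : ∀ i, toFinsupp 𝕜 w i = if i = j then 0 else toFinsupp 𝕜 v i := by
      intro i
      rw [hw, Finsupp.sub_apply, Finsupp.single_apply]
      split_ifs with h1 h2 h2
      · rw [h2, toFinsupp_apply, hc, sub_self]
      · exact absurd h1.symm h2
      · exact absurd h2.symm h1
      · rw [sub_zero]
    have hwt : (toFinsupp 𝕜 w).support ⊆ t := by
      intro i hi
      rw [Finsupp.mem_support_iff, hwj] at hi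
      split_ifs at hi with h
      · exact absurd rfl hi
      · exact (Finset.mem_insert.1 (hv (Finsupp.mem_support_iff.2 hi))).resolve_left h
    have h1 := hN.le_norm_mul (x := v) (a := ScalarCode.one) (v := w) (b := c) (w := unitCode 𝕜 j)
      (by rw [hw, ScalarCode.val_one, one_smul, toFinsupp_unitCode, Finsupp.smul_single,
        smul_eq_mul, mul_one, sub_add_cancel])
    rw [ScalarCode.val_one, norm_one, one_mul] at h1
    rw [Finset.sum_insert hj, add_comm]
    refine h1.trans (add_le_add ((ih w hwt).trans_eq (Finset.sum_congr rfl fun i hi => ?_)) le_rfl)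
    rw [hwj, if_neg (by rintro rfl; exact hj hi)]

/-- The extension of a norm function to all finitely supported sequences. -/
def extend (N : VectorCode → ℝ) (x : ℕ →₀ 𝕜) : ℝ :=
  ⨅ v : VectorCode, N v + sumNorm N (x - toFinsupp 𝕜 v)

lemma extend_le (hN : IsNormFunction 𝕜 N) (x : ℕ →₀ 𝕜) (v : VectorCode) :
    extend N x ≤ N v + sumNorm N (x - toFinsupp 𝕜 v) :=
  ciInf_le ⟨0, by rintro _ ⟨v, rfl⟩; exact add_nonneg (hN.nonneg _) (hN.sumNorm_nonneg _)⟩ v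

/-- The infimum cannot fall below `N v`: the difference of `v` and a competitor `w` is again
rational, so `N v ≤ N w + N (v - w)`, and the last term is at most its `sumNorm`. -/
lemma extend_toFinsupp (hN : IsNormFunction 𝕜 N) (v : VectorCode) :
    extend N (toFinsupp 𝕜 v) = N v := by
  refine le_antisymm ((hN.extend_le _ v).trans_eq (by simp [sumNorm])) (le_ciInf fun w => ?_)
  let d := lin (imSq 𝕜) ScalarCode.one v ScalarCode.negOne w
  have hd : toFinsupp 𝕜 d = toFinsupp 𝕜 v - toFinsupp 𝕜 w := by
    simp [d, toFinsupp_lin, ScalarCode.val_one, ScalarCode.val_negOne, sub_eq_add_neg]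
  have h := hN.le_norm_mul (x := v) (a := ScalarCode.one) (v := w) (b := ScalarCode.one) (w := d)
    (by simp [ScalarCode.val_one, hd])
  have h2 := hN.le_sumNorm d
  rw [hd] at h2
  simp only [ScalarCode.val_one, norm_one, one_mul] at h
  linarith

lemma extend_le_sumNorm (hN : IsNormFunction 𝕜 N) (x : ℕ →₀ 𝕜) : extend N x ≤ sumNorm N x := by
  have := hN.extend_le x []
  rwa [hN.apply_nil, toFinsupp_nil, sub_zero, zero_add] at this

lemma extend_add (hN : IsNormFunction 𝕜 N) (x y : ℕ →₀ 𝕜) :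
    extend N (x + y) ≤ extend N x + extend N y := by
  refine le_ciInf_add_ciInf fun v w => ?_
  let z := lin (imSq 𝕜) ScalarCode.one v ScalarCode.one w
  have hz : toFinsupp 𝕜 z = toFinsupp 𝕜 v + toFinsupp 𝕜 w := by
    simp [z, toFinsupp_lin, ScalarCode.val_one]
  have h := hN.le_norm_mul (x := z) (a := ScalarCode.one) (v := v) (b := ScalarCode.one) (w := w)
    (by simp [ScalarCode.val_one, hz])
  simp only [ScalarCode.val_one, norm_one, one_mul] at h
  have h1 := hN.extend_le (x + y) z
  have h2 := hN.sumNorm_add (x - toFinsupp 𝕜 v) (y - toFinsupp 𝕜 w)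
  rw [sub_add_sub_comm, ← hz] at h2
  linarith

/-- The scalar `c` is replaced by a rational `a`. Since `c • x - a • v = c • (x - v) + (c - a) • v`,
the error is `‖c - a‖` times a quantity fixed by `v`. An inequality is enough to define a seminorm.
-/
lemma extend_smul (hN : IsNormFunction 𝕜 N) (c : 𝕜) (x : ℕ →₀ 𝕜) :
    extend N (c • x) ≤ ‖c‖ * extend N x := by
  have e0 : ‖c‖ * extend N x = ⨅ v, ‖c‖ * (N v + sumNorm N (x - toFinsupp 𝕜 v)) :=
    Real.mul_iInf_of_nonneg (norm_nonneg _) _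
  rw [e0]
  refine le_ciInf fun v => le_of_forall_pos_le_add fun ε hε => ?_
  have hv := hN.nonneg v
  have hv' := hN.sumNorm_nonneg (toFinsupp 𝕜 v)
  have hη : 0 < ε / (N v + sumNorm N (toFinsupp 𝕜 v) + 1) := by positivity
  obtain ⟨a, ha⟩ := ScalarCode.exists_norm_sub_val_lt c hη
  let w := lin (imSq 𝕜) a v ScalarCode.zero []
  have hw : toFinsupp 𝕜 w = a.val 𝕜 • toFinsupp 𝕜 v := by
    simp [w, toFinsupp_lin, ScalarCode.val_zero]
  have h := hN.le_norm_mul (x := w) (a := a) (v := v) (b := ScalarCode.zero) (w := [])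
    (by simp [ScalarCode.val_zero, hw])
  rw [hN.apply_nil, mul_zero, add_zero] at h
  have h1 := hN.extend_le (c • x) w
  have h2 := hN.sumNorm_add (c • (x - toFinsupp 𝕜 v)) ((c - a.val 𝕜) • toFinsupp 𝕜 v)
  rw [sumNorm_smul, sumNorm_smul] at h2
  have e : c • (x - toFinsupp 𝕜 v) + (c - a.val 𝕜) • toFinsupp 𝕜 v = c • x - toFinsupp 𝕜 w := by
    rw [hw, smul_sub, sub_smul]; abel
  rw [e] at h2
  have h3 : ‖a.val 𝕜‖ ≤ ‖c‖ + ‖c - a.val 𝕜‖ := by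
    have := norm_sub_le c (c - a.val 𝕜)
    rwa [sub_sub_cancel] at this
  have e2 : ε / (N v + sumNorm N (toFinsupp 𝕜 v) + 1) *
    (N v + sumNorm N (toFinsupp 𝕜 v) + 1) = ε := by field_simp
  change extend N (c • x) ≤ ‖c‖ * (N v + sumNorm N (x - toFinsupp 𝕜 v)) + ε
  nlinarith [mul_le_mul_of_nonneg_right h3 hv, mul_le_mul_of_nonneg_right ha.le hv,
    mul_le_mul_of_nonneg_right ha.le hv']

/-- The seminorm of a norm function. -/
def seminorm (hN : IsNormFunction 𝕜 N) : Seminorm 𝕜 (ℕ →₀ 𝕜) :=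
  Seminorm.ofSMulLE (extend N)
    (by rw [← toFinsupp_nil, hN.extend_toFinsupp, hN.apply_nil]) hN.extend_add hN.extend_smul

lemma seminorm_toFinsupp (hN : IsNormFunction 𝕜 N) (v : VectorCode) :
    hN.seminorm (toFinsupp 𝕜 v) = N v := hN.extend_toFinsupp v

/-- The rational vectors are dense for the seminorm. -/
lemma exists_seminorm_sub_lt (hN : IsNormFunction 𝕜 N) (x : ℕ →₀ 𝕜) {ε : ℝ} (hε : 0 < ε) :
    ∃ v, hN.seminorm (x - toFinsupp 𝕜 v) < ε := by
  induction x using Finsupp.induction_linear generalizing ε with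
  | zero => exact ⟨[], by simpa [toFinsupp_nil] using hε⟩
  | add x y hx hy =>
    obtain ⟨v, hv⟩ := hx (half_pos hε)
    obtain ⟨w, hw⟩ := hy (half_pos hε)
    refine ⟨lin (imSq 𝕜) ScalarCode.one v ScalarCode.one w, ?_⟩
    rw [toFinsupp_lin, ScalarCode.val_one, one_smul, one_smul, add_sub_add_comm]
    exact (map_add_le_add _ _ _).trans_lt (by linarith)
  | single j c =>
    have hj := hN.nonneg (unitCode 𝕜 j)
    obtain ⟨a, ha⟩ := ScalarCode.exists_norm_sub_val_lt c
      (show 0 < ε / (N (unitCode 𝕜 j) + 1) by positivity)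
    obtain ⟨v, hv⟩ := exists_toFinsupp_single (𝕜 := 𝕜) j a
    refine ⟨v, (hN.extend_le_sumNorm _).trans_lt ?_⟩
    rw [hv, ← Finsupp.single_sub, sumNorm, Finsupp.sum_single_index (by simp)]
    calc ‖c - a.val 𝕜‖ * N (unitCode 𝕜 j) ≤ ‖c - a.val 𝕜‖ * (N (unitCode 𝕜 j) + 1) := by
          gcongr; linarith
      _ < ε / (N (unitCode 𝕜 j) + 1) * (N (unitCode 𝕜 j) + 1) := by gcongr
      _ = ε := by field_simp

end IsNormFunction

/-- A seminorm on the finitely supported sequences, for which they are locally `L^p`, comes from a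
presentation of an `L^p` space. -/
theorem exists_presentation_of_seminorm {p : ℝ} [Fact (1 ≤ ENNReal.ofReal p)]
    (s : Seminorm 𝕜 (ℕ →₀ 𝕜))
    (hs : ∀ (V : Finset (ℕ →₀ 𝕜)) (k : ℕ), ∃ (m : ℕ) (u : Fin m → (ℕ →₀ 𝕜)),
      (∀ a : Fin m → 𝕜, |s (∑ j, a j • u j) - (∑ i, ‖a i‖ ^ p) ^ (1 / p)|
        ≤ 2⁻¹ ^ (k * (m + 1)) * (∑ i, ‖a i‖ ^ p) ^ (1 / p)) ∧
      ∀ v ∈ V, ∃ a : Fin m → 𝕜, s (v - ∑ j, a j • u j) ≤ 2⁻¹ ^ k) :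
    ∃ (Ω : Type) (_ : MeasurableSpace Ω) (μ : Measure Ω)
      (S : Presentation 𝕜 (Lp 𝕜 (ENNReal.ofReal p) μ)),
      ∀ x, ‖Finsupp.linearCombination 𝕜 S.point x‖ = s x := by
  -- The sequences themselves carry the seminorm; no quotient is formed. The embedding `J` simply
  -- sends vectors of seminorm `0` to `0`.
  let i1 : SeminormedAddCommGroup (ℕ →₀ 𝕜) := s.toAddGroupSeminorm.toSeminormedAddCommGroup
  let i2 : NormedSpace 𝕜 (ℕ →₀ 𝕜) :=
    { norm_smul_le := fun c x => (map_smul_eq_mul s c x).le }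
  have hn : ∀ x : ℕ →₀ 𝕜, ‖x‖ = s x := fun _ => rfl
  have hX : LocallyLp 𝕜 p (ℕ →₀ 𝕜) := by
    intro V k
    obtain ⟨m, u, h1, h2⟩ := hs V k
    refine ⟨m, u, fun a => h1 (fun i => a i), fun v hv => ?_⟩
    obtain ⟨a, ha⟩ := h2 v hv
    exact ⟨WithLp.toLp _ a, ha⟩
  obtain ⟨Ω, mΩ, μ, J, hJ⟩ := hX.exists_denseRange Finsupp.basisSingleOne
  have hlin : ∀ x, Finsupp.linearCombination 𝕜 (fun j => J (Finsupp.single j 1)) x = J x := by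
    intro x
    change _ = J.toLinearMap x
    congr 1
    ext j
    simp
  refine ⟨Ω, mΩ, μ, ⟨fun j => J (Finsupp.single j 1), ?_⟩, fun x => ?_⟩
  · rw [← Submodule.dense_iff_topologicalClosure_eq_top]
    refine hJ.mono ?_
    rintro _ ⟨x, rfl⟩
    rw [← hlin x, SetLike.mem_coe, ← Finsupp.range_linearCombination]
    exact ⟨x, rfl⟩
  · rw [hlin, J.norm_map, hn]

end

end LpIndex

end

noncomputable section

namespace LpIndex

/-! ### Computable approximations of powers with a computable exponent -/

lemma exists_computable_search {α : Type*} [Primcodable α] {g : α → ℕ → Bool}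
    (hg : Computable fun z : α × ℕ => g z.1 z.2) (h : ∀ x, ∃ n, g x n = true) :
    ∃ f : α → ℕ, Computable f ∧ ∀ x, g x (f x) = true := by
  classical
  have h1 : ComputablePred fun z : α × ℕ => g z.1 z.2 = true := Computable.computablePred (by simpa)
  exact ⟨_, Computable.find (P := fun x n => g x n = true) h1 h, fun x => Nat.find_spec (h x)⟩

@[fun_prop]
lemma computable_unpair {α : Type*} [Primcodable α] {f : α → ℕ} (hf : Computable f) :
    Computable fun x => (f x).unpair := Primrec.unpair.to_comp.comp hf

/-- Raising to the power `2 * n` removes the root and the fractional exponent, so that comparing `2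
^ h * x ^ (m / n)` with an integer becomes a comparison of natural numbers when `x ^ 2` is rational.
-/
lemma pow_mul_pow_eq {x : ℝ} (hx : 0 ≤ x) {S T m n h : ℕ} (hn : n ≠ 0)
    (hST : x ^ 2 * T = S) :
    ((2 : ℝ) ^ h * x ^ ((m : ℝ) / n)) ^ (2 * n) * (T : ℝ) ^ m = (S : ℝ) ^ m * 2 ^ (2 * h * n) := by
  have hn' : (n : ℝ) ≠ 0 := Nat.cast_ne_zero.2 hn
  have e : (x ^ ((m : ℝ) / n)) ^ (2 * n) = (x ^ 2) ^ m := by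
    rw [← Real.rpow_natCast, ← Real.rpow_mul hx, ← pow_mul, ← Real.rpow_natCast x]
    congr 1
    push_cast
    field_simp
  rw [mul_pow, e, ← hST, mul_pow, ← pow_mul 2 h]
  ring

lemma pow_mul_pow_le_iff {x : ℝ} (hx : 0 ≤ x) {S T m n h A : ℕ} (hn : n ≠ 0) (hT : T ≠ 0)
    (hST : x ^ 2 * T = S) :
    A ^ (2 * n) * T ^ m ≤ S ^ m * 2 ^ (2 * h * n) ↔ (A : ℝ) ≤ 2 ^ h * x ^ ((m : ℝ) / n) := by
  have hT' : (0 : ℝ) < (T : ℝ) ^ m := by positivity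
  rw [← Nat.cast_le (α := ℝ)]
  push_cast
  rw [← pow_mul_pow_eq hx hn hST, mul_le_mul_iff_left₀ hT',
    pow_le_pow_iff_left₀ (by positivity) (by positivity) (by positivity)]

lemma le_pow_mul_pow_iff {x : ℝ} (hx : 0 ≤ x) {S T m n h A : ℕ} (hn : n ≠ 0) (hT : T ≠ 0)
    (hST : x ^ 2 * T = S) :
    S ^ m * 2 ^ (2 * h * n) ≤ A ^ (2 * n) * T ^ m ↔ 2 ^ h * x ^ ((m : ℝ) / n) ≤ (A : ℝ) := by
  have hT' : (0 : ℝ) < (T : ℝ) ^ m := by positivity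
  rw [← Nat.cast_le (α := ℝ)]
  push_cast
  rw [← pow_mul_pow_eq hx hn hST, mul_le_mul_iff_left₀ hT',
    pow_le_pow_iff_left₀ (by positivity) (by positivity) (by positivity)]

/-- The test that `2 ^ h * x ^ (m / n)` is between `B - 1` and `B + 1`, where `x ^ 2 = S / T`. -/
def powTest (S T m n h B : ℕ) : Bool :=
  decide ((B - 1) ^ (2 * n) * T ^ m ≤ S ^ m * 2 ^ (2 * h * n)) &&
    decide (S ^ m * 2 ^ (2 * h * n) ≤ (B + 1) ^ (2 * n) * T ^ m)

lemma powTest_iff {x : ℝ} (hx : 0 ≤ x) {S T m n h B : ℕ} (hn : n ≠ 0) (hT : T ≠ 0)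
    (hST : x ^ 2 * T = S) :
    powTest S T m n h B = true ↔ |2 ^ h * x ^ ((m : ℝ) / n) - B| ≤ 1 := by
  rw [powTest, Bool.and_eq_true, decide_eq_true_iff, decide_eq_true_iff,
    pow_mul_pow_le_iff hx hn hT hST, le_pow_mul_pow_iff hx hn hT hST, abs_le]
  have h0 : (0 : ℝ) ≤ 2 ^ h * x ^ ((m : ℝ) / n) := by positivity
  -- For `B = 0` the truncated `B - 1` is `0`, and the lower test holds, as does the lower bound
  -- `-1`.
  rcases B with _ | B
  · push_cast
    constructor <;> rintro ⟨h1, h2⟩ <;> constructor <;> linarith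
  · rw [Nat.add_sub_cancel]
    push_cast
    constructor <;> rintro ⟨h1, h2⟩ <;> constructor <;> linarith

/-- The test for approximations of `2 ^ h * ‖a‖ ^ p`, given an approximation `q` of `p` with an
error of `2 ^ (-k)`. -/
def rpowTest (δ : ℕ) (q : RatCode) (k : ℕ) (a : ScalarCode) (h B : ℕ) : Bool :=
  powTest ((ScalarCode.normSq δ a).1.1 - (ScalarCode.normSq δ a).1.2)
      ((ScalarCode.normSq δ a).2 + 1) (q.1.1 * 2 ^ k - (q.1.2 * 2 ^ k + (q.2 + 1)))
      ((q.2 + 1) * 2 ^ k) h B &&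
    powTest ((ScalarCode.normSq δ a).1.1 - (ScalarCode.normSq δ a).1.2)
      ((ScalarCode.normSq δ a).2 + 1) (q.1.1 * 2 ^ k + (q.2 + 1) - q.1.2 * 2 ^ k)
      ((q.2 + 1) * 2 ^ k) h B

section

variable {α : Type*} [Primcodable α]

@[fun_prop]
lemma computable_powTest {S T m n h B : α → ℕ} (hS : Computable S) (hT : Computable T)
    (hm : Computable m) (hn : Computable n) (hh : Computable h) (hB : Computable B) :
    Computable fun x => powTest (S x) (T x) (m x) (n x) (h x) (B x) := by
  unfold powTest; fun_prop

@[fun_prop]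
lemma computable_rpowTest (δ : ℕ) {q : α → RatCode} {a : α → ScalarCode} {k h B : α → ℕ}
    (hq : Computable q) (hk : Computable k) (ha : Computable a) (hh : Computable h)
    (hB : Computable B) : Computable fun x => rpowTest δ (q x) (k x) (a x) (h x) (B x) := by
  unfold rpowTest; fun_prop

end

/-- `x ^ t` increases in `t` for `1 ≤ x` and decreases for `0 < x ≤ 1`. The unordered interval
avoids deciding between the cases, and a test at two rational exponents around `p` controls the
power at `p`. -/
lemma rpow_mem_uIcc {x p t₁ t₂ : ℝ} (hx : 0 ≤ x) (hp : 0 < p) (h1 : t₁ ≤ p) (h2 : p ≤ t₂) :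
    x ^ p ∈ Set.uIcc (x ^ t₁) (x ^ t₂) := by
  rw [Set.mem_uIcc]
  rcases hx.eq_or_lt with rfl | hx0
  · right
    rw [Real.zero_rpow hp.ne', Real.zero_rpow (by linarith)]
    exact ⟨le_rfl, by positivity⟩
  · rcases le_total 1 x with h | h
    · left
      exact ⟨Real.rpow_le_rpow_of_exponent_le h h1, Real.rpow_le_rpow_of_exponent_le h h2⟩
    · right
      exact ⟨Real.rpow_le_rpow_of_exponent_ge hx0 h h2, Real.rpow_le_rpow_of_exponent_ge hx0 h h1⟩

lemma abs_sub_le_of_mem_uIcc {x y z c r : ℝ} (hy : y ∈ Set.uIcc x z) (hx : |x - c| ≤ r)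
    (hz : |z - c| ≤ r) : |y - c| ≤ r := by
  rw [abs_le] at *
  rcases Set.mem_uIcc.1 hy with h | h <;> constructor <;> linarith [h.1, h.2, hx.1, hx.2, hz.1, hz.2]

section

variable (𝕜 : Type*) [RCLike 𝕜] {p : ℝ}

lemma ScalarCode.norm_sq_mul (a : ScalarCode) :
    ‖a.val 𝕜‖ ^ 2 * ((normSq (imSq 𝕜) a).2 + 1 : ℕ) =
      ((normSq (imSq 𝕜) a).1.1 - (normSq (imSq 𝕜) a).1.2 : ℕ) := by
  have h := val_normSq (𝕜 := 𝕜) a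
  set r := normSq (imSq 𝕜) a
  have hpos : (0 : ℝ) < (r.2 : ℝ) + 1 := by positivity
  have h2 : ‖a.val 𝕜‖ ^ 2 * ((r.2 : ℝ) + 1) = r.1.1 - r.1.2 := by
    rw [← h, RatCode.val]; push_cast; field_simp
  have h3 : r.1.2 ≤ r.1.1 := by
    have : (0 : ℝ) ≤ r.1.1 - r.1.2 := by rw [← h2]; positivity
    exact_mod_cast sub_nonneg.1 this
  rw [Nat.cast_sub h3, ← h2]
  push_cast
  rfl

/-- The lower exponent of the test, as a real. -/
lemma lower_exponent {q : RatCode} {k : ℕ} (hp : 0 ≤ p) (hq : |(q.val : ℝ) - p| < ((2 : ℝ) ^ k)⁻¹) :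
    let t := (((q.1.1 * 2 ^ k - (q.1.2 * 2 ^ k + (q.2 + 1)) : ℕ) : ℝ)) / ((q.2 + 1) * 2 ^ k : ℕ)
    t ≤ p ∧ p ≤ t + 2 * ((2 : ℝ) ^ k)⁻¹ := by
  intro t
  have hpos : (0 : ℝ) < ((q.2 : ℝ) + 1) * 2 ^ k := by positivity
  rw [abs_lt] at hq
  have e : (((q.1.1 * 2 ^ k : ℕ) : ℝ) - (q.1.2 * 2 ^ k + (q.2 + 1) : ℕ)) / ((q.2 + 1) * 2 ^ k : ℕ) =
      q.val - ((2 : ℝ) ^ k)⁻¹ := by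
    rw [RatCode.val]; push_cast; field_simp; ring
  rcases le_total (q.1.2 * 2 ^ k + (q.2 + 1)) (q.1.1 * 2 ^ k) with h | h
  · have : t = q.val - ((2 : ℝ) ^ k)⁻¹ := by simp only [t]; rw [Nat.cast_sub h, e]
    constructor <;> linarith
  -- Truncation replaces a nonpositive exponent by `0`, which still lies below `p`.
  · have ht : t = 0 := by simp only [t]; rw [Nat.sub_eq_zero_of_le h]; simp
    have : (q.val : ℝ) - ((2 : ℝ) ^ k)⁻¹ ≤ 0 := by
      rw [← e]
      refine div_nonpos_of_nonpos_of_nonneg (sub_nonpos.2 (by exact_mod_cast h)) (by positivity)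
    constructor <;> linarith

lemma upper_exponent {q : RatCode} {k : ℕ} (hp : 0 ≤ p) (hq : |(q.val : ℝ) - p| < ((2 : ℝ) ^ k)⁻¹) :
    let t := (((q.1.1 * 2 ^ k + (q.2 + 1) - q.1.2 * 2 ^ k : ℕ) : ℝ)) / ((q.2 + 1) * 2 ^ k : ℕ)
    p ≤ t ∧ t ≤ p + 2 * ((2 : ℝ) ^ k)⁻¹ := by
  intro t
  have hpos : (0 : ℝ) < ((q.2 : ℝ) + 1) * 2 ^ k := by positivity
  rw [abs_lt] at hq
  have e : (((q.1.1 * 2 ^ k + (q.2 + 1) : ℕ) : ℝ) - (q.1.2 * 2 ^ k : ℕ)) / ((q.2 + 1) * 2 ^ k : ℕ) =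
      q.val + ((2 : ℝ) ^ k)⁻¹ := by
    rw [RatCode.val]; push_cast; field_simp; ring
  have h : q.1.2 * 2 ^ k ≤ q.1.1 * 2 ^ k + (q.2 + 1) := by
    have : (0 : ℝ) ≤ (((q.1.1 * 2 ^ k + (q.2 + 1) : ℕ) : ℝ) - (q.1.2 * 2 ^ k : ℕ)) /
        ((q.2 + 1) * 2 ^ k : ℕ) := by rw [e]; linarith
    rw [div_nonneg_iff] at this
    rcases this with h | h
    · exact_mod_cast sub_nonneg.1 h.1
    · have := h.2; push_cast at this; linarith
  have : t = q.val + ((2 : ℝ) ^ k)⁻¹ := by simp only [t]; rw [Nat.cast_sub h, e]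
  constructor <;> linarith

/-- Dyadic approximations of the `p`-th powers of the norms of rational scalars. -/
theorem exists_computable_rpow (hp : 0 < p) (hc : IsComputableReal p) :
    ∃ P : ScalarCode × ℕ → ℕ, Computable P ∧
      ∀ a h, |2 ^ h * ‖a.val 𝕜‖ ^ p - (P (a, h) : ℝ)| ≤ 1 := by
  obtain ⟨q, hqc, hq⟩ := hc
  have htest : ∀ (a : ScalarCode) (k h B : ℕ), rpowTest (imSq 𝕜) (q k) k a h B = true ↔
      |2 ^ h * ‖a.val 𝕜‖ ^ ((((q k).1.1 * 2 ^ k - ((q k).1.2 * 2 ^ k + ((q k).2 + 1)) : ℕ) : ℝ) /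
        (((q k).2 + 1) * 2 ^ k : ℕ)) - B| ≤ 1 ∧
      |2 ^ h * ‖a.val 𝕜‖ ^ ((((q k).1.1 * 2 ^ k + ((q k).2 + 1) - (q k).1.2 * 2 ^ k : ℕ) : ℝ) /
        (((q k).2 + 1) * 2 ^ k : ℕ)) - B| ≤ 1 := by
    intro a k h B
    have hne : ((q k).2 + 1) * 2 ^ k ≠ 0 := by positivity
    rw [rpowTest, Bool.and_eq_true, powTest_iff (norm_nonneg _) hne (Nat.succ_ne_zero _)
      (ScalarCode.norm_sq_mul 𝕜 a), powTest_iff (norm_nonneg _) hne (Nat.succ_ne_zero _)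
      (ScalarCode.norm_sq_mul 𝕜 a)]
  have hcomp : Computable fun z : (ScalarCode × ℕ) × ℕ =>
      rpowTest (imSq 𝕜) (q z.2.unpair.1) z.2.unpair.1 z.1.1 z.1.2 z.2.unpair.2 :=
    computable_rpowTest _ (hqc.comp (by fun_prop)) (by fun_prop) (by fun_prop) (by fun_prop) (by fun_prop)
  obtain ⟨f, hf, hf'⟩ := exists_computable_search
    (g := fun (x : ScalarCode × ℕ) n =>
      rpowTest (imSq 𝕜) (q n.unpair.1) n.unpair.1 x.1 x.2 n.unpair.2) hcomp (by
      rintro ⟨a, h⟩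
      set x := ‖a.val 𝕜‖ with hx
      have hx0 : 0 ≤ x := norm_nonneg _
      have hcont : Filter.Tendsto (fun t : ℝ => 2 ^ h * x ^ t) (nhds p) (nhds (2 ^ h * x ^ p)) := by
        rcases eq_or_ne x 0 with h0 | h0
        · rw [h0, Real.zero_rpow hp.ne']
          refine tendsto_const_nhds.congr' ?_
          filter_upwards [lt_mem_nhds hp] with t ht
          rw [Real.zero_rpow ht.ne']
        · exact (Real.continuousAt_const_rpow h0).tendsto.const_mul _
      -- For this `B` the power at `p` lies strictly between `B - 1` and `B + 1`. By continuity in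
      -- the exponent, both rational exponents pass the test once `k` is large, so the search over
      -- pairs `(k, B)` ends.
      set B := ⌊2 ^ h * x ^ p⌋₊
      have hB1 : (B : ℝ) ≤ 2 ^ h * x ^ p := Nat.floor_le (by positivity)
      have hB2 : 2 ^ h * x ^ p < B + 1 := Nat.lt_floor_add_one _
      obtain ⟨η, hη, hball⟩ := Metric.eventually_nhds_iff.1
        ((hcont.eventually (lt_mem_nhds (show (B : ℝ) - 1 < _ by linarith))).and
          (hcont.eventually (gt_mem_nhds hB2)))
      obtain ⟨k, hk⟩ := exists_pow_lt_of_lt_one (show 0 < η / 2 by positivity)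
        (show (2⁻¹ : ℝ) < 1 by norm_num)
      rw [inv_pow] at hk
      have good : ∀ t : ℝ, |t - p| ≤ 2 * ((2 : ℝ) ^ k)⁻¹ → |2 ^ h * x ^ t - B| ≤ 1 := by
        intro t ht
        have := hball (y := t) (by rw [Real.dist_eq]; linarith)
        rw [abs_le]; constructor <;> linarith [this.1, this.2]
      have hk0 : (0 : ℝ) < ((2 : ℝ) ^ k)⁻¹ := by positivity
      refine ⟨Nat.pair k B, ?_⟩
      rw [Nat.unpair_pair, htest]
      have hl := lower_exponent hp.le (hq k)
      have hu := upper_exponent hp.le (hq k)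
      exact ⟨good _ (by rw [abs_le]; constructor <;> linarith [hl.1, hl.2]),
        good _ (by rw [abs_le]; constructor <;> linarith [hu.1, hu.2])⟩)
  refine ⟨fun x => (f x).unpair.2, by fun_prop, fun a h => ?_⟩
  have := (htest _ _ _ _).1 (hf' (a, h))
  have hmem := rpow_mem_uIcc (norm_nonneg (a.val 𝕜)) hp
    (lower_exponent hp.le (hq (f (a, h)).unpair.1)).1
    (upper_exponent hp.le (hq (f (a, h)).unpair.1)).1
  refine abs_sub_le_of_mem_uIcc ?_ this.1 this.2
  have h2 : (0 : ℝ) < 2 ^ h := by positivity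
  rw [Set.mem_uIcc] at hmem ⊢
  simpa only [mul_le_mul_iff_right₀ h2] using hmem

end

end LpIndex

end

noncomputable section

namespace LpIndex

/-! ### Computable approximations of `p`-norms. -/

section

variable (𝕜 : Type*) [RCLike 𝕜] {p : ℝ}

/-- The code of `n / 2 ^ h`. -/
def RatCode.dyadicFrac (n h : ℕ) : RatCode := RatCode.frac n (2 ^ h - 1)

lemma RatCode.val_dyadicFrac (n h : ℕ) : (RatCode.dyadicFrac n h).val = n / 2 ^ h := by
  rw [dyadicFrac, val_frac]
  congr 1
  have : 1 ≤ 2 ^ h := Nat.one_le_two_pow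
  rw [Nat.cast_sub this]; simp

@[fun_prop]
lemma computable_dyadicFrac {α : Type*} [Primcodable α] {f g : α → ℕ} (hf : Computable f)
    (hg : Computable g) : Computable fun x => RatCode.dyadicFrac (f x) (g x) := by
  unfold RatCode.dyadicFrac; fun_prop

lemma norm_val_ofRat_dyadicFrac (n h : ℕ) :
    ‖(ScalarCode.ofRat (RatCode.dyadicFrac n h)).val 𝕜‖ = n / 2 ^ h := by
  have hr : ∀ x : ℚ, ((x : ℚ) : 𝕜) = ((x : ℝ) : 𝕜) := fun x => by simp
  rw [ScalarCode.val_ofRat, hr, RCLike.norm_ofReal, RatCode.val_dyadicFrac]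
  push_cast
  exact abs_of_nonneg (by positivity)

/-- The `p`-norm of a sequence of rational scalars. -/
def lpNorm (p : ℝ) (a : List ScalarCode) : ℝ :=
  (∑ j ∈ Finset.range a.length, ‖(a.getD j ScalarCode.zero).val 𝕜‖ ^ p) ^ (1 / p)

/-- The test for approximations of `p`-norms, given approximations `P` of `p`-th powers. -/
def lpNormTest (P : ScalarCode × ℕ → ℕ) (a : List ScalarCode) (h k B : ℕ) : Bool :=
  decide ((∑ j ∈ Finset.range a.length, P (a.getD j ScalarCode.zero, k)) + (a.length + 1) ≤
      P (ScalarCode.ofRat (RatCode.dyadicFrac (B + 1) h), k)) &&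
    (decide (B ≤ 0) || decide (P (ScalarCode.ofRat (RatCode.dyadicFrac (B - 1) h), k) +
      (a.length + 1) ≤ ∑ j ∈ Finset.range a.length, P (a.getD j ScalarCode.zero, k)))

lemma computable_lpNormTest {P : ScalarCode × ℕ → ℕ} (hP : Computable P) :
    Computable fun z : (List ScalarCode × ℕ) × ℕ =>
      lpNormTest P z.1.1 z.1.2 z.2.unpair.1 z.2.unpair.2 := by
  have h1 : Computable fun z : (List ScalarCode × ℕ) × ℕ => ∑ j ∈ Finset.range z.1.1.length,
      P (z.1.1.getD j ScalarCode.zero, z.2.unpair.1) :=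
    computable_sum_range (by fun_prop) (hP.comp (by fun_prop))
  have h2 : Computable fun z : (List ScalarCode × ℕ) × ℕ =>
      P (ScalarCode.ofRat (RatCode.dyadicFrac (z.2.unpair.2 + 1) z.1.2), z.2.unpair.1) :=
    hP.comp (by fun_prop)
  have h3 : Computable fun z : (List ScalarCode × ℕ) × ℕ =>
      P (ScalarCode.ofRat (RatCode.dyadicFrac (z.2.unpair.2 - 1) z.1.2), z.2.unpair.1) :=
    hP.comp (by fun_prop)
  unfold lpNormTest
  exact computable_and (computable_decide_le (computable_add h1 (by fun_prop)) h2)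
    (computable_or (computable_decide_le (by fun_prop) (by fun_prop)) (computable_decide_le (computable_add h3 (by fun_prop)) h1))

lemma abs_sum_sub_le {P : ScalarCode × ℕ → ℕ}
    (hP : ∀ a h, |2 ^ h * ‖a.val 𝕜‖ ^ p - (P (a, h) : ℝ)| ≤ 1) (a : List ScalarCode) (k : ℕ) :
    |2 ^ k * (∑ j ∈ Finset.range a.length, ‖(a.getD j ScalarCode.zero).val 𝕜‖ ^ p) -
      (∑ j ∈ Finset.range a.length, P (a.getD j ScalarCode.zero, k) : ℕ)| ≤ a.length := by
  push_cast
  rw [Finset.mul_sum, ← Finset.sum_sub_distrib]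
  refine (Finset.abs_sum_le_sum_abs _ _).trans ((Finset.sum_le_sum fun j _ => hP _ k).trans ?_)
  simp

/-- Dyadic approximations of the `p`-norm of sequences of rational scalars. -/
theorem exists_computable_lpNorm (hp : 0 < p) (hc : IsComputableReal p) :
    ∃ L : List ScalarCode × ℕ → ℕ, Computable L ∧
      ∀ a h, |lpNorm 𝕜 p a - (L (a, h) : ℝ) / 2 ^ h| ≤ (2 ^ h)⁻¹ := by
  obtain ⟨P, hPc, hP⟩ := exists_computable_rpow 𝕜 hp hc
  have hP' : ∀ n h k : ℕ, |2 ^ k * ((n : ℝ) / 2 ^ h) ^ p -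
      (P (ScalarCode.ofRat (RatCode.dyadicFrac n h), k) : ℝ)| ≤ 1 := fun n h k => by
    have := hP (ScalarCode.ofRat (RatCode.dyadicFrac n h)) k
    rwa [norm_val_ofRat_dyadicFrac] at this
  have hroot : ∀ {y : ℝ}, 0 ≤ y → (y ^ (1 / p)) ^ p = y := fun {y} hy => by
    rw [← Real.rpow_mul hy, one_div_mul_cancel hp.ne', Real.rpow_one]
  obtain ⟨f, hf, hf'⟩ := exists_computable_search
    (g := fun (x : List ScalarCode × ℕ) n => lpNormTest P x.1 x.2 n.unpair.1 n.unpair.2)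
    (computable_lpNormTest hPc) (by
      rintro ⟨a, h⟩
      have hsum := abs_sum_sub_le 𝕜 hP a
      set Y := ∑ j ∈ Finset.range a.length, ‖(a.getD j ScalarCode.zero).val 𝕜‖ ^ p
      have hY : 0 ≤ Y := Finset.sum_nonneg fun _ _ => by positivity
      set z := Y ^ (1 / p)
      have hz : 0 ≤ z := by positivity
      have hzY : z ^ p = Y := hroot hY
      set B := ⌊2 ^ h * z⌋₊
      have hB1 : (B : ℝ) ≤ 2 ^ h * z := Nat.floor_le (by positivity)
      have hB2 : 2 ^ h * z < B + 1 := Nat.lt_floor_add_one _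
      have h2 : (0 : ℝ) < 2 ^ h := by positivity
      -- The floor makes both comparisons of `p`-th powers strict (the lower one if `0 < B`). Scaled
      -- by a large `2 ^ k`, the gaps exceed `2 * (a.length + 1)`: the errors of the `a.length + 1`
      -- approximations of powers, and as much again for the margin demanded by the test.
      have g1 : 0 < (((B + 1 : ℕ) : ℝ) / 2 ^ h) ^ p - Y := by
        rw [sub_pos, ← hzY]
        refine Real.rpow_lt_rpow hz ?_ hp
        rw [lt_div_iff₀ h2]; push_cast; linarith
      have g2 : 0 < B → 0 < Y - (((B - 1 : ℕ) : ℝ) / 2 ^ h) ^ p := by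
        intro hB
        rw [sub_pos, ← hzY]
        refine Real.rpow_lt_rpow (by positivity) ?_ hp
        rw [div_lt_iff₀ h2, Nat.cast_sub hB]; push_cast; linarith
      have large : ∀ {c : ℝ}, 0 < c → ∀ᶠ k : ℕ in Filter.atTop,
          2 * (a.length : ℝ) + 2 ≤ 2 ^ k * c := fun {c} hc' =>
        ((tendsto_pow_atTop_atTop_of_one_lt one_lt_two).atTop_mul_const hc').eventually_ge_atTop _
      have hk : ∃ k : ℕ, 2 * (a.length : ℝ) + 2 ≤ 2 ^ k * ((((B + 1 : ℕ) : ℝ) / 2 ^ h) ^ p - Y) ∧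
          (0 < B → 2 * (a.length : ℝ) + 2 ≤ 2 ^ k * (Y - (((B - 1 : ℕ) : ℝ) / 2 ^ h) ^ p)) := by
        rcases Nat.eq_zero_or_pos B with hB | hB
        · obtain ⟨k, hk⟩ := (large g1).exists
          exact ⟨k, hk, fun h => absurd hB h.ne'⟩
        · obtain ⟨k, hk⟩ := ((large g1).and (large (g2 hB))).exists
          exact ⟨k, hk.1, fun _ => hk.2⟩
      obtain ⟨k, hk1, hk2⟩ := hk
      have hs := abs_le.1 (hsum k)
      refine ⟨Nat.pair k B, ?_⟩
      rw [Nat.unpair_pair, lpNormTest, Bool.and_eq_true, Bool.or_eq_true, decide_eq_true_iff,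
        decide_eq_true_iff, decide_eq_true_iff]
      constructor
      · have h3 := abs_le.1 (hP' (B + 1) h k)
        rw [← Nat.cast_le (α := ℝ)]
        push_cast at hs h3 hk1 ⊢
        linarith [hs.1, h3.2]
      · rcases Nat.eq_zero_or_pos B with hB | hB
        · exact Or.inl hB.le
        · right
          have h3 := abs_le.1 (hP' (B - 1) h k)
          have hk2 := hk2 hB
          rw [← Nat.cast_le (α := ℝ)]
          push_cast at hs ⊢
          linarith [hs.2, h3.1])
  refine ⟨fun x => (f x).unpair.2, by fun_prop, fun a h => ?_⟩
  have hf'' := hf' (a, h)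
  set k := (f (a, h)).unpair.1
  set B := (f (a, h)).unpair.2
  change |_ - (B : ℝ) / 2 ^ h| ≤ _
  rw [lpNormTest, Bool.and_eq_true, Bool.or_eq_true, decide_eq_true_iff,
        decide_eq_true_iff, decide_eq_true_iff] at hf''
  obtain ⟨t1, t2⟩ := hf''
  simp only at t1 t2
  have hs := abs_le.1 (abs_sum_sub_le 𝕜 hP a k)
  rw [lpNorm]
  set Y := ∑ j ∈ Finset.range a.length, ‖(a.getD j ScalarCode.zero).val 𝕜‖ ^ p
  have hY : 0 ≤ Y := Finset.sum_nonneg fun _ _ => by positivity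
  have h2 : (0 : ℝ) < 2 ^ h := by positivity
  have h2k : (0 : ℝ) < 2 ^ k := by positivity
  have upper : Y ^ (1 / p) ≤ ((B + 1 : ℕ) : ℝ) / 2 ^ h := by
    rw [← Real.rpow_le_rpow_iff (by positivity) (by positivity) hp, hroot hY]
    have h3 := abs_le.1 (hP' (B + 1) h k)
    rw [← Nat.cast_le (α := ℝ)] at t1
    push_cast at hs h3 t1 ⊢
    refine le_of_mul_le_mul_left ?_ h2k
    linarith [hs.2, h3.1]
  have lower : (B : ℝ) / 2 ^ h ≤ Y ^ (1 / p) + (2 ^ h)⁻¹ := by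
    rcases t2 with hB | t2
    · rw [Nat.le_zero.1 hB]; simp; positivity
    · have : ((B - 1 : ℕ) : ℝ) / 2 ^ h ≤ Y ^ (1 / p) := by
        rw [← Real.rpow_le_rpow_iff (by positivity) (by positivity) hp, hroot hY]
        have h3 := abs_le.1 (hP' (B - 1) h k)
        rw [← Nat.cast_le (α := ℝ)] at t2
        push_cast at hs t2
        refine le_of_mul_le_mul_left ?_ h2k
        linarith [hs.1, h3.2]
      have hB : (B : ℝ) ≤ (B - 1 : ℕ) + 1 := by exact_mod_cast (by omega : B ≤ B - 1 + 1)
      calc (B : ℝ) / 2 ^ h ≤ ((B - 1 : ℕ) + 1) / 2 ^ h := by gcongr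
        _ = ((B - 1 : ℕ) : ℝ) / 2 ^ h + (2 ^ h)⁻¹ := by rw [add_div, one_div]
        _ ≤ _ := by gcongr
  have e : ((B + 1 : ℕ) : ℝ) / 2 ^ h = B / 2 ^ h + (2 ^ h)⁻¹ := by push_cast; rw [add_div, one_div]
  rw [abs_le]
  constructor <;> linarith

end

end LpIndex

end

noncomputable section

namespace LpIndex

/-! ### Properties of sets of codes defined by rules -/

section

variable {α δ τ : Type*} [Primcodable α] [Primcodable δ] [Primcodable τ]

/-- A property of sets `D` which says that every parameter `x` and every finite list of elements
of `D` has a witness `t` which computes a list of elements of `D`. -/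
def IsRule (Q : Set δ → Prop) : Prop :=
  ∃ ρ : (ℕ × List δ) × ℕ → Option (List δ), Computable ρ ∧
    ∀ D, Q D ↔ ∀ (x : ℕ) (L : List δ), (∀ d ∈ L, d ∈ D) →
      ∃ t qs, ρ ((x, L), t) = some qs ∧ ∀ d ∈ qs, d ∈ D

/-- Parameters and witnesses of other types are coded by numbers. A number that codes no parameter
must impose nothing, so it gets the empty list; one that codes no witness must not help, so it gets
`none`. -/
lemma isRule_of {Q : Set δ → Prop} (ρ : (α × List δ) × τ → Option (List δ)) (hρ : Computable ρ)
    (h : ∀ D, Q D ↔ ∀ (x : α) (L : List δ), (∀ d ∈ L, d ∈ D) →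
      ∃ t qs, ρ ((x, L), t) = some qs ∧ ∀ d ∈ qs, d ∈ D) : IsRule Q := by
  refine ⟨fun z => (Encodable.decode z.1.1 : Option α).elim (some []) fun x =>
    (Encodable.decode z.2 : Option τ).elim none fun t => ρ ((x, z.1.2), t),
    computable_option_elim (by fun_prop) (by fun_prop)
      (computable_option_elim (by fun_prop) (by fun_prop) (hρ.comp (by fun_prop))), fun D => ?_⟩
  rw [h]
  constructor
  · intro H x L hL
    rcases hx : (Encodable.decode x : Option α) with _ | a
    · exact ⟨0, [], by simp [hx], by simp⟩
    · obtain ⟨t, qs, h1, h2⟩ := H a L hL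
      exact ⟨Encodable.encode t, qs, by simp [hx, h1], h2⟩
  · intro H x L hL
    obtain ⟨t, qs, h1, h2⟩ := H (Encodable.encode x) L hL
    simp only [Encodable.encodek, Option.elim_some] at h1
    rcases ht : (Encodable.decode t : Option τ) with _ | t'
    · simp [ht] at h1
    · exact ⟨t', qs, by simpa [ht] using h1, h2⟩

lemma isRule_forall {Q : Set δ → Prop} (g : α × List δ → Bool) (hg : Computable g)
    (h : ∀ D, Q D ↔ ∀ (x : α) (L : List δ), (∀ d ∈ L, d ∈ D) → g (x, L) = true) : IsRule Q := by
  refine isRule_of (α := α) (τ := ℕ) (fun z => bif g z.1 then some [] else none)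
    (computable_cond (hg.comp (by fun_prop)) (by fun_prop) (by fun_prop)) fun D => ?_
  rw [h]
  refine forall_congr' fun x => forall_congr' fun L => imp_congr_right fun _ => ?_
  cases hx : g (x, L) <;> simp [hx]

/-- Even parameters serve the first rule and odd ones the second. -/
lemma IsRule.and {Q R : Set δ → Prop} (hQ : IsRule Q) (hR : IsRule R) :
    IsRule fun D => Q D ∧ R D := by
  obtain ⟨ρ, hρ, h1⟩ := hQ
  obtain ⟨σ, hσ, h2⟩ := hR
  refine ⟨fun z => bif decide (z.1.1 % 2 = 0) then ρ ((z.1.1 / 2, z.1.2), z.2)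
    else σ ((z.1.1 / 2, z.1.2), z.2), computable_cond
      (computable_decide_eq (by fun_prop) (by fun_prop)) (hρ.comp (by fun_prop))
      (hσ.comp (by fun_prop)), fun D => ?_⟩
  beta_reduce
  rw [h1, h2]
  constructor
  · rintro ⟨H1, H2⟩ x L hL
    rcases Nat.mod_two_eq_zero_or_one x with h | h
    · simpa [h] using H1 (x / 2) L hL
    · simpa [h] using H2 (x / 2) L hL
  · refine fun H => ⟨fun x L hL => ?_, fun x L hL => ?_⟩
    · simpa using H (2 * x) L hL
    · have e1 : (2 * x + 1) % 2 = 1 := by omega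
      have e2 : (2 * x + 1) / 2 = x := by omega
      simpa [e1, e2] using H (2 * x + 1) L hL

end

/-! ### The rules for diagrams -/

/-- The pairs of codes of which diagrams consist. -/
abbrev DiagramCode : Type := VectorCode × IntervalCode

/-- Norms are known with arbitrary precision. -/
def HasSmallIntervals (D : Set DiagramCode) : Prop :=
  ∀ (v : VectorCode) (k : ℕ), ∃ I : IntervalCode, (I.2.val : ℝ) ≤ (2 ^ k)⁻¹ ∧ (v, I) ∈ D

/-- The intervals of a vector can be shrunk at both ends. -/
def HasShrinkings (D : Set DiagramCode) : Prop :=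
  ∀ d ∈ D, ∃ J : IntervalCode, d.2.lo.val < J.lo.val ∧ J.hi.val < d.2.hi.val ∧ (d.1, J) ∈ D

/-- The intervals of a vector can be enlarged. -/
def HasEnlargements (D : Set DiagramCode) : Prop :=
  ∀ (I : IntervalCode), ∀ d ∈ D, I.lo.val ≤ d.2.lo.val → d.2.hi.val ≤ I.hi.val → (d.1, I) ∈ D

/-- The intervals are consistent with the seminorm inequalities. -/
def IsSubadditive (𝕜 : Type*) [RCLike 𝕜] (D : Set DiagramCode) : Prop :=
  ∀ (a b : ScalarCode) (α β : RatCode), 0 ≤ α.val → 0 ≤ β.val → ‖a.val 𝕜‖ ≤ α.val →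
    ‖b.val 𝕜‖ ≤ β.val → ∀ d₁ ∈ D, ∀ d₂ ∈ D, ∀ d₃ ∈ D,
      VectorCode.toFinsupp 𝕜 d₁.1 = a.val 𝕜 • VectorCode.toFinsupp 𝕜 d₂.1 +
        b.val 𝕜 • VectorCode.toFinsupp 𝕜 d₃.1 →
      d₁.2.lo.val < α.val * d₂.2.hi.val + β.val * d₃.2.hi.val

lemma isRule_hasSmallIntervals : IsRule HasSmallIntervals := by
  refine isRule_of (α := VectorCode × ℕ) (τ := IntervalCode)
    (fun z => bif RatCode.le z.2.radius (RatCode.dyadicFrac 1 z.1.1.2) then some [(z.1.1.1, z.2)]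
      else none) (by unfold IntervalCode.radius; fun_prop) fun D => ?_
  have e : ∀ (I : IntervalCode) (k : ℕ), RatCode.le I.radius (RatCode.dyadicFrac 1 k) = true ↔
      (I.2.val : ℝ) ≤ (2 ^ k)⁻¹ := fun I k => by
    rw [RatCode.le_iff, IntervalCode.val_radius, RatCode.val_dyadicFrac, ← Rat.cast_le (K := ℝ)]
    simp
  constructor
  · intro H x L _
    obtain ⟨I, h1, h2⟩ := H x.1 x.2
    exact ⟨I, _, by rw [(e I x.2).2 h1]; rfl, by simpa using h2⟩
  · intro H v k
    obtain ⟨I, qs, h1, h2⟩ := H (v, k) [] (by simp)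
    simp only at h1
    cases h : RatCode.le I.radius (RatCode.dyadicFrac 1 k)
    · simp [h] at h1
    · rw [h, cond_true, Option.some_inj] at h1
      exact ⟨I, (e I k).1 h, h2 _ (by simp [← h1])⟩

/-- The single premise is the head of the list; an empty list demands nothing. -/
lemma isRule_hasShrinkings : IsRule HasShrinkings := by
  refine isRule_of (α := ℕ) (τ := IntervalCode)
    (fun z => (z.1.2[0]?).elim (some []) fun d =>
      bif RatCode.lt d.2.lo z.2.lo && RatCode.lt z.2.hi d.2.hi then some [(d.1, z.2)] else none)
    (by fun_prop) fun D => ?_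
  constructor
  · rintro H x (_ | ⟨d, L⟩) hL
    · exact ⟨((0, 0), 0, 0), [], by simp, by simp⟩
    · obtain ⟨J, h1, h2, h3⟩ := H d (hL d (by simp))
      refine ⟨J, [(d.1, J)], ?_, by simpa using h3⟩
      simp [(RatCode.lt_iff _ _).2 h1, (RatCode.lt_iff _ _).2 h2]
  · intro H d hd
    obtain ⟨J, qs, h1, h2⟩ := H 0 [d] (by simpa using hd)
    simp only [List.length_singleton, zero_lt_one, getElem?_pos, List.getElem_cons_zero,
      Option.elim_some] at h1
    cases h : RatCode.lt d.2.lo J.lo && RatCode.lt J.hi d.2.hi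
    · simp [h] at h1
    · rw [h, cond_true, Option.some_inj] at h1
      rw [Bool.and_eq_true, RatCode.lt_iff, RatCode.lt_iff] at h
      exact ⟨J, h.1, h.2, h2 _ (by simp [← h1])⟩

lemma isRule_hasEnlargements : IsRule HasEnlargements := by
  refine isRule_of (α := IntervalCode) (τ := ℕ)
    (fun z => (z.1.2[0]?).elim (some []) fun d =>
      bif RatCode.le z.1.1.lo d.2.lo && RatCode.le d.2.hi z.1.1.hi then some [(d.1, z.1.1)]
        else some [])
    (by fun_prop) fun D => ?_
  constructor
  · rintro H I (_ | ⟨d, L⟩) hL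
    · exact ⟨0, [], by simp, by simp⟩
    · cases h : RatCode.le I.lo d.2.lo && RatCode.le d.2.hi I.hi
      · exact ⟨0, [], by simp [h], by simp⟩
      · refine ⟨0, [(d.1, I)], by simp [h], ?_⟩
        rw [Bool.and_eq_true, RatCode.le_iff, RatCode.le_iff] at h
        simpa using H I d (hL d (by simp)) h.1 h.2
  · intro H I d hd h1 h2
    obtain ⟨t, qs, h3, h4⟩ := H I [d] (by simpa using hd)
    simp only [List.length_singleton, zero_lt_one, getElem?_pos, List.getElem_cons_zero,
      Option.elim_some, (RatCode.le_iff _ _).2 h1, (RatCode.le_iff _ _).2 h2, Bool.and_true,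
      cond_true, Option.some_inj] at h3
    exact h4 _ (by simp [← h3])

lemma normSq_le_iff {𝕜 : Type*} [RCLike 𝕜] {a : ScalarCode} {α : RatCode} (h : 0 ≤ α.val) :
    RatCode.le (ScalarCode.normSq (imSq 𝕜) a) (RatCode.mul α α) = true ↔ ‖a.val 𝕜‖ ≤ α.val := by
  rw [RatCode.le_iff, RatCode.val_mul, ← Rat.cast_le (K := ℝ), ScalarCode.val_normSq, Rat.cast_mul,
    ← sq, sq_le_sq₀ (norm_nonneg _) (by exact_mod_cast h)]

/-- The decision procedure for one instance of the seminorm inequalities. -/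
def subadditiveTest (δ : ℕ) (x : (ScalarCode × ScalarCode) × RatCode × RatCode)
    (d₁ d₂ d₃ : DiagramCode) : Bool :=
  !((RatCode.le (RatCode.frac 0 0) x.2.1 && RatCode.le (RatCode.frac 0 0) x.2.2) &&
    (RatCode.le (ScalarCode.normSq δ x.1.1) (RatCode.mul x.2.1 x.2.1) &&
      RatCode.le (ScalarCode.normSq δ x.1.2) (RatCode.mul x.2.2 x.2.2)) &&
    VectorCode.isZero δ (VectorCode.lin δ ScalarCode.one d₁.1 ScalarCode.negOne
      (VectorCode.lin δ x.1.1 d₂.1 x.1.2 d₃.1))) ||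
  RatCode.lt d₁.2.lo (RatCode.add (RatCode.mul x.2.1 d₂.2.hi) (RatCode.mul x.2.2 d₃.2.hi))

@[fun_prop]
lemma computable_not {α : Type*} [Primcodable α] {f : α → Bool} (hf : Computable f) :
    Computable fun x => !f x := Primrec.not.to_comp.comp hf

@[fun_prop]
lemma computable_subadditiveTest {α : Type*} [Primcodable α] (δ : ℕ)
    {x : α → (ScalarCode × ScalarCode) × RatCode × RatCode} {d₁ d₂ d₃ : α → DiagramCode}
    (hx : Computable x) (h₁ : Computable d₁) (h₂ : Computable d₂) (h₃ : Computable d₃) :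
    Computable fun z => subadditiveTest δ (x z) (d₁ z) (d₂ z) (d₃ z) := by
  unfold subadditiveTest; fun_prop

lemma subadditiveTest_iff {𝕜 : Type*} [RCLike 𝕜] (a b : ScalarCode) (α β : RatCode)
    (d₁ d₂ d₃ : DiagramCode) : subadditiveTest (imSq 𝕜) ((a, b), α, β) d₁ d₂ d₃ = true ↔
      (0 ≤ α.val → 0 ≤ β.val → ‖a.val 𝕜‖ ≤ α.val → ‖b.val 𝕜‖ ≤ β.val →
        VectorCode.toFinsupp 𝕜 d₁.1 = a.val 𝕜 • VectorCode.toFinsupp 𝕜 d₂.1 +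
          b.val 𝕜 • VectorCode.toFinsupp 𝕜 d₃.1 →
        d₁.2.lo.val < α.val * d₂.2.hi.val + β.val * d₃.2.hi.val) := by
  have e0 : ∀ q : RatCode, RatCode.le (RatCode.frac 0 0) q = true ↔ 0 ≤ q.val := fun q => by
    rw [RatCode.le_iff, RatCode.val_frac]; simp
  rw [subadditiveTest, Bool.or_eq_true, Bool.not_eq_true', ← Bool.not_eq_true]
  simp only [Bool.and_eq_true, e0, VectorCode.isZero_iff, RatCode.lt_iff, RatCode.val_add,
    RatCode.val_mul, VectorCode.toFinsupp_lin, ScalarCode.val_one, ScalarCode.val_negOne, one_smul,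
    neg_one_smul, ← sub_eq_add_neg, sub_eq_zero]
  by_cases h1 : 0 ≤ α.val
  · by_cases h2 : 0 ≤ β.val
    · simp only [normSq_le_iff h1, normSq_le_iff h2]
      tauto
    · simp [h2]
  · simp [h1]

lemma isRule_isSubadditive (𝕜 : Type*) [RCLike 𝕜] : IsRule (IsSubadditive 𝕜) := by
  refine isRule_forall (α := (ScalarCode × ScalarCode) × RatCode × RatCode)
    (fun z => (z.2[0]?).elim true fun d₁ => (z.2[1]?).elim true fun d₂ => (z.2[2]?).elim true
      fun d₃ => subadditiveTest (imSq 𝕜) z.1 d₁ d₂ d₃) (by fun_prop) fun D => ?_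
  constructor
  · rintro H ⟨⟨a, b⟩, α, β⟩ L hL
    rcases L with _ | ⟨d₁, _ | ⟨d₂, _ | ⟨d₃, L⟩⟩⟩
    · simp
    · simp
    · simp
    · exact (subadditiveTest_iff a b α β d₁ d₂ d₃).2 fun h1 h2 h3 h4 h5 =>
        H a b α β h1 h2 h3 h4 d₁ (hL _ (by simp)) d₂ (hL _ (by simp)) d₃ (hL _ (by simp)) h5
  · intro H a b α β h1 h2 h3 h4 d₁ hd₁ d₂ hd₂ d₃ hd₃ h5
    have := H ((a, b), α, β) [d₁, d₂, d₃] (by simp [hd₁, hd₂, hd₃])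
    exact (subadditiveTest_iff a b α β d₁ d₂ d₃).1 this h1 h2 h3 h4 h5

end LpIndex

end

noncomputable section

namespace LpIndex

/-! ### The rule for the local structure of `L^p` spaces -/

/-- The points of a grid of mesh `2 ^ (-h)` in the unit square. -/
def gridScalar (h d : ℕ) : ScalarCode :=
  (((d / (2 * 2 ^ h + 1), 2 ^ h), 2 ^ h - 1), ((d % (2 * 2 ^ h + 1), 2 ^ h), 2 ^ h - 1))

/-- The number of points of a grid. -/
def gridSize (h : ℕ) : ℕ := (2 * 2 ^ h + 1) * (2 * 2 ^ h + 1)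

/-- The points of a grid in the `m`-th power of the unit square. -/
def gridVector (h m i : ℕ) : List ScalarCode :=
  (List.range m).map fun j => gridScalar h (i / gridSize h ^ j % gridSize h)

lemma length_gridVector (h m i : ℕ) : (gridVector h m i).length = m := by simp [gridVector]

section

variable {𝕜 : Type*} [RCLike 𝕜]

lemma exists_grid_coordinate {x : ℝ} (hx : |x| ≤ 1) (h : ℕ) :
    ∃ e < 2 * 2 ^ h + 1, |x - (RatCode.val ((e, 2 ^ h), 2 ^ h - 1) : ℝ)| ≤ (2 ^ h)⁻¹ := by
  have h2 : (0 : ℝ) < 2 ^ h := by positivity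
  rw [abs_le] at hx
  have h0 : 0 ≤ (x + 1) * 2 ^ h := mul_nonneg (by linarith) h2.le
  refine ⟨⌊(x + 1) * 2 ^ h⌋₊, ?_, ?_⟩
  · rw [Nat.lt_succ_iff]
    refine Nat.floor_le_of_le ?_
    push_cast
    nlinarith
  · have e1 := Nat.floor_le h0
    have e2 := Nat.lt_floor_add_one ((x + 1) * 2 ^ h)
    set e := ⌊(x + 1) * 2 ^ h⌋₊
    have e3 : (RatCode.val ((e, 2 ^ h), 2 ^ h - 1) : ℝ) = (e - 2 ^ h) / 2 ^ h := by
      rw [RatCode.val]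
      have : 1 ≤ 2 ^ h := Nat.one_le_two_pow
      push_cast [Nat.cast_sub this]
      simp
    have e4 : x - (e - 2 ^ h) / 2 ^ h = ((x + 1) * 2 ^ h - e) * (2 ^ h)⁻¹ := by field_simp; ring
    rw [e3, e4, abs_of_nonneg (mul_nonneg (by linarith) (by positivity))]
    exact mul_le_of_le_one_left (by positivity) (by linarith)

lemma exists_gridScalar_near {z : 𝕜} (hz : ‖z‖ ≤ 1) (h : ℕ) :
    ∃ d < gridSize h, ‖z - (gridScalar h d).val 𝕜‖ ≤ 2 * (2 ^ h)⁻¹ := by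
  obtain ⟨e, he, hx⟩ := exists_grid_coordinate ((RCLike.abs_re_le_norm z).trans hz) h
  obtain ⟨f, hf, hy⟩ := exists_grid_coordinate ((RCLike.abs_im_le_norm z).trans hz) h
  have hpos : 0 < 2 * 2 ^ h + 1 := by positivity
  refine ⟨f + e * (2 * 2 ^ h + 1), ?_, ?_⟩
  · rw [gridSize]
    calc f + e * (2 * 2 ^ h + 1) < (2 * 2 ^ h + 1) + e * (2 * 2 ^ h + 1) := by omega
      _ = (e + 1) * (2 * 2 ^ h + 1) := by ring
      _ ≤ _ := Nat.mul_le_mul_right _ he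
  · have e1 : (f + e * (2 * 2 ^ h + 1)) / (2 * 2 ^ h + 1) = e := by
      rw [Nat.add_mul_div_right _ _ hpos, Nat.div_eq_of_lt hf, zero_add]
    have e2 : (f + e * (2 * 2 ^ h + 1)) % (2 * 2 ^ h + 1) = f := by
      rw [Nat.add_mul_mod_self_right, Nat.mod_eq_of_lt hf]
    rw [gridScalar, e1, e2, ScalarCode.val]
    set q : RatCode := ((e, 2 ^ h), 2 ^ h - 1)
    set r : RatCode := ((f, 2 ^ h), 2 ^ h - 1)
    have hr : ∀ x : ℚ, ((x : ℚ) : 𝕜) = ((x : ℝ) : 𝕜) := fun x => by simp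
    have e : z - (((q.val : ℚ) : 𝕜) + ((r.val : ℚ) : 𝕜) * RCLike.I) =
        ((RCLike.re z - q.val : ℝ) : 𝕜) + ((RCLike.im z - r.val : ℝ) : 𝕜) * RCLike.I := by
      conv_lhs => rw [← RCLike.re_add_im z]
      rw [hr, hr]
      push_cast
      ring
    rw [e]
    refine (norm_add_le _ _).trans ?_
    rw [norm_mul, RCLike.norm_ofReal, RCLike.norm_ofReal]
    have hI : ‖(RCLike.I : 𝕜)‖ ≤ 1 := by
      rcases eq_or_ne (RCLike.I : 𝕜) 0 with h | h
      · rw [h, norm_zero]; exact zero_le_one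
      · exact (RCLike.norm_I_of_ne_zero h).le
    have := mul_le_mul hy hI (norm_nonneg _) (by positivity)
    linarith

lemma exists_gridVector_near {m : ℕ} {z : Fin m → 𝕜} (hz : ∀ j, ‖z j‖ ≤ 1) (h : ℕ) :
    ∃ i < gridSize h ^ m, ∀ j : Fin m,
      ‖z j - ((gridVector h m i).getD j ScalarCode.zero).val 𝕜‖ ≤ 2 * (2 ^ h)⁻¹ := by
  choose d hd hd' using fun j => exists_gridScalar_near (hz j) h
  let i := finFunctionFinEquiv fun j => (⟨d j, hd j⟩ : Fin (gridSize h))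
  refine ⟨i, i.2, fun j => ?_⟩
  -- The grid points of the cube are numbered by their digits in base `gridSize h`.
  have e : (i : ℕ) / gridSize h ^ (j : ℕ) % gridSize h = d j := by
    have := congrFun (finFunctionFinEquiv.symm_apply_apply
      fun j => (⟨d j, hd j⟩ : Fin (gridSize h))) j
    exact congrArg Fin.val this
  rw [gridVector, List.getD_eq_getElem _ _ (by simp), List.getElem_map, List.getElem_range, e]
  exact hd' j

end

/-- The queries which verify that vectors `u` span an almost isometric copy of `ℓ^p_m`, where `L`
approximates the norm of `ℓ^p_m`. -/
def isometryQueries (δ : ℕ) (L : List ScalarCode × ℕ → ℕ) (h : ℕ) (u : List VectorCode) :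
    List DiagramCode :=
  (List.range (gridSize h ^ u.length)).map fun i =>
    (VectorCode.comb δ (gridVector h u.length i) u u.length,
      IntervalCode.dyadic
        (RatCode.dyadicFrac (L (gridVector h u.length i, h + 1)) (h + 1)) h)

/-- The queries which verify that vectors `V` are near to combinations of vectors `u`. -/
def distanceQueries (δ : ℕ) (V : List VectorCode) (k : ℕ) (u : List VectorCode)
    (C : List (List ScalarCode)) : List DiagramCode :=
  (List.range V.length).map fun i =>
    (VectorCode.lin δ ScalarCode.one (V.getD i []) ScalarCode.negOne
      (VectorCode.comb δ (C.getD i []) u u.length), IntervalCode.dyadic (RatCode.frac 0 0) k)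

/-- The rational vectors are locally `L^p`, up to arbitrary precision. -/
def HasLocalLpBases (𝕜 : Type*) [RCLike 𝕜] (L : List ScalarCode × ℕ → ℕ) (D : Set DiagramCode) :
    Prop :=
  ∀ (V : List VectorCode) (k : ℕ), ∃ (u : List VectorCode) (C : List (List ScalarCode)),
    ∀ d ∈ isometryQueries (imSq 𝕜) L (k * (u.length + 1)) u ++ distanceQueries (imSq 𝕜) V k u C,
      d ∈ D

section

variable {α : Type*} [Primcodable α]

@[fun_prop]
lemma computable_gridScalar {f g : α → ℕ} (hf : Computable f) (hg : Computable g) :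
    Computable fun x => gridScalar (f x) (g x) := by unfold gridScalar; fun_prop

@[fun_prop]
lemma computable_gridSize {f : α → ℕ} (hf : Computable f) :
    Computable fun x => gridSize (f x) := by unfold gridSize; fun_prop

@[fun_prop]
lemma computable_gridVector {f g h : α → ℕ} (hf : Computable f) (hg : Computable g)
    (hh : Computable h) : Computable fun x => gridVector (f x) (g x) (h x) := by
  unfold gridVector; fun_prop

lemma computable_isometryQueries (δ : ℕ) {L : List ScalarCode × ℕ → ℕ} (hL : Computable L)
    {h : α → ℕ} {u : α → List VectorCode} (hh : Computable h) (hu : Computable u) :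
    Computable fun x => isometryQueries δ L (h x) (u x) := by
  unfold isometryQueries
  refine computable_map_range (by fun_prop) (computable_pair (by fun_prop)
    (computable_dyadic (computable_dyadicFrac (hL.comp (by fun_prop)) (by fun_prop))
      (by fun_prop)))

lemma computable_distanceQueries (δ : ℕ) {V u : α → List VectorCode} {k : α → ℕ}
    {C : α → List (List ScalarCode)} (hV : Computable V) (hk : Computable k) (hu : Computable u)
    (hC : Computable C) : Computable fun x => distanceQueries δ (V x) (k x) (u x) (C x) := by
  unfold distanceQueries; fun_prop

end

lemma isRule_hasLocalLpBases (𝕜 : Type*) [RCLike 𝕜] {L : List ScalarCode × ℕ → ℕ}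
    (hL : Computable L) : IsRule (HasLocalLpBases 𝕜 L) := by
  refine isRule_of (α := List VectorCode × ℕ) (τ := List VectorCode × List (List ScalarCode))
    (fun z => some (isometryQueries (imSq 𝕜) L (z.1.1.2 * (z.2.1.length + 1)) z.2.1 ++
      distanceQueries (imSq 𝕜) z.1.1.1 z.1.1.2 z.2.1 z.2.2))
    (computable_some (computable_append
      (computable_isometryQueries _ hL (by fun_prop) (by fun_prop))
      (computable_distanceQueries _ (by fun_prop) (by fun_prop) (by fun_prop) (by fun_prop))))
    fun D => ?_
  constructor
  · intro H x _ _
    obtain ⟨u, C, h⟩ := H x.1 x.2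
    exact ⟨(u, C), _, rfl, h⟩
  · intro H V k
    obtain ⟨⟨u, C⟩, qs, h1, h2⟩ := H (V, k) [] (by simp)
    rw [Option.some_inj] at h1
    exact ⟨u, C, by rw [h1]; exact h2⟩

end LpIndex

end

noncomputable section

namespace LpIndex

/-! ### Diagrams of presentations of `L^p` spaces satisfy the rules -/

lemma IntervalCode.exists_mem_of_lt {l x r : ℝ} (hl : l < x) (hr : x < r) :
    ∃ J : IntervalCode, x ∈ J.toSet ∧ l < J.lo.val ∧ (J.hi.val : ℝ) < r := by
  obtain ⟨k, hk⟩ := exists_pow_lt_of_lt_one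
    (show 0 < min (x - l) (r - x) / 2 by have := sub_pos.2 hl; have := sub_pos.2 hr; positivity)
    (show (2⁻¹ : ℝ) < 1 by norm_num)
  rw [inv_pow] at hk
  have hk0 : (0 : ℝ) < (2 ^ k)⁻¹ := by positivity
  obtain ⟨c, h1, h2⟩ := exists_rat_btwn (show x - (2 ^ k)⁻¹ < x by linarith)
  obtain ⟨q, rfl⟩ := RatCode.exists_val_eq c
  have m1 := min_le_left (x - l) (r - x)
  have m2 := min_le_right (x - l) (r - x)
  refine ⟨IntervalCode.dyadic q k, ?_, ?_, ?_⟩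
  · rw [IntervalCode.mem_dyadic, abs_lt]; constructor <;> linarith
  · rw [IntervalCode.val_lo, IntervalCode.val_dyadic_radius]
    push_cast
    change l < (q.val : ℝ) - _
    linarith
  · rw [IntervalCode.val_hi, IntervalCode.val_dyadic_radius]
    push_cast
    change (q.val : ℝ) + _ < r
    linarith

section

variable {𝕜 : Type*} [RCLike 𝕜] {B : Type*} [NormedAddCommGroup B] [NormedSpace 𝕜 B]

namespace Presentation

variable (S : Presentation 𝕜 B)

lemma mem_diagram {d : DiagramCode} :
    d ∈ S.diagram ↔ (d.2.lo.val : ℝ) < ‖S.vec d.1‖ ∧ ‖S.vec d.1‖ < d.2.hi.val :=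
  IntervalCode.mem_toSet

lemma vec_lin (a : ScalarCode) (v : VectorCode) (b : ScalarCode) (w : VectorCode) :
    S.vec (VectorCode.lin (imSq 𝕜) a v b w) = a.val 𝕜 • S.vec v + b.val 𝕜 • S.vec w := by
  simp only [vec_eq, VectorCode.toFinsupp_lin, map_add, map_smul]

lemma vec_comb (c : List ScalarCode) (u : List VectorCode) (n : ℕ) :
    S.vec (VectorCode.comb (imSq 𝕜) c u n) =
      ∑ i : Fin n, (c.getD i ScalarCode.zero).val 𝕜 • S.vec (u.getD i []) := by
  simp only [vec_eq, VectorCode.toFinsupp_comb, map_sum, map_smul, Finset.sum_range]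

lemma exists_vec_near (x : B) {ε : ℝ} (hε : 0 < ε) : ∃ v, ‖x - S.vec v‖ < ε := by
  have key : ∀ (y : ℕ →₀ 𝕜) {ε : ℝ}, 0 < ε →
      ∃ v, ‖Finsupp.linearCombination 𝕜 S.point y - S.vec v‖ < ε := by
    intro y
    induction y using Finsupp.induction_linear with
    | zero =>
      intro ε hε
      exact ⟨[], by simpa [vec_eq, IsNormFunction.toFinsupp_nil] using hε⟩
    | add x y hx hy =>
      intro ε hε
      obtain ⟨v, hv⟩ := hx (half_pos hε)
      obtain ⟨w, hw⟩ := hy (half_pos hε)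
      refine ⟨VectorCode.lin (imSq 𝕜) ScalarCode.one v ScalarCode.one w, ?_⟩
      rw [vec_lin, ScalarCode.val_one, one_smul, one_smul, map_add, add_sub_add_comm]
      exact (norm_add_le _ _).trans_lt (by linarith)
    | single j c =>
      intro ε hε
      obtain ⟨a, ha⟩ := ScalarCode.exists_norm_sub_val_lt c
        (show 0 < ε / (‖S.point j‖ + 1) by positivity)
      obtain ⟨v, hv⟩ := VectorCode.exists_toFinsupp_single (𝕜 := 𝕜) j a
      refine ⟨v, ?_⟩
      rw [vec_eq, hv, Finsupp.linearCombination_single, Finsupp.linearCombination_single,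
        ← sub_smul, norm_smul]
      calc ‖c - a.val 𝕜‖ * ‖S.point j‖ ≤ ‖c - a.val 𝕜‖ * (‖S.point j‖ + 1) := by gcongr; linarith
        _ < ε / (‖S.point j‖ + 1) * (‖S.point j‖ + 1) := by gcongr
        _ = ε := by field_simp
  have hx : x ∈ closure (Submodule.span 𝕜 (Set.range S.point) : Set B) := by
    rw [← Submodule.topologicalClosure_coe, S.dense]; trivial
  obtain ⟨y, hy, hxy⟩ := Metric.mem_closure_iff.1 hx _ (half_pos hε)
  rw [SetLike.mem_coe, ← Finsupp.range_linearCombination] at hy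
  obtain ⟨z, rfl⟩ := hy
  obtain ⟨v, hv⟩ := key z (half_pos hε)
  refine ⟨v, ?_⟩
  rw [dist_eq_norm] at hxy
  rw [← sub_add_sub_cancel x (Finsupp.linearCombination 𝕜 S.point z) (S.vec v)]
  exact (norm_add_le _ _).trans_lt (by linarith)

lemma hasSmallIntervals_diagram : HasSmallIntervals S.diagram := by
  intro v k
  have hk : (0 : ℝ) < (2 ^ k)⁻¹ := by positivity
  obtain ⟨J, h1, h2, h3⟩ := IntervalCode.exists_mem_of_lt
    (show ‖S.vec v‖ - (2 ^ k)⁻¹ < ‖S.vec v‖ by linarith)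
    (show ‖S.vec v‖ < ‖S.vec v‖ + (2 ^ k)⁻¹ by linarith)
  refine ⟨J, ?_, h1⟩
  rw [IntervalCode.val_lo] at h2
  rw [IntervalCode.val_hi] at h3
  push_cast at h2 h3
  linarith

lemma hasShrinkings_diagram : HasShrinkings S.diagram := by
  intro d hd
  rw [mem_diagram] at hd
  obtain ⟨J, h1, h2, h3⟩ := IntervalCode.exists_mem_of_lt hd.1 hd.2
  exact ⟨J, by exact_mod_cast h2, by exact_mod_cast h3, h1⟩

lemma hasEnlargements_diagram : HasEnlargements S.diagram := by
  intro I d hd h1 h2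
  rw [mem_diagram] at hd ⊢
  have h1' : (I.lo.val : ℝ) ≤ d.2.lo.val := by exact_mod_cast h1
  have h2' : (d.2.hi.val : ℝ) ≤ I.hi.val := by exact_mod_cast h2
  exact ⟨h1'.trans_lt hd.1, hd.2.trans_le h2'⟩

lemma isSubadditive_diagram : IsSubadditive 𝕜 S.diagram := by
  intro a b α β hα hβ ha hb d₁ h₁ d₂ h₂ d₃ h₃ h
  rw [mem_diagram] at h₁ h₂ h₃
  have hα' : (0 : ℝ) ≤ α.val := by exact_mod_cast hα
  have hβ' : (0 : ℝ) ≤ β.val := by exact_mod_cast hβ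
  have e : S.vec d₁.1 = a.val 𝕜 • S.vec d₂.1 + b.val 𝕜 • S.vec d₃.1 := by
    simp only [vec_eq, h, map_add, map_smul]
  have h4 : ‖S.vec d₁.1‖ ≤ ‖a.val 𝕜‖ * ‖S.vec d₂.1‖ + ‖b.val 𝕜‖ * ‖S.vec d₃.1‖ := by
    rw [e, ← norm_smul, ← norm_smul]; exact norm_add_le _ _
  have h5 := mul_le_mul ha h₂.2.le (norm_nonneg _) hα'
  have h6 := mul_le_mul hb h₃.2.le (norm_nonneg _) hβ'
  have : (d₁.2.lo.val : ℝ) < α.val * d₂.2.hi.val + β.val * d₃.2.hi.val := by linarith [h₁.1]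
  exact_mod_cast this

end Presentation

end

lemma lpNorm_eq_norm {𝕜 : Type*} [RCLike 𝕜] {p : ℝ} [Fact (1 ≤ ENNReal.ofReal p)] {m : ℕ}
    {a : List ScalarCode} (ha : a.length = m) :
    lpNorm 𝕜 p a = ‖(WithLp.toLp (ENNReal.ofReal p)
      fun j : Fin m => (a.getD j ScalarCode.zero).val 𝕜 : FinLp 𝕜 p m)‖ := by
  subst ha
  rw [lpNorm, FinLp.norm_eq, Finset.sum_range]

lemma Presentation.hasLocalLpBases_diagram {𝕜 : Type*} [RCLike 𝕜] {p : ℝ}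
    [hp : Fact (1 ≤ ENNReal.ofReal p)] {Ω : Type*} [MeasurableSpace Ω] {μ : Measure Ω}
    (S : Presentation 𝕜 (Lp 𝕜 (ENNReal.ofReal p) μ)) {L : List ScalarCode × ℕ → ℕ}
    (hL : ∀ a h, |lpNorm 𝕜 p a - (L (a, h) : ℝ) / 2 ^ h| ≤ (2 ^ h)⁻¹) :
    HasLocalLpBases 𝕜 L S.diagram := by
  intro V k
  have hk : (0 : ℝ) < (2 ^ k)⁻¹ := by positivity
  obtain ⟨m, g, hg, hV⟩ := exists_isometric_lift_near (fun i : Fin V.length => S.vec (V.getD i []))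
    (show (0 : ℝ) < (2 ^ k)⁻¹ / 4 by positivity)
  choose b hb using hV
  set h := k * (m + 1) with hh
  have hh0 : (0 : ℝ) < (2 ^ (h + 1))⁻¹ := by positivity
  have hc : ∀ (i : Fin V.length) (j : Fin m), ∃ c : ScalarCode,
      ‖b i j - c.val 𝕜‖ < (2 ^ k)⁻¹ / (4 * (m + 1)) := fun i j =>
    ScalarCode.exists_norm_sub_val_lt _ (by positivity)
  choose c hc using hc
  let G : ℕ → FinLp 𝕜 p m := fun i => WithLp.toLp _ fun j : Fin m =>
    ((gridVector h m i).getD j ScalarCode.zero).val 𝕜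
  let C : Fin V.length → FinLp 𝕜 p m := fun i => WithLp.toLp _ fun j : Fin m => (c i j).val 𝕜
  -- Only finitely many coefficient vectors are ever tested, namely the grid and those which
  -- approximate `V`, so their norms have a common bound. It determines how closely rational vectors
  -- must follow the `g j`.
  let M := (∑ i ∈ Finset.range (gridSize h ^ m), ‖G i‖) + ∑ i, ‖C i‖ + 1
  have hM0 : 0 < M := by positivity
  have hM1 : ∀ i < gridSize h ^ m, ‖G i‖ ≤ M := fun i hi => by
    have h1 := Finset.single_le_sum (f := fun i => ‖G i‖) (fun _ _ => norm_nonneg _)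
      (Finset.mem_range.2 hi)
    have h2 : 0 ≤ ∑ i, ‖C i‖ := Finset.sum_nonneg fun _ _ => norm_nonneg _
    simp only [M]
    linarith
  have hM2 : ∀ i, ‖C i‖ ≤ M := fun i => by
    have h1 := Finset.single_le_sum (f := fun i => ‖C i‖) (fun _ _ => norm_nonneg _)
      (Finset.mem_univ i)
    have h2 : 0 ≤ ∑ i ∈ Finset.range (gridSize h ^ m), ‖G i‖ :=
      Finset.sum_nonneg fun _ _ => norm_nonneg _
    simp only [M]
    linarith
  -- The replacement of `g` by rational vectors may use half of the tolerance `2 ^ (-h)` of an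
  -- isometry query, the other half being the error of `L`, and a quarter of the tolerance of a
  -- distance query.
  let η := min (2 ^ (h + 1))⁻¹ ((2 ^ k)⁻¹ / 4) / (2 * (m + 1) * M)
  have hη0 : 0 < η := by positivity
  have hη : m * η * M < min (2 ^ (h + 1))⁻¹ ((2 ^ k)⁻¹ / 4) := by
    have hm : 0 < min (2 ^ (h + 1) : ℝ)⁻¹ ((2 ^ k)⁻¹ / 4) := by positivity
    have e : 2 * (m + 1) * M * η = min (2 ^ (h + 1))⁻¹ ((2 ^ k)⁻¹ / 4) := by
      simp only [η]; field_simp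
    rw [← e]
    have := mul_pos hM0 hη0
    have hm0 : (0 : ℝ) ≤ m := by positivity
    nlinarith
  choose w hw using fun j => S.exists_vec_near (g j) hη0
  have hwg : ∀ a : FinLp 𝕜 p m, ‖a‖ ≤ M →
      ‖FinLp.lift p g a - FinLp.lift p (fun j => S.vec (w j)) a‖ <
        min (2 ^ (h + 1))⁻¹ ((2 ^ k)⁻¹ / 4) := fun a ha =>
    (FinLp.norm_lift_sub_le _ _ (fun j => (hw j).le) a).trans_lt
      ((mul_le_mul_of_nonneg_left ha (by positivity)).trans_lt hη)
  have hlen : (List.ofFn w).length = m := List.length_ofFn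
  have hcomb : ∀ a : List ScalarCode,
      S.vec (VectorCode.comb (imSq 𝕜) a (List.ofFn w) m) =
        FinLp.lift p (fun j => S.vec (w j)) (WithLp.toLp _ fun j : Fin m =>
          (a.getD j ScalarCode.zero).val 𝕜) := by
    intro a
    rw [S.vec_comb, FinLp.lift_apply]
    refine Finset.sum_congr rfl fun j _ => ?_
    congr 2
    rw [List.getD_eq_getElem _ _ (by simp), List.getElem_ofFn]
  refine ⟨List.ofFn w, List.ofFn fun i => List.ofFn (c i), ?_⟩
  rw [hlen, ← hh]
  intro d hd
  rcases List.mem_append.1 hd with hd | hd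
  · rw [isometryQueries, List.mem_map] at hd
    obtain ⟨i, hi, rfl⟩ := hd
    rw [List.mem_range, hlen] at hi
    rw [hlen]
    change _ ∈ IntervalCode.toSet _
    rw [IntervalCode.mem_dyadic, RatCode.val_dyadicFrac, hcomb]
    have h1 := hwg (G i) (hM1 i hi)
    have h2 := (abs_norm_sub_norm_le _ _).trans_lt h1
    rw [hg, abs_lt] at h2
    have h3 := abs_le.1 (hL (gridVector h m i) (h + 1))
    rw [lpNorm_eq_norm (length_gridVector h m i)] at h3
    have h4 := min_le_left (2 ^ (h + 1) : ℝ)⁻¹ ((2 ^ k)⁻¹ / 4)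
    have h5 : (2 ^ h : ℝ)⁻¹ = 2 * (2 ^ (h + 1))⁻¹ := by rw [pow_succ]; field_simp
    rw [h5, abs_lt]
    push_cast
    constructor
    · linarith [h2.2, h3.1]
    · linarith [h2.1, h3.2]
  · rw [distanceQueries, List.mem_map] at hd
    obtain ⟨i, hi, rfl⟩ := hd
    rw [List.mem_range] at hi
    rw [hlen]
    change _ ∈ IntervalCode.toSet _
    rw [IntervalCode.mem_dyadic, RatCode.val_frac, S.vec_lin, ScalarCode.val_one,
      ScalarCode.val_negOne, one_smul, neg_one_smul, ← sub_eq_add_neg, hcomb]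
    have e : (WithLp.toLp (ENNReal.ofReal p) fun j : Fin m => ((List.getD (List.ofFn fun i =>
        List.ofFn (c i)) i []).getD j ScalarCode.zero).val 𝕜 : FinLp 𝕜 p m) = C ⟨i, hi⟩ := by
      have e1 : List.getD (List.ofFn fun i => List.ofFn (c i)) i [] = List.ofFn (c ⟨i, hi⟩) := by
        rw [List.getD_eq_getElem _ _ (by simpa using hi), List.getElem_ofFn]
      rw [e1]
      simp only [C]
      congr 1
      ext j
      rw [List.getD_eq_getElem _ _ (by simp), List.getElem_ofFn]
    rw [e]
    have h1 := hwg (C ⟨i, hi⟩) (hM2 _)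
    have h2 := hb ⟨i, hi⟩
    have h3 : ‖FinLp.lift p g (b ⟨i, hi⟩) - FinLp.lift p g (C ⟨i, hi⟩)‖ ≤ (2 ^ k)⁻¹ / 4 := by
      have hgj : ∀ j, ‖g j‖ = 1 := fun j => by
        rw [← FinLp.lift_unit (𝕜 := 𝕜) (p := p) g j, hg, FinLp.norm_unit]
      rw [← map_sub, FinLp.lift_apply]
      refine (norm_sum_le_of_le (n := fun _ => (2 ^ k)⁻¹ / (4 * (m + 1))) _ fun j _ => ?_).trans ?_
      · rw [norm_smul, hgj, mul_one]
        exact (hc ⟨i, hi⟩ j).le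
      · simp only [Finset.sum_const, Finset.card_univ, Fintype.card_fin, nsmul_eq_mul]
        rw [mul_div_assoc', div_le_div_iff₀ (by positivity) (by positivity)]
        nlinarith
    have h4 := min_le_right (2 ^ (h + 1) : ℝ)⁻¹ ((2 ^ k)⁻¹ / 4)
    have h6 := norm_add₃_le (a := S.vec (V.getD i []) - FinLp.lift p g (b ⟨i, hi⟩))
      (b := FinLp.lift p g (b ⟨i, hi⟩) - FinLp.lift p g (C ⟨i, hi⟩))
      (c := FinLp.lift p g (C ⟨i, hi⟩) - FinLp.lift p (fun j => S.vec (w j)) (C ⟨i, hi⟩))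
    rw [sub_add_sub_cancel, sub_add_sub_cancel] at h6
    simp only [Nat.cast_zero, zero_add, div_one, Rat.cast_zero, sub_zero, abs_norm]
    simp only at h2
    linarith

end LpIndex

end

noncomputable section

namespace LpIndex

/-! ### Sets which satisfy the rules are diagrams -/

lemma FinLp.norm_le_sum {𝕜 : Type*} [RCLike 𝕜] {p : ℝ} [Fact (1 ≤ ENNReal.ofReal p)] {m : ℕ}
    (a : FinLp 𝕜 p m) : ‖a‖ ≤ ∑ j, ‖a j‖ := by
  have e : a = ∑ j, a j • FinLp.unit 𝕜 p j := by
    ext i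
    simp [FinLp.unit_apply]
  conv_lhs => rw [e]
  refine norm_sum_le_of_le _ fun j _ => ?_
  rw [norm_smul, FinLp.norm_unit, mul_one]

lemma Seminorm.map_sum_smul_le {𝕜 X : Type*} [RCLike 𝕜] [AddCommGroup X] [Module 𝕜 X]
    (s : Seminorm 𝕜 X) {m : ℕ} (w : Fin m → X) {b : Fin m → 𝕜} {η : ℝ} (hb : ∀ j, ‖b j‖ ≤ η) :
    s (∑ j, b j • w j) ≤ η * ∑ j, s (w j) := by
  refine (Finset.le_sum_of_subadditive s (map_zero s).le (map_add_le_add s) _ _).trans ?_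
  rw [Finset.mul_sum]
  refine Finset.sum_le_sum fun j _ => ?_
  rw [map_smul_eq_mul]
  exact mul_le_mul_of_nonneg_right (hb j) (apply_nonneg _ _)

/-- A linear map on `ℓ^p_m` is almost isometric if it is so on a fine net of the unit cube. -/
lemma abs_seminorm_sub_norm_le_of_net {𝕜 X : Type*} [RCLike 𝕜] [AddCommGroup X] [Module 𝕜 X]
    {p : ℝ} [Fact (1 ≤ ENNReal.ofReal p)] (s : Seminorm 𝕜 X) {m : ℕ} (w : Fin m → X) {η : ℝ}
    (h0 : 0 ≤ η) (hη : 2 * η * (m + 1) ≤ 1 / 2)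
    (hG : ∀ z : FinLp 𝕜 p m, (∀ j, ‖z j‖ ≤ 1) → ∃ g : FinLp 𝕜 p m, (∀ j, ‖z j - g j‖ ≤ 2 * η) ∧
      |s (∑ j, g j • w j) - ‖g‖| ≤ 2 * η) (a : FinLp 𝕜 p m) :
    |s (∑ j, a j • w j) - ‖a‖| ≤ 8 * (m + 1) * η * ‖a‖ := by
  set T := ∑ j, s (w j) with hT
  have hT0 : 0 ≤ T := Finset.sum_nonneg fun _ _ => apply_nonneg _ _
  have cube : ∀ z : FinLp 𝕜 p m, (∀ j, ‖z j‖ ≤ 1) →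
      |s (∑ j, z j • w j) - ‖z‖| ≤ 2 * η + 2 * η * T + 2 * η * m := by
    intro z hz
    obtain ⟨g, h1, h2⟩ := hG z hz
    have h3 : |s (∑ j, z j • w j) - s (∑ j, g j • w j)| ≤ 2 * η * T := by
      refine (abs_sub_map_le_sub s _ _).trans ?_
      rw [← Finset.sum_sub_distrib]
      simp_rw [← sub_smul]
      exact Seminorm.map_sum_smul_le s w h1
    have h4 : |‖z‖ - ‖g‖| ≤ 2 * η * m := by
      refine (abs_norm_sub_norm_le _ _).trans ((FinLp.norm_le_sum _).trans ?_)
      refine (Finset.sum_le_sum fun j _ => h1 j).trans ?_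
      simp [mul_comm]
    rw [abs_le] at *
    constructor <;> linarith [h2.1, h2.2, h3.1, h3.2, h4.1, h4.2]
  -- The estimate `cube` involves `T` itself. Applied to the unit vectors it bounds `T` by a term in
  -- `m` plus at most `T / 2`, which is absorbed on the left.
  have hTm : T ≤ 3 * m := by
    have h1 : ∀ j, s (w j) ≤ 1 + (2 * η + 2 * η * T + 2 * η * m) := by
      intro j
      have h := cube (FinLp.unit 𝕜 p j) (fun l => by
        rw [FinLp.unit_apply]; split_ifs <;> simp)
      have e : ∑ l, FinLp.unit 𝕜 p j l • w l = w j := by simp [FinLp.unit_apply]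
      rw [e, FinLp.norm_unit, abs_le] at h
      linarith [h.2]
    have h2 : T ≤ m * (1 + (2 * η + 2 * η * T + 2 * η * m)) := by
      refine (Finset.sum_le_sum fun j _ => h1 j).trans_eq ?_
      simp [mul_add]
    have hm : (0 : ℝ) ≤ m := by positivity
    have h3 : m * (2 * η * T) ≤ 1 / 2 * T := by
      have : m * (2 * η) ≤ 1 / 2 := by nlinarith
      calc m * (2 * η * T) = m * (2 * η) * T := by ring
        _ ≤ _ := mul_le_mul_of_nonneg_right this hT0
    have h4 : m * (2 * η + 2 * η * m) ≤ m * (1 / 2) := by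
      refine mul_le_mul_of_nonneg_left ?_ hm
      linarith
    linarith
  rcases eq_or_ne a 0 with rfl | ha
  · simp
  have ha' : 0 < ‖a‖ := norm_pos_iff.2 ha
  have h := cube (((‖a‖⁻¹ : ℝ) : 𝕜) • a) (fun j => by
    rw [PiLp.smul_apply, norm_smul, RCLike.norm_ofReal, abs_of_pos (by positivity),
      inv_mul_le_iff₀ ha', mul_one]
    exact FinLp.norm_apply_le a j)
  have e : ∑ j, (((‖a‖⁻¹ : ℝ) : 𝕜) • a) j • w j = ((‖a‖⁻¹ : ℝ) : 𝕜) • ∑ j, a j • w j := by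
    rw [Finset.smul_sum]
    exact Finset.sum_congr rfl fun j _ => by rw [PiLp.smul_apply, smul_assoc]
  rw [e, map_smul_eq_mul, norm_smul, RCLike.norm_ofReal, abs_of_pos (inv_pos.2 ha'), ← mul_sub,
    abs_mul, abs_of_pos (inv_pos.2 ha'), inv_mul_le_iff₀ ha'] at h
  refine h.trans ?_
  rw [mul_comm]
  refine mul_le_mul_of_nonneg_right ?_ ha'.le
  nlinarith [mul_le_mul_of_nonneg_left hTm h0]

/-- The small intervals of a set of codes determine norms. -/
lemma exists_norm_of_rules {𝕜 : Type*} [RCLike 𝕜] {D : Set DiagramCode}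
    (h1 : HasSmallIntervals D) (h2 : HasShrinkings D) (h3 : HasEnlargements D)
    (h4 : IsSubadditive 𝕜 D) (v : VectorCode) :
    ∃ x : ℝ, ∀ I : IntervalCode, (v, I) ∈ D ↔ x ∈ I.toSet := by
  have hlt : ∀ I J : IntervalCode, (v, I) ∈ D → (v, J) ∈ D → (I.lo.val : ℝ) < J.hi.val := by
    intro I J hI hJ
    -- Subadditivity for the trivial combination `v = 1 • v + 0 • v` makes any two intervals of `v`
    -- overlap.
    have := h4 ScalarCode.one ScalarCode.zero (RatCode.frac 1 0) (RatCode.frac 0 0)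
      (by simp [RatCode.val_frac]) (by simp [RatCode.val_frac])
      (by simp [RatCode.val_frac, ScalarCode.val_one])
      (by simp [RatCode.val_frac, ScalarCode.val_zero]) _ hI _ hJ _ hJ
      (by simp [ScalarCode.val_one, ScalarCode.val_zero])
    simp only [RatCode.val_frac] at this
    norm_num at this
    exact_mod_cast this
  let A : Set ℝ := {y | ∃ I : IntervalCode, (v, I) ∈ D ∧ (I.lo.val : ℝ) = y}
  have hne : A.Nonempty := by
    obtain ⟨I, _, hI⟩ := h1 v 0
    exact ⟨_, I, hI, rfl⟩
  have hle : ∀ J, (v, J) ∈ D → sSup A ≤ (J.hi.val : ℝ) := fun J hJ => csSup_le hne (by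
    rintro _ ⟨I, hI, rfl⟩
    exact (hlt I J hI hJ).le)
  have hge : ∀ J, (v, J) ∈ D → (J.lo.val : ℝ) ≤ sSup A := fun J hJ => le_csSup (by
    refine ⟨(J.hi.val : ℝ), ?_⟩
    rintro _ ⟨I, hI, rfl⟩
    exact (hlt I J hI hJ).le) ⟨J, hJ, rfl⟩
  -- Shrinking turns the weak bounds at the ends into strict ones. Conversely, a small interval
  -- around the supremum fits into `I` and is enlarged to it.
  refine ⟨sSup A, fun I => ⟨fun hI => ?_, fun hI => ?_⟩⟩
  · obtain ⟨J, hJ1, hJ2, hJ⟩ := h2 _ hI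
    rw [IntervalCode.mem_toSet]
    have hJ1' : (I.lo.val : ℝ) < J.lo.val := by exact_mod_cast hJ1
    have hJ2' : (J.hi.val : ℝ) < I.hi.val := by exact_mod_cast hJ2
    exact ⟨hJ1'.trans_le (hge J hJ), (hle J hJ).trans_lt hJ2'⟩
  · rw [IntervalCode.mem_toSet] at hI
    obtain ⟨k, hk⟩ := exists_pow_lt_of_lt_one
      (show 0 < min (sSup A - I.lo.val) (I.hi.val - sSup A) / 2 by
        have := sub_pos.2 hI.1; have := sub_pos.2 hI.2; positivity)
      (show (2⁻¹ : ℝ) < 1 by norm_num)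
    rw [inv_pow] at hk
    obtain ⟨J, hJr, hJ⟩ := h1 v k
    have m1 := min_le_left (sSup A - I.lo.val) (I.hi.val - sSup A)
    have m2 := min_le_right (sSup A - I.lo.val) (I.hi.val - sSup A)
    have e1 := hge J hJ
    have e2 := hle J hJ
    rw [IntervalCode.val_lo] at e1
    rw [IntervalCode.val_hi] at e2
    push_cast at e1 e2
    refine h3 I (v, J) hJ ?_ ?_
    · have : (I.lo.val : ℝ) ≤ J.lo.val := by
        rw [IntervalCode.val_lo J]; push_cast; linarith
      exact_mod_cast this
    · have : (J.hi.val : ℝ) ≤ I.hi.val := by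
        rw [IntervalCode.val_hi J]; push_cast; linarith
      exact_mod_cast this

lemma isNormFunction_of_isSubadditive {𝕜 : Type*} [RCLike 𝕜] {D : Set DiagramCode}
    (h : IsSubadditive 𝕜 D) {N : VectorCode → ℝ} (hN : ∀ v I, (v, I) ∈ D ↔ N v ∈ I.toSet) :
    IsNormFunction 𝕜 N := by
  intro x a v b w α β hx hα hβ ha hb
  obtain ⟨α, rfl⟩ := RatCode.exists_val_eq α
  obtain ⟨β, rfl⟩ := RatCode.exists_val_eq β
  have hα' : (0 : ℝ) ≤ α.val := by exact_mod_cast hα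
  have hβ' : (0 : ℝ) ≤ β.val := by exact_mod_cast hβ
  refine le_of_forall_pos_le_add fun ε hε => ?_
  have hη : 0 < ε / (1 + α.val + β.val) := by positivity
  set η := ε / (1 + α.val + β.val)
  have e : η * (1 + α.val + β.val) = ε := by simp only [η]; field_simp
  obtain ⟨I, hI, hI1, -⟩ := IntervalCode.exists_mem_of_lt (show N x - η < N x by linarith)
    (show N x < N x + η by linarith)
  obtain ⟨J, hJ, -, hJ1⟩ := IntervalCode.exists_mem_of_lt (show N v - η < N v by linarith)
    (show N v < N v + η by linarith)
  obtain ⟨K, hK, -, hK1⟩ := IntervalCode.exists_mem_of_lt (show N w - η < N w by linarith)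
    (show N w < N w + η by linarith)
  have key := h a b α β hα hβ ha hb _ ((hN x I).2 hI) _ ((hN v J).2 hJ) _ ((hN w K).2 hK) hx
  have key' : (I.lo.val : ℝ) < α.val * J.hi.val + β.val * K.hi.val := by exact_mod_cast key
  nlinarith [mul_le_mul_of_nonneg_left hJ1.le hα', mul_le_mul_of_nonneg_left hK1.le hβ']

/-- Passing from the grid to the whole space loses a factor `8 * (m + 1)`. It is compensated by
using the rule with `k + 4` in place of `k`. -/
lemma eight_mul_le_two_pow (m k : ℕ) :
    8 * ((m : ℝ) + 1) * (2 ^ ((k + 4) * (m + 1)))⁻¹ ≤ 2⁻¹ ^ (k * (m + 1)) := by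
  have h1 : (m : ℝ) + 1 ≤ 2 ^ m := by exact_mod_cast Nat.lt_two_pow_self (n := m)
  have h2 : (2 : ℝ) ^ ((k + 4) * (m + 1)) = 2 ^ (k * (m + 1)) * (2 ^ (3 * m + 4) * 2 ^ m) := by
    rw [← pow_add, ← pow_add]; congr 1; ring
  have h3 : (8 : ℝ) ≤ 2 ^ (3 * m + 4) := by
    calc (8 : ℝ) = 2 ^ 3 := by norm_num
      _ ≤ _ := pow_le_pow_right₀ one_le_two (by omega)
  rw [inv_pow, h2, ← div_eq_mul_inv, div_le_iff₀ (by positivity),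
    inv_mul_cancel_left₀ (by positivity)]
  exact mul_le_mul h3 h1 (by positivity) (by positivity)

/-- The diagrams of presentations of `L^p` spaces are defined by rules. -/
theorem exists_diagram_eq_iff {𝕜 : Type*} [RCLike 𝕜] {p : ℝ} [hp : Fact (1 ≤ ENNReal.ofReal p)]
    {L : List ScalarCode × ℕ → ℕ}
    (hL : ∀ a h, |lpNorm 𝕜 p a - (L (a, h) : ℝ) / 2 ^ h| ≤ (2 ^ h)⁻¹) (D : Set DiagramCode) :
    (∃ (Ω : Type) (_ : MeasurableSpace Ω) (μ : Measure Ω)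
      (S : Presentation 𝕜 (Lp 𝕜 (ENNReal.ofReal p) μ)), S.diagram = D) ↔
    HasSmallIntervals D ∧ HasShrinkings D ∧ HasEnlargements D ∧ IsSubadditive 𝕜 D ∧
      HasLocalLpBases 𝕜 L D := by
  constructor
  · rintro ⟨Ω, mΩ, μ, S, rfl⟩
    exact ⟨S.hasSmallIntervals_diagram, S.hasShrinkings_diagram, S.hasEnlargements_diagram,
      S.isSubadditive_diagram, S.hasLocalLpBases_diagram hL⟩
  rintro ⟨h1, h2, h3, h4, h5⟩
  choose N hN using exists_norm_of_rules h1 h2 h3 h4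
  have hNf := isNormFunction_of_isSubadditive h4 hN
  set s := hNf.seminorm
  have hs : ∀ v, s (VectorCode.toFinsupp 𝕜 v) = N v := hNf.seminorm_toFinsupp
  obtain ⟨Ω, mΩ, μ, S, hS⟩ := exists_presentation_of_seminorm (p := p) s (by
    intro V k
    choose c hc using fun v : ℕ →₀ 𝕜 => hNf.exists_seminorm_sub_lt v
      (show (0 : ℝ) < 2⁻¹ ^ (k + 1) by positivity)
    -- The rule concerns rational vectors, so the elements of `V` are first replaced by rational
    -- ones at half of the allowed distance.
    obtain ⟨u, C, hu⟩ := h5 (V.toList.map c) (k + 4)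
    set m := u.length with hm
    set h := (k + 4) * (m + 1) with hh
    have hη0 : (0 : ℝ) < (2 ^ h)⁻¹ := by positivity
    let w : Fin m → (ℕ →₀ 𝕜) := fun j => VectorCode.toFinsupp 𝕜 (u.getD j [])
    have hcomb : ∀ a : List ScalarCode, VectorCode.toFinsupp 𝕜 (VectorCode.comb (imSq 𝕜) a u m) =
        ∑ j : Fin m, (a.getD j ScalarCode.zero).val 𝕜 • w j := fun a => by
      rw [VectorCode.toFinsupp_comb, Finset.sum_range]
    have h8 := eight_mul_le_two_pow m k
    rw [← hh] at h8
    refine ⟨m, w, fun a => ?_, fun v hv => ?_⟩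
    · have hη : 2 * (2 ^ h : ℝ)⁻¹ * (m + 1) ≤ 1 / 2 := by
        have : (2⁻¹ : ℝ) ^ (k * (m + 1)) ≤ 1 := pow_le_one₀ (by norm_num) (by norm_num)
        nlinarith
      have key := abs_seminorm_sub_norm_le_of_net (p := p) s w hη0.le hη (by
        intro z hz
        obtain ⟨i, hi, hzi⟩ := exists_gridVector_near hz h
        refine ⟨WithLp.toLp _ fun j : Fin m =>
          ((gridVector h m i).getD j ScalarCode.zero).val 𝕜, hzi, ?_⟩
        have hq := hu (VectorCode.comb (imSq 𝕜) (gridVector h m i) u m, IntervalCode.dyadic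
          (RatCode.dyadicFrac (L (gridVector h m i, h + 1)) (h + 1)) h)
          (List.mem_append_left _ (List.mem_map.2 ⟨i, List.mem_range.2 hi, rfl⟩))
        rw [hN, IntervalCode.mem_dyadic, ← hs, hcomb, RatCode.val_dyadicFrac, abs_lt] at hq
        have h6 := abs_le.1 (hL (gridVector h m i) (h + 1))
        rw [lpNorm_eq_norm (length_gridVector h m i)] at h6
        have h7 : (2 ^ h : ℝ)⁻¹ = 2 * (2 ^ (h + 1))⁻¹ := by rw [pow_succ]; field_simp
        push_cast at hq
        rw [abs_le]
        constructor
        · linarith [hq.1, h6.2]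
        · linarith [hq.2, h6.1]) (WithLp.toLp _ a)
      have e : ‖(WithLp.toLp _ a : FinLp 𝕜 p m)‖ = (∑ i, ‖a i‖ ^ p) ^ (1 / p) := FinLp.norm_eq _
      rw [← e]
      exact key.trans (mul_le_mul_of_nonneg_right h8 (norm_nonneg _))
    · obtain ⟨i, hi, hiv⟩ := List.getElem_of_mem
        (List.mem_map_of_mem (f := c) (Finset.mem_toList.2 hv))
      refine ⟨fun j => ((C.getD i []).getD j ScalarCode.zero).val 𝕜, ?_⟩
      have hq := hu (VectorCode.lin (imSq 𝕜) ScalarCode.one ((V.toList.map c).getD i [])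
          ScalarCode.negOne (VectorCode.comb (imSq 𝕜) (C.getD i []) u m),
          IntervalCode.dyadic (RatCode.frac 0 0) (k + 4))
        (List.mem_append_right _ (List.mem_map.2 ⟨i, List.mem_range.2 hi, rfl⟩))
      rw [hN, IntervalCode.mem_dyadic, ← hs, VectorCode.toFinsupp_lin, hcomb, ScalarCode.val_one,
        ScalarCode.val_negOne, one_smul, neg_one_smul, ← sub_eq_add_neg, RatCode.val_frac,
        List.getD_eq_getElem _ _ hi, hiv] at hq
      simp only [Nat.cast_zero, zero_add, div_one, Rat.cast_zero, sub_zero] at hq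
      have h6 := (le_abs_self _).trans_lt hq
      have h7 := hc v
      rw [← sub_add_sub_cancel v (VectorCode.toFinsupp 𝕜 (c v))]
      refine (map_add_le_add s _ _).trans ?_
      have h9 : (2 ^ (k + 4) : ℝ)⁻¹ ≤ 2⁻¹ ^ (k + 1) := by
        rw [← inv_pow]
        exact pow_le_pow_of_le_one (by norm_num) (by norm_num) (by omega)
      have h10 : (2⁻¹ : ℝ) ^ k = 2⁻¹ ^ (k + 1) + 2⁻¹ ^ (k + 1) := by rw [pow_succ]; ring
      rw [h10]
      exact add_le_add h7.le (h6.le.trans h9))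
  refine ⟨Ω, mΩ, μ, S, ?_⟩
  ext ⟨v, I⟩
  change ‖S.vec v‖ ∈ I.toSet ↔ _
  rw [S.vec_eq, hS, hs, hN]

/-- The property of being the diagram of a presentation of an `L^p` space is a rule. -/
theorem isRule_exists_diagram_eq (𝕜 : Type*) [RCLike 𝕜] {p : ℝ}
    [hp : Fact (1 ≤ ENNReal.ofReal p)] (hc : IsComputableReal p) :
    IsRule fun D : Set DiagramCode => ∃ (Ω : Type) (_ : MeasurableSpace Ω) (μ : Measure Ω)
      (S : Presentation 𝕜 (Lp 𝕜 (ENNReal.ofReal p) μ)), S.diagram = D := by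
  have hp0 : 0 < p := by have := ENNReal.one_le_ofReal.1 hp.out; linarith
  obtain ⟨L, hLc, hL⟩ := exists_computable_lpNorm 𝕜 hp0 hc
  simp_rw [exists_diagram_eq_iff hL]
  exact isRule_hasSmallIntervals.and (isRule_hasShrinkings.and (isRule_hasEnlargements.and
    ((isRule_isSubadditive 𝕜).and (isRule_hasLocalLpBases 𝕜 hLc))))

end LpIndex

end

noncomputable section

namespace LpIndex

/-! ### Names and indices of presentations of `L^p` spaces are `Π⁰₂` -/

@[fun_prop]
lemma computable_natPair {α : Type*} [Primcodable α] {f g : α → ℕ} (hf : Computable f)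
    (hg : Computable g) : Computable fun x => Nat.pair (f x) (g x) :=
  Primrec₂.natPair.to_comp.comp hf hg

section

variable {δ : Type*} [Primcodable δ] [DecidableEq δ]

/-- The test that the witness `t` is suitable for the parameter `w.1` and the elements with numbers
in `w.2` of the set enumerated by `σ`. -/
def ruleTest (ρ : (ℕ × List δ) × ℕ → Option (List δ)) (σ : List (Option δ)) (w : ℕ × List ℕ)
    (t : ℕ) : Bool :=
  w.2.all (fun i => decide (i < σ.length)) &&
    (ρ ((w.1, w.2.filterMap fun i => σ.getD i none), t)).elim false
      fun qs => qs.all fun q => !σ.all fun o => !decide (o = some q)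

lemma computable_ruleTest {α : Type*} [Primcodable α] {ρ : (ℕ × List δ) × ℕ → Option (List δ)}
    (hρ : Computable ρ) {σ : α → List (Option δ)} {w : α → ℕ × List ℕ} {t : α → ℕ}
    (hσ : Computable σ) (hw : Computable w) (ht : Computable t) :
    Computable fun x => ruleTest ρ (σ x) (w x) (t x) := by
  have h1 : Computable fun x => ρ (((w x).1, (w x).2.filterMap fun i => (σ x).getD i none), t x) :=
    hρ.comp (by fun_prop)
  have h2 : Computable fun x => (w x).2.all (fun i => decide (i < (σ x).length)) :=
    computable_list_all (by fun_prop) (computable_decide_lt (by fun_prop) (by fun_prop))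
  have h3 : Computable fun z : α × List δ =>
      z.2.all fun q => !(σ z.1).all fun o => !decide (o = some q) :=
    computable_list_all (by fun_prop) (computable_not (computable_list_all (by fun_prop)
      (computable_not (computable_decide_eq (by fun_prop) (by fun_prop)))))
  exact computable_and h2 (computable_option_elim h1 (computable_const false) h3)

lemma computable_ruleTest_decode {ρ : (ℕ × List δ) × ℕ → Option (List δ)} (hρ : Computable ρ) :
    Computable fun z : (List (Option δ) × ℕ) × ℕ =>
      (Encodable.decode z.1.2 : Option (ℕ × List ℕ)).elim true
        fun w => ruleTest ρ z.1.1 w z.2 :=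
  computable_option_elim (by fun_prop) (by fun_prop)
    (computable_ruleTest hρ (by fun_prop) (by fun_prop) (by fun_prop))

end

/-- A property defined by a rule is `Π⁰₂` in an enumeration of the set. -/
lemma IsRule.exists_test {δ : Type*} [Primcodable δ] {Q : Set δ → Prop}
    (hQ : IsRule Q) : ∃ χ : (List (Option δ) × ℕ) × ℕ → Bool, Computable χ ∧
      ∀ F : ℕ → Option δ, Q {d | ∃ n, F n = some d} ↔
        ∀ x : ℕ, ∃ y : ℕ, χ (((List.range y.unpair.1).map F, x), y.unpair.2) = true := by
  have : DecidableEq δ := Encodable.decidableEqOfEncodable δ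
  obtain ⟨ρ, hρ, h⟩ := hQ
  -- The universal parameter codes a parameter of the rule and a list of positions in the
  -- enumeration that stand for the premises. The number `y` codes a stage and a witness `t`, and
  -- the test passes when all premises and conclusions have been listed by that stage.
  refine ⟨_, computable_ruleTest_decode hρ, fun F => ?_⟩
  have hget : ∀ {s i : ℕ}, i < s → ((List.range s).map F).getD i none = F i := fun {s i} hi => by
    rw [List.getD_eq_getElem _ _ (by simpa using hi), List.getElem_map, List.getElem_range]
  have hmem : ∀ {s : ℕ} {q : δ}, (!((List.range s).map F).all fun o => !decide (o = some q)) = true ↔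
      ∃ n < s, F n = some q := by
    intro s q
    simp only [Bool.not_eq_true', ← Bool.not_eq_true, List.all_eq_true, List.mem_map,
      List.mem_range, decide_eq_true_iff]
    push Not
    simp
  rw [h]
  constructor
  · intro H x
    rcases hx : (Encodable.decode x : Option (ℕ × List ℕ)) with _ | ⟨x', K⟩
    · exact ⟨0, by simp only [hx, Option.elim_none]⟩
    · obtain ⟨t, qs, h1, h2⟩ := H x' (K.filterMap F) (by
        intro d hd
        obtain ⟨i, _, hi⟩ := List.mem_filterMap.1 hd
        exact ⟨i, hi⟩)
      have hb : ∃ s : ℕ, (∀ i ∈ K, i < s) ∧ ∀ q ∈ qs, ∃ n < s, F n = some q := by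
        have e1 : ∃ s : ℕ, ∀ i ∈ K, i < s :=
          ⟨K.sum + 1, fun i hi => Nat.lt_succ_of_le (List.single_le_sum (by simp) i hi)⟩
        have e2 : ∃ s : ℕ, ∀ q ∈ qs, ∃ n < s, F n = some q := by
          clear h1
          induction qs with
          | nil => exact ⟨0, by simp⟩
          | cons q qs ih =>
            obtain ⟨s, hs⟩ := ih fun d hd => h2 d (List.mem_cons_of_mem _ hd)
            obtain ⟨n, hn⟩ := h2 q List.mem_cons_self
            refine ⟨max s (n + 1), fun q' hq' => ?_⟩
            rcases List.mem_cons.1 hq' with rfl | hq'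
            · exact ⟨n, by omega, hn⟩
            · obtain ⟨n', h3, h4⟩ := hs q' hq'
              exact ⟨n', by omega, h4⟩
        obtain ⟨s₁, e1⟩ := e1
        obtain ⟨s₂, e2⟩ := e2
        refine ⟨max s₁ s₂, fun i hi => lt_max_of_lt_left (e1 i hi), fun q hq => ?_⟩
        obtain ⟨n, h3, h4⟩ := e2 q hq
        exact ⟨n, lt_max_of_lt_right h3, h4⟩
      obtain ⟨s, hs1, hs2⟩ := hb
      refine ⟨Nat.pair s t, ?_⟩
      rw [Nat.unpair_pair]
      have e : (K.filterMap fun i => ((List.range s).map F).getD i none) = K.filterMap F :=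
        List.filterMap_congr fun i hi => hget (hs1 i hi)
      simp only [ruleTest, hx, Option.elim_some, e, h1, Bool.and_eq_true, List.all_eq_true,
        decide_eq_true_iff, hmem, List.length_map, List.length_range]
      exact ⟨hs1, hs2⟩
  · intro H x L hL
    have hK : ∃ K : List ℕ, K.filterMap F = L := by
      clear H
      induction L with
      | nil => exact ⟨[], rfl⟩
      | cons d L ih =>
        obtain ⟨K, hK⟩ := ih fun d' hd' => hL d' (List.mem_cons_of_mem _ hd')
        obtain ⟨n, hn⟩ := hL d List.mem_cons_self
        exact ⟨n :: K, by rw [List.filterMap_cons_some hn, hK]⟩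
    obtain ⟨K, rfl⟩ := hK
    obtain ⟨y, hy⟩ := H (Encodable.encode (x, K))
    simp only [ruleTest, Encodable.encodek, Option.elim_some, Bool.and_eq_true, List.all_eq_true,
      decide_eq_true_iff, List.length_map, List.length_range] at hy
    obtain ⟨h1, h2⟩ := hy
    have e : (K.filterMap fun i => ((List.range y.unpair.1).map F).getD i none) = K.filterMap F :=
      List.filterMap_congr fun i hi => hget (h1 i hi)
    rw [e] at h2
    rcases hr : ρ ((x, K.filterMap F), y.unpair.2) with _ | qs
    · simp [hr] at h2
    · simp only [hr, Option.elim_some, List.all_eq_true, hmem] at h2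
      refine ⟨_, qs, hr, fun d hd => ?_⟩
      obtain ⟨n, _, hn⟩ := h2 d hd
      exact ⟨n, hn⟩

/-- A functional whose value at `n` is computed from the first `u n` values of its argument is
computable. -/
lemma isComputableOperator_of_use {v : List ℕ × ℕ → ℕ} (hv : Computable v) {u : ℕ → ℕ}
    (hu : Computable u) :
    IsComputableOperator fun f n => v ((List.range (u n)).map f, n) := by
  refine ⟨fun l n => bif decide (u n ≤ l.length) then some (v (l.take (u n), n)) else none, ?_, ?_⟩
  · have hu' : Computable fun z : List ℕ × ℕ => u z.2 := hu.comp Computable.snd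
    have hv' : Computable fun z : List ℕ × ℕ => v (z.1.take (u z.2), z.2) :=
      hv.comp (computable_pair (computable_take hu' Computable.fst) Computable.snd)
    exact (computable_cond (computable_decide_le hu'
      (computable_length Computable.fst)) (computable_some hv') (computable_const none) : Computable fun z : List ℕ × ℕ => _)
  · intro f n m
    have htake : ∀ k, u n ≤ k → ((List.range k).map f).take (u n) = (List.range (u n)).map f :=
      fun k hk => by rw [← List.map_take, List.take_range, min_eq_left hk]
    constructor
    · rintro rfl
      exact ⟨u n, by simp [htake _ le_rfl]⟩
    · rintro ⟨k, hk⟩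
      by_cases h : u n ≤ k
      · simpa [h, htake k h] using hk
      · simp [h] at hk

lemma decode_eq_some_iff (n : ℕ) (d : DiagramCode) :
    (Encodable.decode n : Option DiagramCode) = some d ↔ n = Encodable.encode d := by
  constructor
  · intro h
    have := Denumerable.encode_ofNat (α := DiagramCode) n
    rw [Denumerable.decode_eq_ofNat, Option.some_inj] at h
    rw [← h, this]
  · rintro rfl
    exact Encodable.encodek d

/-- The coding of pairs by numbers is bijective, so every value of `f` is the code of a pair. -/
lemma isName_iff {𝕜 : Type*} [RCLike 𝕜] {B : Type*} [NormedAddCommGroup B] [NormedSpace 𝕜 B]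
    (S : Presentation 𝕜 B) (f : ℕ → ℕ) : S.IsName f ↔
      S.diagram = {d | ∃ n, (Encodable.decode (f n) : Option DiagramCode) = some d} := by
  simp only [decode_eq_some_iff]
  rw [Presentation.IsName]
  constructor
  · intro h
    ext d
    rw [Set.mem_ofPred_eq, ← Encodable.encode_injective.mem_set_image, ← h]
    rfl
  · intro h
    rw [h]
    ext n
    constructor
    · rintro ⟨k, rfl⟩
      refine ⟨Denumerable.ofNat DiagramCode (f k), ⟨k, ?_⟩, ?_⟩
      · exact (Denumerable.encode_ofNat (α := DiagramCode) _).symm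
      · exact Denumerable.encode_ofNat (α := DiagramCode) _
    · rintro ⟨d, ⟨k, hk⟩, rfl⟩
      exact ⟨k, hk⟩

theorem isPi02Baire_lpNames (𝕜 : Type*) [RCLike 𝕜] {p : ℝ} (hp : 1 ≤ p)
    (hc : IsComputableReal p) : IsPi02Baire (lpNames 𝕜 p hp) := by
  have : Fact (1 ≤ ENNReal.ofReal p) := ⟨ENNReal.one_le_ofReal.2 hp⟩
  obtain ⟨χ, hχ, h⟩ := (isRule_exists_diagram_eq 𝕜 hc).exists_test
  have hv : Computable fun z : List ℕ × ℕ => (bif χ ((z.1.map fun a =>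
      (Encodable.decode a : Option DiagramCode), z.2.unpair.1), z.2.unpair.2.unpair.2)
      then 1 else 0 : ℕ) :=
    computable_cond (hχ.comp (by fun_prop)) (by fun_prop) (by fun_prop)
  refine ⟨_, isComputableOperator_of_use hv (u := fun n => n.unpair.2.unpair.1) (by fun_prop),
    fun f => ?_⟩
  have hmem : f ∈ lpNames 𝕜 p hp ↔ ∃ (Ω : Type) (_ : MeasurableSpace Ω) (μ : Measure Ω)
      (S : Presentation 𝕜 (Lp 𝕜 (ENNReal.ofReal p) μ)),
      S.diagram = {d | ∃ n, (Encodable.decode (f n) : Option DiagramCode) = some d} := by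
    simp only [← isName_iff]
    rfl
  rw [hmem, h]
  refine forall_congr' fun x => exists_congr fun y => ?_
  simp only [Nat.unpair_pair, List.map_map]
  change χ (((List.range y.unpair.1).map
    ((fun a => (Encodable.decode a : Option DiagramCode)) ∘ f), x), y.unpair.2) = true ↔ _
  cases χ (((List.range y.unpair.1).map
    ((fun a => (Encodable.decode a : Option DiagramCode)) ∘ f), x), y.unpair.2) <;> simp

lemma IsPi02Nat.inter {A B : Set ℕ} (hA : IsPi02Nat A) (hB : IsPi02Nat B) :
    IsPi02Nat (A ∩ B) := by
  classical
  obtain ⟨R, hR, h1⟩ := hA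
  obtain ⟨T, hT, h2⟩ := hB
  obtain ⟨r, hr, rfl⟩ := ComputablePred.computable_iff.1 hR
  obtain ⟨t, ht, rfl⟩ := ComputablePred.computable_iff.1 hT
  refine ⟨fun z => (bif decide (z.2.1 % 2 = 0) then r (z.1, z.2.1 / 2, z.2.2)
    else t (z.1, z.2.1 / 2, z.2.2)) = true, ComputablePred.computable_iff.2 ⟨_, computable_cond
      (computable_decide_eq (by fun_prop) (by fun_prop)) (hr.comp (by fun_prop))
      (ht.comp (by fun_prop)), rfl⟩, fun e => ?_⟩
  rw [Set.mem_inter_iff, h1, h2]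
  constructor
  · rintro ⟨H1, H2⟩ x
    rcases Nat.mod_two_eq_zero_or_one x with h | h
    · simpa [h] using H1 (x / 2)
    · simpa [h] using H2 (x / 2)
  · refine fun H => ⟨fun x => ?_, fun x => ?_⟩
    · simpa using H (2 * x)
    · have e1 : (2 * x + 1) % 2 = 1 := by omega
      have e2 : (2 * x + 1) / 2 = x := by omega
      simpa [e1, e2] using H (2 * x + 1)

/-! ### Indices: totality and the enumeration of certified intervals. -/

open Nat.Partrec (Code)

/-- The result, if any, of a given number of steps of the `e`-th program. -/
def stepEval (e s n : ℕ) : Option ℕ := Code.evaln s (Denumerable.ofNat Code e) n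

@[fun_prop]
lemma computable_stepEval {α : Type*} [Primcodable α] {e s n : α → ℕ} (he : Computable e)
    (hs : Computable s) (hn : Computable n) :
    Computable fun x => stepEval (e x) (s x) (n x) := by
  have h : Computable fun x => (Denumerable.ofNat Code (e x)) :=
    (Primrec.ofNat Code).to_comp.comp he
  exact Code.primrec_evaln.to_comp.comp ((hs.pair h).pair hn)

lemma mem_eval_iff {e n x : ℕ} :
    x ∈ Code.eval (Denumerable.ofNat Code e) n ↔ ∃ s, stepEval e s n = some x :=
  Code.evaln_complete

/-- The elements of the diagram which are verified by the `e`-th program. -/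
def diagramEnum (z : ℕ × ℕ) : Option DiagramCode :=
  (Encodable.decode z.2 : Option ((VectorCode × ℕ) × IntervalCode × ℕ)).elim none fun w =>
    (stepEval z.1 w.2.2 (Encodable.encode w.1)).elim none fun x =>
      (Encodable.decode x : Option RatCode).elim none fun q =>
        bif RatCode.le w.2.1.lo (IntervalCode.dyadic q w.1.2).lo &&
          RatCode.le (IntervalCode.dyadic q w.1.2).hi w.2.1.hi then some (w.1.1, w.2.1) else none

lemma computable_diagramEnum : Computable diagramEnum := by
  unfold diagramEnum; fun_prop

lemma exists_diagramEnum_eq_some_iff {e : ℕ} {v : VectorCode} {I : IntervalCode} :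
    (∃ n, diagramEnum (e, n) = some (v, I)) ↔ ∃ (k : ℕ) (q : RatCode),
      Encodable.encode q ∈ Code.eval (Denumerable.ofNat Code e) (Encodable.encode (v, k)) ∧
      I.lo.val ≤ (IntervalCode.dyadic q k).lo.val ∧ (IntervalCode.dyadic q k).hi.val ≤ I.hi.val := by
  constructor
  · rintro ⟨n, hn⟩
    rw [diagramEnum] at hn
    rcases h1 : (Encodable.decode n : Option ((VectorCode × ℕ) × IntervalCode × ℕ)) with
      _ | ⟨⟨v', k⟩, I', s⟩
    · simp only [h1, Option.elim_none] at hn; cases hn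
    simp only [h1, Option.elim_some] at hn
    rcases h2 : stepEval e s (Encodable.encode (v', k)) with _ | x
    · simp only [h2, Option.elim_none] at hn; cases hn
    simp only [h2, Option.elim_some] at hn
    rcases h3 : (Encodable.decode x : Option RatCode) with _ | q
    · simp only [h3, Option.elim_none] at hn; cases hn
    simp only [h3, Option.elim_some] at hn
    cases h4 : RatCode.le I'.lo (IntervalCode.dyadic q k).lo &&
      RatCode.le (IntervalCode.dyadic q k).hi I'.hi
    · simp only [h4, cond_false] at hn; cases hn
    rw [h4, cond_true, Option.some_inj, Prod.mk.injEq] at hn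
    obtain ⟨rfl, rfl⟩ := hn
    rw [Bool.and_eq_true, RatCode.le_iff, RatCode.le_iff] at h4
    have h5 : Encodable.encode q = x := by
      rw [Denumerable.decode_eq_ofNat, Option.some_inj] at h3
      rw [← h3]
      exact Denumerable.encode_ofNat (α := RatCode) x
    refine ⟨k, q, ?_, h4⟩
    rw [mem_eval_iff, h5]
    exact ⟨s, h2⟩
  · rintro ⟨k, q, h1, h2, h3⟩
    obtain ⟨s, hs⟩ := mem_eval_iff.1 h1
    refine ⟨Encodable.encode ((v, k), I, s), ?_⟩
    simp only [diagramEnum, Encodable.encodek, Option.elim_some, hs, (RatCode.le_iff _ _).2 h2,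
      (RatCode.le_iff _ _).2 h3, Bool.and_true, cond_true]

/-- An interval contains the norm exactly when it contains one of the dyadic intervals around the
outputs, which are of arbitrarily small radius. Conversely, the dyadic interval around an output is
itself enumerated, so membership in the diagram is the required error bound. -/
lemma isIndex_iff {𝕜 : Type*} [RCLike 𝕜] {B : Type*} [NormedAddCommGroup B] [NormedSpace 𝕜 B]
    (S : Presentation 𝕜 B) (e : ℕ) : S.IsIndex e ↔
      (∀ (v : VectorCode) (k : ℕ), ∃ q : RatCode,
        Encodable.encode q ∈ Code.eval (Denumerable.ofNat Code e) (Encodable.encode (v, k))) ∧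
      S.diagram = {d | ∃ n, diagramEnum (e, n) = some d} := by
  constructor
  · intro h
    refine ⟨fun v k => ?_, ?_⟩
    · obtain ⟨q, hq, -⟩ := h v k
      exact ⟨q, hq⟩
    ext ⟨v, I⟩
    rw [Set.mem_ofPred_eq, exists_diagramEnum_eq_some_iff, S.mem_diagram]
    constructor
    · rintro ⟨h1, h2⟩
      obtain ⟨k, hk⟩ := exists_pow_lt_of_lt_one
        (show 0 < min (‖S.vec v‖ - I.lo.val) (I.hi.val - ‖S.vec v‖) / 2 by
          have := sub_pos.2 h1; have := sub_pos.2 h2; positivity)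
        (show (2⁻¹ : ℝ) < 1 by norm_num)
      rw [inv_pow] at hk
      have m1 := min_le_left (‖S.vec v‖ - I.lo.val) (I.hi.val - ‖S.vec v‖)
      have m2 := min_le_right (‖S.vec v‖ - I.lo.val) (I.hi.val - ‖S.vec v‖)
      obtain ⟨q, hq, hq2⟩ := h v k
      rw [abs_lt] at hq2
      have t1 : (I.lo.val : ℝ) ≤ (IntervalCode.dyadic q k).lo.val := by
        rw [IntervalCode.val_lo (IntervalCode.dyadic q k), IntervalCode.val_dyadic_radius]
        push_cast
        change _ ≤ (q.val : ℝ) - _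
        linarith
      have t2 : ((IntervalCode.dyadic q k).hi.val : ℝ) ≤ I.hi.val := by
        rw [IntervalCode.val_hi (IntervalCode.dyadic q k), IntervalCode.val_dyadic_radius]
        push_cast
        change (q.val : ℝ) + _ ≤ _
        linarith
      exact ⟨k, q, hq, by exact_mod_cast t1, by exact_mod_cast t2⟩
    · rintro ⟨k, q, hq, h1, h2⟩
      obtain ⟨q', hq', h3⟩ := h v k
      obtain rfl := Encodable.encode_injective (Part.mem_unique hq hq')
      rw [abs_sub_comm, ← IntervalCode.mem_dyadic, IntervalCode.mem_toSet] at h3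
      have h1' : (I.lo.val : ℝ) ≤ (IntervalCode.dyadic q k).lo.val := by exact_mod_cast h1
      have h2' : ((IntervalCode.dyadic q k).hi.val : ℝ) ≤ I.hi.val := by exact_mod_cast h2
      exact ⟨h1'.trans_lt h3.1, h3.2.trans_le h2'⟩
  · rintro ⟨h1, h2⟩ v k
    obtain ⟨q, hq⟩ := h1 v k
    refine ⟨q, hq, ?_⟩
    have : (v, IntervalCode.dyadic q k) ∈ S.diagram := by
      rw [h2, Set.mem_ofPred_eq, exists_diagramEnum_eq_some_iff]
      exact ⟨k, q, hq, le_rfl, le_rfl⟩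
    rw [abs_sub_comm]
    exact IntervalCode.mem_dyadic.1 this

theorem isPi02Nat_lpIndices (𝕜 : Type*) [RCLike 𝕜] {p : ℝ} (hp : 1 ≤ p)
    (hc : IsComputableReal p) : IsPi02Nat (lpIndices 𝕜 p hp) := by
  have : Fact (1 ≤ ENNReal.ofReal p) := ⟨ENNReal.one_le_ofReal.2 hp⟩
  obtain ⟨χ, hχ, h⟩ := (isRule_exists_diagram_eq 𝕜 hc).exists_test
  have hmem : lpIndices 𝕜 p hp = {e | ∀ (v : VectorCode) (k : ℕ), ∃ q : RatCode,
        Encodable.encode q ∈ Code.eval (Denumerable.ofNat Code e) (Encodable.encode (v, k))} ∩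
      {e | ∃ (Ω : Type) (_ : MeasurableSpace Ω) (μ : Measure Ω)
        (S : Presentation 𝕜 (Lp 𝕜 (ENNReal.ofReal p) μ)),
        S.diagram = {d | ∃ n, diagramEnum (e, n) = some d}} := by
    ext e
    have : e ∈ lpIndices 𝕜 p hp ↔ ∃ (Ω : Type) (_ : MeasurableSpace Ω) (μ : Measure Ω)
      (S : Presentation 𝕜 (Lp 𝕜 (ENNReal.ofReal p) μ)), S.IsIndex e := Iff.rfl
    rw [this]
    simp only [isIndex_iff, exists_and_left]
    rfl
  rw [hmem]
  refine IsPi02Nat.inter ?_ ?_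
  · refine ⟨fun z => ((stepEval z.1 z.2.2 z.2.1).elim false fun _ => true) = true,
      ComputablePred.computable_iff.2 ⟨_, by fun_prop, rfl⟩, fun e => ?_⟩
    have e1 : ∀ x y, ((stepEval e y x).elim false fun _ => true) = true ↔
        ∃ a, stepEval e y x = some a := fun x y => by
      cases stepEval e y x <;> simp
    simp only [e1, Set.mem_ofPred_eq]
    constructor
    · intro H x
      obtain ⟨q, hq⟩ := H (Denumerable.ofNat (VectorCode × ℕ) x).1
        (Denumerable.ofNat (VectorCode × ℕ) x).2
      rw [Prod.mk.eta, Denumerable.encode_ofNat, mem_eval_iff] at hq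
      obtain ⟨s, hs⟩ := hq
      exact ⟨s, _, hs⟩
    · intro H v k
      obtain ⟨s, a, ha⟩ := H (Encodable.encode (v, k))
      refine ⟨Denumerable.ofNat RatCode a, ?_⟩
      rw [Denumerable.encode_ofNat, mem_eval_iff]
      exact ⟨s, ha⟩
  · have hF : Computable fun z : ℕ × ℕ × ℕ =>
        (List.range z.2.2.unpair.1).map fun n => diagramEnum (z.1, n) :=
      computable_map_range (by fun_prop) (computable_diagramEnum.comp (by fun_prop))
    refine ⟨fun z => χ (((List.range z.2.2.unpair.1).map fun n => diagramEnum (z.1, n), z.2.1),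
      z.2.2.unpair.2) = true, ComputablePred.computable_iff.2 ⟨_, hχ.comp
        (computable_pair (computable_pair hF (by fun_prop)) (by fun_prop)), rfl⟩, fun e => ?_⟩
    rw [Set.mem_ofPred_eq, h]

end LpIndex

end

noncomputable section

namespace LpIndex

/-! ### Hardness -/

section

variable (𝕜 : Type*) [RCLike 𝕜] (p : ℝ) [hp : Fact (1 ≤ ENNReal.ofReal p)]

/-- The presentation of the `L^p` space of a point whose distinguished points are `1, 0, 0, …`. -/
def onePointPresentation :
    Presentation 𝕜 (Lp 𝕜 (ENNReal.ofReal p) (Measure.dirac () : Measure Unit)) where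
  point j := if j = 0 then Lp.const _ _ 1 else 0
  dense := by
    refine top_le_iff.1 (le_trans (fun f _ => ?_) (Submodule.le_topologicalClosure _))
    have e : f = f () • (Lp.const _ _ (1 : 𝕜) :
        Lp 𝕜 (ENNReal.ofReal p) (Measure.dirac () : Measure Unit)) := by
      refine Lp.ext ?_
      filter_upwards [Lp.coeFn_smul (f ()) (Lp.const (ENNReal.ofReal p)
        (Measure.dirac () : Measure Unit) (1 : 𝕜)), Lp.coeFn_const (ENNReal.ofReal p)
        (Measure.dirac () : Measure Unit) (1 : 𝕜)] with x h1 h2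
      rw [h1, Pi.smul_apply, h2]
      simp
    rw [e]
    exact Submodule.smul_mem _ _ (Submodule.subset_span ⟨0, if_pos rfl⟩)

lemma norm_vec_onePointPresentation (v : VectorCode) :
    ‖(onePointPresentation 𝕜 p).vec v‖ = ‖(v.getD 0 ScalarCode.zero).val 𝕜‖ := by
  have hp1 := ENNReal.one_le_ofReal.1 hp.out
  have h : (onePointPresentation 𝕜 p).vec v =
      (v.getD 0 ScalarCode.zero).val 𝕜 • Lp.const _ _ (1 : 𝕜) := by
    rw [Presentation.vec_eq, Finsupp.linearCombination_apply, Finsupp.sum,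
      Finset.sum_eq_single 0]
    · rfl
    · intro j _ hj
      simp [onePointPresentation, hj]
    · intro h
      rw [Finsupp.notMem_support_iff.1 h, zero_smul]
  rw [h, norm_smul, Lp.norm_const' _ _ _ (by simp; linarith) ENNReal.ofReal_ne_top]
  simp

/-- The decision procedure for the diagram of the presentation of a point. -/
def onePointTest (δ : ℕ) (d : DiagramCode) : Bool :=
  (RatCode.lt d.2.lo (RatCode.frac 0 0) || RatCode.lt (RatCode.mul d.2.lo d.2.lo)
      (ScalarCode.normSq δ (d.1.getD 0 ScalarCode.zero))) &&
    (RatCode.lt (RatCode.frac 0 0) d.2.hi && RatCode.lt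
      (ScalarCode.normSq δ (d.1.getD 0 ScalarCode.zero)) (RatCode.mul d.2.hi d.2.hi))

lemma computable_onePointTest (δ : ℕ) : Computable fun d => onePointTest δ d := by
  unfold onePointTest; fun_prop

lemma onePointTest_iff (d : DiagramCode) :
    onePointTest (imSq 𝕜) d = true ↔ d ∈ (onePointPresentation 𝕜 p).diagram := by
  rw [Presentation.mem_diagram, norm_vec_onePointPresentation, onePointTest]
  set a := d.1.getD 0 ScalarCode.zero
  have h0 := norm_nonneg (a.val 𝕜)
  simp only [Bool.and_eq_true, Bool.or_eq_true, RatCode.lt_iff]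
  simp only [← Rat.cast_lt (K := ℝ), ScalarCode.val_normSq, RatCode.val_mul, RatCode.val_frac]
  push_cast
  rw [zero_div]
  generalize (d.2.lo.val : ℝ) = l
  generalize (d.2.hi.val : ℝ) = r
  refine and_congr ⟨?_, fun h => ?_⟩ ⟨fun h => ?_, fun h => ⟨by linarith, by nlinarith⟩⟩
  · rintro (h | h)
    · linarith
    · nlinarith
  -- Norms are compared through their squares, which loses the sign of the left end; a negative left
  -- end is accepted separately.
  · rcases lt_or_ge l 0 with hl | hl
    · exact Or.inl hl
    · exact Or.inr (by nlinarith)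
  · nlinarith [h.1, h.2]

/-- The diagram is decidable and nonempty; every number that fails the test is sent to the fixed
element `d₀`. -/
lemma exists_enumeration_onePointPresentation : ∃ d : ℕ → DiagramCode, Computable d ∧
    Set.range d = (onePointPresentation 𝕜 p).diagram := by
  let d₀ : DiagramCode := ([], IntervalCode.dyadic (RatCode.frac 0 0) 0)
  have h₀ : d₀ ∈ (onePointPresentation 𝕜 p).diagram := by
    change _ ∈ IntervalCode.toSet _
    rw [norm_vec_onePointPresentation, IntervalCode.mem_dyadic, RatCode.val_frac]
    simp [d₀, ScalarCode.val_zero]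
  refine ⟨fun n => (Encodable.decode n : Option DiagramCode).elim d₀ fun d =>
    bif onePointTest (imSq 𝕜) d then d else d₀, computable_option_elim (by fun_prop)
      (computable_const _) (computable_cond ((computable_onePointTest _).comp Computable.snd)
        Computable.snd (computable_const _)), ?_⟩
  ext d
  constructor
  · rintro ⟨n, rfl⟩
    beta_reduce
    rcases (Encodable.decode n : Option DiagramCode) with _ | d
    · exact h₀
    · cases h : onePointTest (imSq 𝕜) d
      · simpa [h] using h₀
      · simpa [h] using (onePointTest_iff 𝕜 p d).1 h
  · intro hd
    exact ⟨Encodable.encode d, by simp only [Encodable.encodek, Option.elim_some,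
      (onePointTest_iff 𝕜 p d).2 hd, cond_true]⟩

end

/-- The zero vector alone contributes infinitely many intervals around `0`. Hence a finite set can
never be a diagram. -/
lemma Presentation.infinite_diagram {𝕜 : Type*} [RCLike 𝕜] {B : Type*} [NormedAddCommGroup B]
    [NormedSpace 𝕜 B] (S : Presentation 𝕜 B) : S.diagram.Infinite := by
  have h : ∀ k : ℕ, ([], IntervalCode.dyadic (RatCode.frac 0 0) k) ∈ S.diagram := fun k => by
    change _ ∈ IntervalCode.toSet _
    rw [IntervalCode.mem_dyadic, RatCode.val_frac]
    simp [Presentation.vec]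
  refine Set.infinite_of_injective_forall_mem (f := fun k : ℕ =>
    (([], IntervalCode.dyadic (RatCode.frac 0 0) k) : DiagramCode)) (fun k l hkl => ?_) h
  have e : 2 ^ k - 1 = 2 ^ l - 1 := congrArg (fun d : DiagramCode => d.2.2.2) hkl
  have h1 : 1 ≤ 2 ^ k := Nat.one_le_two_pow
  have h2 : 1 ≤ 2 ^ l := Nat.one_le_two_pow
  exact Nat.pow_right_injective le_rfl (by beta_reduce; omega)

/-! ### The reductions. -/

lemma computable_any_range {α : Type*} [Primcodable α] {f : α → ℕ} {g : α → ℕ → Bool}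
    (hf : Computable f) (hg : Computable fun z : α × ℕ => g z.1 z.2) :
    Computable fun x => (List.range (f x)).any (g x) := by
  have h : Computable fun x => !(List.range (f x)).all fun i => !g x i :=
    computable_not (computable_all_range hf (computable_not hg))
  exact h.of_eq fun x => by simp [List.any_eq_not_all_not]

/-- The test that `φ` verifies the `Π⁰₂` condition for all parameters up to `x`, with the help of
the values `l` of its argument. -/
def stageTest (φ : List ℕ → ℕ → Option ℕ) (l : List ℕ) (x : ℕ) : Bool :=
  (List.range (x + 1)).all fun x' => (List.range (l.length + 1)).any fun y' =>
    (List.range (l.length + 1)).any fun k => decide (φ (l.take k) (Nat.pair x' y') = some 1)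

lemma computable_stageTest {α : Type*} [Primcodable α] {φ : List ℕ → ℕ → Option ℕ}
    (hφ : Computable₂ φ) {l : α → List ℕ} {x : α → ℕ} (hl : Computable l) (hx : Computable x) :
    Computable fun z => stageTest φ (l z) (x z) := by
  unfold stageTest
  have h : Computable fun z : ((α × ℕ) × ℕ) × ℕ =>
      φ ((l z.1.1.1).take z.2) (Nat.pair z.1.1.2 z.1.2) := by
    have h1 : Computable fun z : ((α × ℕ) × ℕ) × ℕ => (l z.1.1.1).take z.2 := by fun_prop
    have h2 : Computable fun z : ((α × ℕ) × ℕ) × ℕ => Nat.pair z.1.1.2 z.1.2 := by fun_prop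
    exact Computable₂.comp hφ h1 h2
  exact computable_all_range (by fun_prop) (computable_any_range (by fun_prop)
    (computable_any_range (by fun_prop) (computable_decide_eq h (by fun_prop))))

lemma stageTest_iff (φ : List ℕ → ℕ → Option ℕ) (f : ℕ → ℕ) (s x : ℕ) :
    stageTest φ ((List.range s).map f) x = true ↔ ∀ x' ≤ x, ∃ y' ≤ s, ∃ k ≤ s,
      φ ((List.range k).map f) (Nat.pair x' y') = some 1 := by
  have htake : ∀ k ≤ s, ((List.range s).map f).take k = (List.range k).map f := fun k hk => by
    rw [← List.map_take, List.take_range, min_eq_left hk]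
  simp only [stageTest, List.all_eq_true, List.any_eq_true, List.mem_range, Nat.lt_succ_iff,
    decide_eq_true_iff, List.length_map, List.length_range]
  refine forall_congr' fun x' => imp_congr_right fun _ => exists_congr fun y' =>
    and_congr_right fun _ => exists_congr fun k => and_congr_right fun hk => ?_
  rw [htake k hk]

/-- At `⟨x, s⟩` the operator lists `d x` if stage `s` confirms all instances of the `Π⁰₂` condition
up to `x`, and otherwise the harmless `d 0`. If the condition holds, everything is listed; if it
fails at `x`, only `d i` with `i ≤ x` can appear. -/
theorem exists_reduction_lpNames (𝕜 : Type*) [RCLike 𝕜] {p : ℝ} (hp : 1 ≤ p) {P : Set (ℕ → ℕ)}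
    (hP : IsPi02Baire P) :
    ∃ F : (ℕ → ℕ) → ℕ → ℕ, IsComputableOperator F ∧ ∀ f, f ∈ P ↔ F f ∈ lpNames 𝕜 p hp := by
  have : Fact (1 ≤ ENNReal.ofReal p) := ⟨ENNReal.one_le_ofReal.2 hp⟩
  obtain ⟨Q, ⟨φ, hφ, hQ⟩, hP⟩ := hP
  obtain ⟨d, hd, hrange⟩ := exists_enumeration_onePointPresentation 𝕜 p
  have hv : Computable fun z : List ℕ × ℕ => bif stageTest φ z.1 z.2.unpair.1 then
      Encodable.encode (d z.2.unpair.1) else Encodable.encode (d 0) :=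
    computable_cond (computable_stageTest hφ (by fun_prop) (by fun_prop))
      (computable_encode (hd.comp (by fun_prop))) (computable_const _)
  refine ⟨_, isComputableOperator_of_use hv (u := fun n => n.unpair.2) (by fun_prop), fun f => ?_⟩
  set F : ℕ → ℕ := fun n => bif stageTest φ ((List.range n.unpair.2).map f) n.unpair.1 then
    Encodable.encode (d n.unpair.1) else Encodable.encode (d 0) with hF
  have hstage : ∀ x, (∃ s, stageTest φ ((List.range s).map f) x = true) ↔
      ∀ x' ≤ x, ∃ y, Q f (Nat.pair x' y) = 1 := by
    intro x
    simp only [stageTest_iff, hQ]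
    constructor
    · rintro ⟨s, hs⟩ x' hx'
      obtain ⟨y, _, k, _, h⟩ := hs x' hx'
      exact ⟨y, k, h⟩
    · intro H
      choose! y k h using H
      -- A stage above all witnesses and all lengths of initial segments that the instances up to
      -- `x` need.
      refine ⟨∑ i ∈ Finset.range (x + 1), (y i + k i), fun x' hx' => ?_⟩
      have := Finset.single_le_sum (f := fun i => y i + k i) (fun _ _ => Nat.zero_le _)
        (Finset.mem_range.2 (show x' < x + 1 by omega))
      exact ⟨y x', by omega, k x', by omega, h x' hx'⟩
  rw [hP]
  constructor
  · intro H
    refine ⟨Unit, inferInstance, Measure.dirac (), onePointPresentation 𝕜 p, ?_⟩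
    rw [Presentation.IsName, ← hrange, ← Set.range_comp]
    refine Set.Subset.antisymm ?_ ?_
    · rintro _ ⟨n, rfl⟩
      simp only [hF]
      cases stageTest φ ((List.range n.unpair.2).map f) n.unpair.1
      · exact ⟨0, rfl⟩
      · exact ⟨n.unpair.1, rfl⟩
    · rintro _ ⟨x, rfl⟩
      obtain ⟨s, hs⟩ := (hstage x).2 fun x' _ => H x'
      refine ⟨Nat.pair x s, ?_⟩
      simp only [hF, Nat.unpair_pair, hs, cond_true]
      rfl
  · rintro ⟨Ω, mΩ, μ, S, hS⟩ x
    by_contra hx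
    refine S.infinite_diagram (Set.Finite.of_finite_image (f := Encodable.encode) ?_
      Encodable.encode_injective.injOn)
    rw [← hS]
    refine ((Set.finite_Iic x).image fun i => Encodable.encode (d i)).subset ?_
    rintro _ ⟨n, rfl⟩
    cases h : stageTest φ ((List.range n.unpair.2).map f) n.unpair.1
    · exact ⟨0, Nat.zero_le x, by simp only [hF, h, cond_false]⟩
    · refine ⟨n.unpair.1, ?_, by simp only [hF, h, cond_true]⟩
      by_contra hn
      exact hx ((hstage _).1 ⟨_, h⟩ x (not_le.1 hn).le)

lemma isComputableReal_one : IsComputableReal 1 :=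
  ⟨fun _ => RatCode.frac 1 0, by fun_prop, fun k => by simp [RatCode.val_frac]⟩

open Nat.Partrec (Code)

/-- The program for `e` searches, on input `n`, for a `y` with `R (e, n, y)` and then outputs a
correct approximation for the presentation of a point. It is total exactly when `e` lies in the set,
and every index is total. -/
theorem exists_reduction_lpIndices (𝕜 : Type*) [RCLike 𝕜] {p : ℝ} (hp : 1 ≤ p) {A : Set ℕ}
    (hA : IsPi02Nat A) : ManyOneReducible (fun e => e ∈ A) (fun e => e ∈ lpIndices 𝕜 p hp) := by
  have : Fact (1 ≤ ENNReal.ofReal p) := ⟨ENNReal.one_le_ofReal.2 hp⟩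
  obtain ⟨R, hR, hA⟩ := hA
  obtain ⟨r, hr, rfl⟩ := ComputablePred.computable_iff.1 hR
  -- The norms in the presentation of a point are absolute values of scalars, so powers with
  -- exponent `1` are what is needed. They are used at precision `k + 1` to make the error strictly
  -- less than `2 ^ (-k)`.
  obtain ⟨N, hN, hN'⟩ := exists_computable_rpow 𝕜 one_pos isComputableReal_one
  let q : VectorCode × ℕ → RatCode := fun z =>
    RatCode.dyadicFrac (N (z.1.getD 0 ScalarCode.zero, z.2 + 1)) (z.2 + 1)
  have hq : Computable q := computable_dyadicFrac (hN.comp (by fun_prop)) (by fun_prop)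
  let out : ℕ → ℕ := fun n => (Encodable.decode n : Option (VectorCode × ℕ)).elim 0
    fun z => Encodable.encode (q z)
  have hout : Computable out := computable_option_elim (by fun_prop) (by fun_prop)
    (computable_encode (hq.comp Computable.snd))
  let G : ℕ →. ℕ := fun m => (Nat.rfind fun y =>
    (Part.some (r (m.unpair.1, m.unpair.2, y)) : Part Bool)).map fun _ => out m.unpair.2
  have hG : Nat.Partrec G := by
    refine Partrec.nat_iff.1 (Partrec.map (Partrec.rfind ?_) ?_)
    · have h : Computable fun z : ℕ × ℕ => r (z.1.unpair.1, z.1.unpair.2, z.2) :=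
        hr.comp (by fun_prop)
      exact h.partrec
    · exact (hout.comp (by fun_prop) : Computable fun z : ℕ × ℕ => out z.1.unpair.2)
  obtain ⟨c, hc⟩ := Code.exists_code.1 hG
  have heval : ∀ e n x, x ∈ Code.eval (Code.curry c e) n ↔
      (∃ y, r (e, n, y) = true) ∧ out n = x := by
    intro e n x
    rw [Code.eval_curry, hc]
    simp only [G, Nat.unpair_pair, Part.mem_map_iff, exists_and_right]
    refine and_congr_left fun _ => ?_
    refine Part.dom_iff_mem.symm.trans (Nat.rfind_dom.trans ?_)
    exact exists_congr fun y => ⟨fun h => (Part.mem_some_iff.1 h.1).symm,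
      fun h => ⟨Part.mem_some_iff.2 h.symm, fun _ => trivial⟩⟩
  refine ⟨fun e => Encodable.encode (Code.curry c e), Computable.encode.comp
    (Code.primrec₂_curry.to_comp.comp (Computable.const c) Computable.id), fun e => (hA e).trans ?_⟩
  constructor
  · intro H
    refine ⟨Unit, inferInstance, Measure.dirac (), onePointPresentation 𝕜 p, fun v k =>
      ⟨q (v, k), ?_, ?_⟩⟩
    · rw [Denumerable.ofNat_encode, heval]
      exact ⟨H _, by simp only [out, Encodable.encodek, Option.elim_some]⟩
    · rw [norm_vec_onePointPresentation]
      have h1 := hN' (v.getD 0 ScalarCode.zero) (k + 1)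
      rw [Real.rpow_one] at h1
      simp only [q]
      rw [RatCode.val_dyadicFrac]
      push_cast
      set a := ‖(v.getD 0 ScalarCode.zero).val 𝕜‖
      have h2 : (0 : ℝ) < 2 ^ (k + 1) := by positivity
      have e1 : (N (v.getD 0 ScalarCode.zero, k + 1) : ℝ) / 2 ^ (k + 1) - a =
          -(2 ^ (k + 1) * a - N (v.getD 0 ScalarCode.zero, k + 1)) / 2 ^ (k + 1) := by
        field_simp; ring
      rw [e1, abs_div, abs_neg, abs_of_pos h2, div_lt_iff₀ h2]
      have e2 : ((2 : ℝ) ^ k)⁻¹ * 2 ^ (k + 1) = 2 := by rw [pow_succ]; field_simp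
      rw [e2]
      linarith
  · rintro ⟨Ω, mΩ, μ, S, hS⟩ x
    obtain ⟨a, ha, -⟩ := hS (Denumerable.ofNat (VectorCode × ℕ) x).1
      (Denumerable.ofNat (VectorCode × ℕ) x).2
    rw [Prod.mk.eta, Denumerable.encode_ofNat, Denumerable.ofNat_encode, heval] at ha
    exact ha.1

end LpIndex

end

theorem theorem2 {𝕜 : Type*} [RCLike 𝕜] (p : ℝ) (hp : 1 ≤ p)
    (hcomp : LpIndex.IsComputableReal p) :
    LpIndex.IsPi02CompleteBaire (LpIndex.lpNames 𝕜 p hp) ∧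
      LpIndex.IsPi02CompleteNat (LpIndex.lpIndices 𝕜 p hp) :=
  ⟨⟨LpIndex.isPi02Baire_lpNames 𝕜 hp hcomp, fun _ h => LpIndex.exists_reduction_lpNames 𝕜 hp h⟩,
    LpIndex.isPi02Nat_lpIndices 𝕜 hp hcomp, fun _ h => LpIndex.exists_reduction_lpIndices 𝕜 hp h⟩
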